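/- Let $t_0<\vartheta$, $h>0$, and let $\mathrm{PC}([a,b],\mathbb R^n)$ be the set of functions $x:[a,b]\to\mathbb R^n$ for which there are $a=\xi_1<\dots<\xi_k=b$ such that $x$ is continuous on each $[\xi_i,\xi_{i+1})$ and has a finite left limit at each $\xi_{i+1}$. Put $\mathrm{PC}=\mathrm{PC}([-h,0],\mathbb R^n)$, $\mathbb G=[t_0,\vartheta]\times\mathbb R^n\times\mathrm{PC}$, $\|w\|_1=\int_{-h}^0\|w(\xi)\|\,d\xi$, $\|w\|_\infty=\sup_{[-h,0]}\|w\|$, $P(\alpha)=\{(z,w)\in\mathbb R^n\times\mathrm{PC}:\|z\|\le\alpha,\ \|w\|_\infty\le\alpha\}$, and $x_\tau(\xi)=x(\tau+\xi)$, $\xi\in[-h,0]$. Let $\mathbb U\subset\mathbb R^m$ be nonempty and compact, and let $f:[t_0,\vartheta]\times\mathbb R^n\times\mathbb R^n\times\mathbb U\to\mathbb R^n$, $f^0:[t_0,\vartheta]\times\mathbb R^n\times\mathbb R^n\times\mathbb U\to\mathbb R$, $\sigma:\mathbb R^n\times\mathrm{PC}\to\mathbb R$ satisfy: $(f_1)$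 $f,f^0$ are continuous; $(f_2)$ for every $\alpha>0$ there is $\lambda_f>0$ with $\|f(t,x,y,u)-f(t,x',y',u)\|+|f^0(t,x,y,u)-f^0(t,x',y',u)|\le\lambda_f(\|x-x'\|+\|y-y'\|)$ for all $t\in[t_0,\vartheta]$, $u\in\mathbb U$ and $x,y,x',y'$ of norm at most $\alpha$; $(f_3)$ $\|f(t,x,y,u)\|+|f^0(t,x,y,u)|\le c_f(1+\|x\|+\|y\|)$ for all $t,x,y,u$, with a constant $c_f>0$; $(\sigma)$ for every $\alpha>0$ there is $\lambda_\sigma>0$ with $|\sigma(z,w)-\sigma(z',w')|\le\lambda_\sigma(\|z-z'\|+\|w-w'\|_1)$ for all $(z,w),(z',w')\in P(\alpha)$. For $(t,z,w)\in\mathbb G$ let $\Lambda(t,z,w)$ be the set of $x\in\mathrm{PC}([t-h,\vartheta],\mathbb R^n)$ such that $x(\tau)=w(\tau-t)$ on $[t-h,t)$, $x(t)=z$, and $x$ is Lipschitz on $[t,\vartheta]$. For a measurable control $u:[t,\vartheta]\to\mathbb U$, a motion is an $x\in\Lambda(t,z,w)$ with $\dot x(\tau)=f(\tau,x(\tau),x(\tau-h),u(\tau))$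 for a.e. $\tau\in[t,\vartheta]$. The value functional is $$\rho(t,z,w)=\inf_{u}\Big(\sigma(x(\vartheta),x_\vartheta)+\int_t^\vartheta f^0(\xi,x(\xi),x(\xi-h),u(\xi))\,d\xi\Big),$$ where $u$ runs over the measurable controls on $[t,\vartheta]$ and $x$ is the motion generated by $u$. Let $H(t,x,y,s)=\min_{u\in\mathbb U}(\langle f(t,x,y,u),s\rangle+f^0(t,x,y,u))$, $F(x,y)=\{l\in\mathbb R^n:\|l\|\le c_f(1+\|x\|+\|y\|)\}$, and let $X(t,z,w)$ be the set of $x\in\Lambda(t,z,w)$ with $\dot x(\tau)\in F(x(\tau),x(\tau-h))$ for a.e. $\tau\in[t,\vartheta]$. Let $\Phi$ be the set of $\varphi:\mathbb G\to\mathbb R$ that are continuous in $t$ for fixed $(z,w)$ and such that for every $\alpha>0$ there is $\lambda_\varphi>0$ with $|\varphi(t,z,w)-\varphi(t,z',w')|\le\lambda_\varphi(\|z-z'\|+\|w-w'\|_1)$ for all $t\in[t_0,\vartheta]$ and $(z,w),(z',w')\in P(\alpha)$. The terminal condition is $\varphi(\vartheta,z,w)=\sigma(z,w)$ for all $(z,w)$.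 For $t<\vartheta$ and $l\in\mathbb R^n$, let $x^l\in\Lambda(t,z,w)$ be given by $x^l(\tau)=z+l(\tau-t)$ on $[t,\vartheta]$, let $\partial^-_l\varphi(t,z,w)$ and $\partial^+_l\varphi(t,z,w)$ in $[-\infty,+\infty]$ be the lower and the upper limit of $\big(\varphi(\tau,x^l(\tau),x^l_\tau)-\varphi(t,z,w)\big)/(\tau-t)$ as $\tau\to t+0$, and let $D^-\varphi(t,z,w)=\{(p_0,p)\in\mathbb R\times\mathbb R^n:p_0+\langle l,p\rangle\le\partial^-_l\varphi(t,z,w)\ \forall l\in\mathbb R^n\}$, $D^+\varphi(t,z,w)=\{(q_0,q)\in\mathbb R\times\mathbb R^n:q_0+\langle l,q\rangle\ge\partial^+_l\varphi(t,z,w)\ \forall l\in\mathbb R^n\}$. Theorem. Every measurable control generates a unique motion from each point of $\mathbb G$, and $\rho$ is well defined and finite. For every $\varphi:\mathbb G\to\mathbb R$ the following are equivalent: (a) $\varphi\equiv\rho$. (b) $\varphi$ is a minimax solution: $\varphi\in\Phi$, $\varphi$ satisfies the terminal condition, and for all $(t,z,w)\in\mathbb G$ with $t<\vartheta$, $\tau\in(t,\vartheta]$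 and $s\in\mathbb R^n$, $$\inf_{x\in X(t,z,w)}\omega(x)\le0\le\sup_{x\in X(t,z,w)}\omega(x),$$ where $\omega(x)=\varphi(\tau,x(\tau),x_\tau)-\varphi(t,z,w)+\int_t^\tau\big(H(\xi,x(\xi),x(\xi-h),s)-\langle\dot x(\xi),s\rangle\big)d\xi$. (c) $\varphi\in\Phi$, $\varphi$ satisfies the terminal condition, and for all $(t,z,w)\in\mathbb G$ with $t<\vartheta$ and $s\in\mathbb R^n$, $$\inf_{l\in F(z,w(-h))}\big(\partial^-_l\varphi(t,z,w)+H(t,z,w(-h),s)-\langle l,s\rangle\big)\le0\le\sup_{l\in F(z,w(-h))}\big(\partial^+_l\varphi(t,z,w)+H(t,z,w(-h),s)-\langle l,s\rangle\big).$$ (d) $\varphi$ is a viscosity solution: $\varphi\in\Phi$, $\varphi$ satisfies the terminal condition, and for all $(t,z,w)\in\mathbb G$ with $t<\vartheta$, $p_0+H(t,z,w(-h),p)\le0$ for all $(p_0,p)\in D^-\varphi(t,z,w)$ and $q_0+H(t,z,w(-h),q)\ge0$ for all $(q_0,q)\in D^+\varphi(t,z,w)$. Consequently, the minimax solution and the viscosity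 solution exist, are unique, and both coincide with $\rho$. -/

import Mathlib

open Set Filter Topology MeasureTheory

namespace DelayHJB

/-- The Euclidean space `ℝᵏ`. -/
abbrev Vec (k : ℕ) : Type := EuclideanSpace ℝ (Fin k)

/-- `x` is piecewise continuous on `[a, b]`: there are nodes `a = p 0 < p 1 < ⋯ < p N = b` such that
`x` is continuous on each `[p i, p (i+1))` and has a finite left limit at each `p (i+1)`.
Only the values of `x` on `[a, b]` matter. -/
def IsPC {n : ℕ} (a b : ℝ) (x : ℝ → Vec n) : Prop :=
  ∃ (N : ℕ) (p : ℕ → ℝ), p 0 = a ∧ p N = b ∧ (∀ i < N, p i < p (i + 1)) ∧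
    ∀ i < N, ContinuousOn x (Ico (p i) (p (i + 1))) ∧
      ∃ l : Vec n, Tendsto x (𝓝[<] (p (i + 1))) (𝓝 l)

/-- The space `PC([a, b], ℝⁿ)`. A function on `[a, b]` is represented by its extension by zero to
the whole line, so that two elements are equal iff they agree on `[a, b]`. -/
@[ext]
structure PC (n : ℕ) (a b : ℝ) where
  /-- the function, extended by zero -/
  toFun : ℝ → Vec n
  isPC : IsPC a b toFun
  zero_outside : ∀ ξ, ξ ∉ Icc a b → toFun ξ = 0

instance {n : ℕ} {a b : ℝ} : CoeFun (PC n a b) (fun _ => ℝ → Vec n) := ⟨PC.toFun⟩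

theorem IsPC.congr {n : ℕ} {a b : ℝ} {x y : ℝ → Vec n} (hx : IsPC a b x)
    (hxy : ∀ ξ ∈ Ico a b, y ξ = x ξ) : IsPC a b y := by
  obtain ⟨N, p, h0, hN, hlt, hc⟩ := hx
  have hmono : ∀ i j, i ≤ j → j ≤ N → p i ≤ p j := by
    intro i j hij
    induction j, hij using Nat.le_induction with
    | base => intro _; exact le_rfl
    | succ j _ ih => intro hj; exact (ih (by omega)).trans (hlt j (by omega)).le
  refine ⟨N, p, h0, hN, hlt, fun i hi => ?_⟩
  obtain ⟨hci, l, hl⟩ := hc i hi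
  have hsub : ∀ ξ ∈ Ico (p i) (p (i + 1)), y ξ = x ξ := by
    intro ξ hξ
    refine hxy ξ ⟨?_, ?_⟩
    · rw [← h0]; exact (hmono 0 i (by omega) hi.le).trans hξ.1
    · rw [← hN]; exact hξ.2.trans_le (hmono (i + 1) N hi le_rfl)
  refine ⟨hci.congr hsub, l, hl.congr' ?_⟩
  filter_upwards [Ico_mem_nhdsLT (hlt i hi)] with ξ hξ
  exact (hsub ξ hξ).symm

/-- Appending one more continuous piece. -/
theorem IsPC.snoc {n : ℕ} {a b c : ℝ} {x : ℝ → Vec n} (hx : IsPC a b x) (hbc : b < c)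
    (hc : ContinuousOn x (Ico b c)) (hl : ∃ l : Vec n, Tendsto x (𝓝[<] c) (𝓝 l)) :
    IsPC a c x := by
  obtain ⟨N, p, h0, hN, hlt, hp⟩ := hx
  refine ⟨N + 1, fun i => if i ≤ N then p i else c, by simp [h0], by simp, ?_, ?_⟩
  · intro i hi
    rcases Nat.lt_succ_iff_lt_or_eq.1 hi with h | rfl
    · simpa [h.le, Nat.succ_le_of_lt h] using hlt i h
    · simpa [hN] using hbc
  · intro i hi
    rcases Nat.lt_succ_iff_lt_or_eq.1 hi with h | rfl
    · simpa [h.le, Nat.succ_le_of_lt h] using hp i h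
    · simpa [hN] using ⟨hc, hl⟩

/-- Piecewise continuity is inherited by subintervals. -/
theorem IsPC.mono {n : ℕ} {a b c d : ℝ} {x : ℝ → Vec n} (hx : IsPC a b x) (hac : a ≤ c)
    (hcd : c < d) (hdb : d ≤ b) : IsPC c d x := by
  obtain ⟨N, p, h0, hN, hlt, hp⟩ := hx
  have key : ∀ M ≤ N, c ≤ min d (p M) → IsPC c (min d (p M)) x := by
    intro M
    induction M with
    | zero =>
      intro _ h
      have : min d (p 0) = c := le_antisymm ((min_le_right _ _).trans (h0.trans_le hac)) h
      rw [this]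
      exact ⟨0, fun _ => c, rfl, rfl, by simp, by simp⟩
    | succ M ih =>
      intro hM h
      have hM' : M < N := hM
      obtain ⟨hcM, l, hl⟩ := hp M hM'
      have hltM := hlt M hM'
      -- the new piece, from any point `e ≥ p M` below `min d (p (M+1))`
      have hlim : p M < min d (p (M + 1)) →
          ∃ l : Vec n, Tendsto x (𝓝[<] (min d (p (M + 1)))) (𝓝 l) := by
        intro hlt'
        rcases le_or_gt (p (M + 1)) d with h1 | h1
        · rw [min_eq_right h1]; exact ⟨l, hl⟩
        · rw [min_eq_left h1.le] at hlt' ⊢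
          refine ⟨x d, ?_⟩
          have : ContinuousAt x d := (hcM d ⟨hlt'.le, h1⟩).continuousAt (Ico_mem_nhds hlt' h1)
          exact this.tendsto.mono_left nhdsWithin_le_nhds
      have hcont : ∀ e, p M ≤ e → ContinuousOn x (Ico e (min d (p (M + 1)))) := fun e he =>
        hcM.mono (Ico_subset_Ico he (min_le_right _ _))
      rcases le_or_gt d (p M) with h1 | h1
      · have e1 : min d (p (M + 1)) = min d (p M) := by
          rw [min_eq_left h1, min_eq_left (h1.trans hltM.le)]
        rw [e1] at h ⊢
        exact ih hM'.le h
      · have hlt' : p M < min d (p (M + 1)) := lt_min h1 hltM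
        rcases le_or_gt c (p M) with h2 | h2
        · have := ih hM'.le (le_min hcd.le h2)
          rw [min_eq_right h1.le] at this
          exact this.snoc hlt' (hcont _ le_rfl) (hlim hlt')
        · have h3 : IsPC c c x := ⟨0, fun _ => c, rfl, rfl, by simp, by simp⟩
          rcases h.lt_or_eq with h4 | h4
          · exact h3.snoc h4 (hcont _ h2.le) (hlim hlt')
          · rw [← h4]; exact h3
  have := key N le_rfl (by rw [hN, min_eq_left hdb]; exact hcd.le)
  rwa [hN, min_eq_left hdb] at this

/-- Piecewise continuity is invariant under translations. -/
theorem IsPC.shift {n : ℕ} {a b : ℝ} {x : ℝ → Vec n} (hx : IsPC a b x) (τ : ℝ) :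
    IsPC (a - τ) (b - τ) (fun ξ => x (τ + ξ)) := by
  obtain ⟨N, p, h0, hN, hlt, hp⟩ := hx
  refine ⟨N, fun i => p i - τ, by simp [h0], by simp [hN],
    fun i hi => sub_lt_sub_right (hlt i hi) τ, fun i hi => ?_⟩
  obtain ⟨hc, l, hl⟩ := hp i hi
  refine ⟨hc.comp (by fun_prop) ?_, l, hl.comp ?_⟩
  · intro ξ hξ
    exact ⟨by linarith [hξ.1], by linarith [hξ.2]⟩
  · refine tendsto_nhdsWithin_iff.2 ⟨?_, ?_⟩
    · have : Tendsto (fun ξ : ℝ => τ + ξ) (𝓝 (p (i + 1) - τ)) (𝓝 (τ + (p (i + 1) - τ))) :=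
        (by fun_prop : Continuous fun ξ : ℝ => τ + ξ).tendsto _
      rw [add_sub_cancel] at this
      exact this.mono_left nhdsWithin_le_nhds
    · filter_upwards [self_mem_nhdsWithin] with ξ hξ
      have : ξ < p (i + 1) - τ := hξ
      exact (by linarith : τ + ξ < p (i + 1))

/-- The time interval `[t₀, ϑ]` and the delay `h`. -/
structure Horizon where
  t₀ : ℝ
  ϑ : ℝ
  h : ℝ
  t₀_lt : t₀ < ϑ
  h_pos : 0 < h

/-- The space `PC = PC([-h, 0], ℝⁿ)` of histories. -/
abbrev Hist (n : ℕ) (T : Horizon) : Type := PC n (-T.h) 0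

/-- The domain `𝔾 = [t₀, ϑ] × ℝⁿ × PC`. -/
@[ext]
structure Pt (n : ℕ) (T : Horizon) where
  t : ℝ
  mem : t ∈ Icc T.t₀ T.ϑ
  z : Vec n
  w : Hist n T

/-- The norm `‖·‖₁` on `PC([-h, 0], ℝⁿ)`. -/
noncomputable def norm1 {n : ℕ} (T : Horizon) (r : ℝ → Vec n) : ℝ :=
  ∫ ξ in (-T.h)..0, ‖r ξ‖

/-- The set `P(α)` of the pairs `(z, w)` with `‖z‖ ≤ α` and `‖w‖_∞ ≤ α`. -/
def bounded (n : ℕ) (T : Horizon) (α : ℝ) : Set (Vec n × Hist n T) :=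
  {q | ‖q.1‖ ≤ α ∧ ∀ ξ ∈ Icc (-T.h) 0, ‖q.2 ξ‖ ≤ α}

/-- The segment `x_τ ∈ PC([-h, 0], ℝⁿ)`, `x_τ(ξ) = x(τ + ξ)`, of `x ∈ PC([t - h, ϑ], ℝⁿ)`. -/
noncomputable def seg {n : ℕ} {T : Horizon} {t : ℝ} (x : PC n (t - T.h) T.ϑ) (τ : Icc t T.ϑ) :
    Hist n T where
  toFun := (Icc (-T.h) 0).indicator (fun ξ => x (τ + ξ))
  isPC := by
    have h1 : IsPC ((τ : ℝ) - T.h) τ x :=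
      x.isPC.mono (by linarith [τ.2.1]) (by linarith [T.h_pos]) τ.2.2
    have h2 := h1.shift (τ : ℝ)
    have e1 : (τ : ℝ) - T.h - τ = -T.h := by ring
    rw [e1, sub_self] at h2
    exact h2.congr fun ξ hξ => indicator_of_mem (Ico_subset_Icc_self hξ) _
  zero_outside := fun ξ hξ => indicator_of_notMem hξ _

/-- The point `(τ, x(τ), x_τ) ∈ 𝔾`, for `x ∈ PC([t - h, ϑ], ℝⁿ)` with `t ≥ t₀` and
`τ ∈ [t, ϑ]`. -/
noncomputable def Pt.along {n : ℕ} {T : Horizon} (g : Pt n T) (x : PC n (g.t - T.h) T.ϑ)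
    (τ : Icc g.t T.ϑ) : Pt n T where
  t := τ
  mem := ⟨g.mem.1.trans τ.2.1, τ.2.2⟩
  z := x τ
  w := seg x τ

/-- The set `Λ(t, z, w)`. -/
def Lam {n : ℕ} {T : Horizon} (g : Pt n T) : Set (PC n (g.t - T.h) T.ϑ) :=
  {x | (∀ τ ∈ Ico (g.t - T.h) g.t, x τ = g.w (τ - g.t)) ∧
    x g.t = g.z ∧ ∃ K : NNReal, LipschitzOnWith K x (Icc g.t T.ϑ)}

/-- The function `x^l ∈ Λ(t, z, w)` with `x^l(τ) = z + l (τ - t)` for `τ ∈ [t, ϑ]`. -/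
noncomputable def line {n : ℕ} {T : Horizon} (g : Pt n T) (l : Vec n) :
    PC n (g.t - T.h) T.ϑ where
  toFun := (Icc (g.t - T.h) T.ϑ).indicator
    (fun τ => if τ < g.t then g.w (τ - g.t) else g.z + (τ - g.t) • l)
  isPC := by
    have h0 := g.w.isPC.shift (-g.t)
    have e1 : -T.h - -g.t = g.t - T.h := by ring
    have e2 : (0 : ℝ) - -g.t = g.t := by ring
    rw [e1, e2] at h0
    have h1 : IsPC (g.t - T.h) g.t ((Icc (g.t - T.h) T.ϑ).indicator
        (fun τ => if τ < g.t then g.w (τ - g.t) else g.z + (τ - g.t) • l)) := by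
      refine h0.congr fun τ hτ => ?_
      have hm : τ ∈ Icc (g.t - T.h) T.ϑ := ⟨hτ.1, hτ.2.le.trans g.mem.2⟩
      rw [indicator_of_mem hm, if_pos hτ.2, neg_add_eq_sub]
    rcases g.mem.2.lt_or_eq with h2 | h2
    · have hEq : EqOn ((Icc (g.t - T.h) T.ϑ).indicator
          (fun τ => if τ < g.t then g.w (τ - g.t) else g.z + (τ - g.t) • l))
          (fun τ => g.z + (τ - g.t) • l) (Ico g.t T.ϑ) := by
        intro τ hτ
        have hm : τ ∈ Icc (g.t - T.h) T.ϑ := ⟨by linarith [hτ.1, T.h_pos], hτ.2.le⟩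
        rw [indicator_of_mem hm, if_neg (not_lt.2 hτ.1)]
      have hcont : Continuous fun τ : ℝ => g.z + (τ - g.t) • l := by fun_prop
      refine h1.snoc h2 (hcont.continuousOn.congr hEq) ⟨g.z + (T.ϑ - g.t) • l, ?_⟩
      refine ((hcont.tendsto T.ϑ).mono_left nhdsWithin_le_nhds).congr' ?_
      filter_upwards [Ico_mem_nhdsLT h2] with τ hτ
      exact (hEq hτ).symm
    · rw [h2] at h1 ⊢
      exact h1
  zero_outside := fun ξ hξ => indicator_of_notMem hξ _

/-- The data of the Bolza problem: the set `U ⊂ ℝᵐ`, the right-hand side `f(t, x, y, u)`, the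
running cost `f⁰(t, x, y, u)` and the terminal cost `σ(z, w)`. Only the values of `f`, `f⁰` for
`t ∈ [t₀, ϑ]` and `u ∈ U` matter. -/
structure Bolza (n m : ℕ) (T : Horizon) where
  U : Set (Vec m)
  f : ℝ → Vec n → Vec n → Vec m → Vec n
  f0 : ℝ → Vec n → Vec n → Vec m → ℝ
  σ : Vec n → Hist n T → ℝ

namespace Bolza

variable {n m : ℕ} {T : Horizon}

/-- Condition `(f₁)`: joint continuity of `f` and `f⁰`. -/
def CondF1 (P : Bolza n m T) : Prop :=
  ContinuousOn (fun q : ℝ × Vec n × Vec n × Vec m => P.f q.1 q.2.1 q.2.2.1 q.2.2.2)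
      (Icc T.t₀ T.ϑ ×ˢ univ ×ˢ univ ×ˢ P.U) ∧
    ContinuousOn (fun q : ℝ × Vec n × Vec n × Vec m => P.f0 q.1 q.2.1 q.2.2.1 q.2.2.2)
      (Icc T.t₀ T.ϑ ×ˢ univ ×ˢ univ ×ˢ P.U)

/-- Condition `(f₂)`: local Lipschitz continuity in `(x, y)`. -/
def CondF2 (P : Bolza n m T) : Prop :=
  ∀ α > 0, ∃ lam > 0, ∀ t ∈ Icc T.t₀ T.ϑ, ∀ x y x' y' : Vec n,
    ‖x‖ ≤ α → ‖y‖ ≤ α → ‖x'‖ ≤ α → ‖y'‖ ≤ α → ∀ u ∈ P.U,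
      ‖P.f t x y u - P.f t x' y' u‖ + |P.f0 t x y u - P.f0 t x' y' u|
        ≤ lam * (‖x - x'‖ + ‖y - y'‖)

/-- Condition `(f₃)` with the constant `c`: sublinear growth. -/
def CondF3 (P : Bolza n m T) (c : ℝ) : Prop :=
  ∀ t ∈ Icc T.t₀ T.ϑ, ∀ x y : Vec n, ∀ u ∈ P.U,
    ‖P.f t x y u‖ + |P.f0 t x y u| ≤ c * (1 + ‖x‖ + ‖y‖)

/-- Condition `(σ)`. -/
def CondSigma (P : Bolza n m T) : Prop :=
  ∀ α > 0, ∃ lam > 0, ∀ z z' : Vec n, ∀ w w' : Hist n T,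
    (z, w) ∈ bounded n T α → (z', w') ∈ bounded n T α →
      |P.σ z w - P.σ z' w'| ≤ lam * (‖z - z'‖ + norm1 T (fun ξ => w ξ - w' ξ))

/-- The set `𝔘(t)` of the (Lebesgue) measurable controls `u : [t, ϑ] → U`. The values of `u`
outside `[t, ϑ]` are irrelevant. -/
def controls (P : Bolza n m T) (t : ℝ) : Set (ℝ → Vec m) :=
  {u | AEMeasurable u (volume.restrict (Icc t T.ϑ)) ∧ ∀ τ ∈ Icc t T.ϑ, u τ ∈ P.U}

/-- `x` is a motion `x(· | t, z, w, u)` of the delay system. -/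
def IsMotion (P : Bolza n m T) (g : Pt n T) (u : ℝ → Vec m) (x : PC n (g.t - T.h) T.ϑ) : Prop :=
  x ∈ Lam g ∧ ∀ᵐ τ ∂(volume.restrict (Icc g.t T.ϑ)),
    HasDerivAt x (P.f τ (x τ) (x (τ - T.h)) (u τ)) τ

/-- The Bolza cost of the control `u` with the motion `x`. -/
noncomputable def cost (P : Bolza n m T) (g : Pt n T) (u : ℝ → Vec m)
    (x : PC n (g.t - T.h) T.ϑ) : ℝ :=
  P.σ (x T.ϑ) (seg x ⟨T.ϑ, g.mem.2, le_rfl⟩) +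
    ∫ ξ in g.t..T.ϑ, P.f0 ξ (x ξ) (x (ξ - T.h)) (u ξ)

/-- The set of the values `J(t, z, w, u)`, `u ∈ 𝔘(t)`. -/
def costs (P : Bolza n m T) (g : Pt n T) : Set ℝ :=
  {c | ∃ u ∈ P.controls g.t, ∃ x, P.IsMotion g u x ∧ c = P.cost g u x}

/-- The value functional `ρ`. -/
noncomputable def value (P : Bolza n m T) (g : Pt n T) : ℝ := sInf (P.costs g)

/-- The Hamiltonian `H(t, x, y, s)`; the minimum over `U` is written as an infimum. -/
noncomputable def H (P : Bolza n m T) (t : ℝ) (x y s : Vec n) : ℝ :=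
  sInf ((fun u => inner ℝ (P.f t x y u) s + P.f0 t x y u) '' P.U)

/-- The terminal condition `φ(ϑ, z, w) = σ(z, w)`. -/
def Terminal (P : Bolza n m T) (φ : Pt n T → ℝ) : Prop :=
  ∀ (z : Vec n) (w : Hist n T), φ ⟨T.ϑ, ⟨T.t₀_lt.le, le_rfl⟩, z, w⟩ = P.σ z w

end Bolza

section Solutions

variable {n m : ℕ} {T : Horizon}

/-- The class `Φ`. -/
def InPhi (φ : Pt n T → ℝ) : Prop :=
  (∀ (z : Vec n) (w : Hist n T), Continuous fun t : Icc T.t₀ T.ϑ => φ ⟨t, t.2, z, w⟩) ∧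
  ∀ α > 0, ∃ lam > 0, ∀ (t : ℝ) (ht : t ∈ Icc T.t₀ T.ϑ) (z z' : Vec n) (w w' : Hist n T),
    (z, w) ∈ bounded n T α → (z', w') ∈ bounded n T α →
      |φ ⟨t, ht, z, w⟩ - φ ⟨t, ht, z', w'⟩| ≤
        lam * (‖z - z'‖ + norm1 T (fun ξ => w ξ - w' ξ))

/-- The set `F(x, y)`, with the constant `c` of the growth condition. -/
def F (c : ℝ) (x y : Vec n) : Set (Vec n) := {l | ‖l‖ ≤ c * (1 + ‖x‖ + ‖y‖)}

/-- The set `X(t, z, w)` of the solutions of the delay differential inclusion. -/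
def X (c : ℝ) (g : Pt n T) : Set (PC n (g.t - T.h) T.ϑ) :=
  {x | x ∈ Lam g ∧ ∀ᵐ τ ∂(volume.restrict (Icc g.t T.ϑ)),
    ∃ l ∈ F c (x τ) (x (τ - T.h)), HasDerivAt x l τ}

/-- The expression under the infimum and the supremum in the definition of a minimax solution. -/
noncomputable def minimaxGap (P : Bolza n m T) (φ : Pt n T → ℝ) (g : Pt n T) (τ : Icc g.t T.ϑ)
    (s : Vec n) (x : PC n (g.t - T.h) T.ϑ) : ℝ :=
  φ (g.along x τ) - φ g +
    ∫ ξ in g.t..τ, (P.H ξ (x ξ) (x (ξ - T.h)) s - inner ℝ (deriv x ξ) s)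

/-- Minimax solutions of the Cauchy problem. Infima and suprema are taken in `[-∞, +∞]`. -/
def IsMinimaxSolution (P : Bolza n m T) (c : ℝ) (φ : Pt n T → ℝ) : Prop :=
  InPhi φ ∧ P.Terminal φ ∧
    ∀ (g : Pt n T) (τ : Icc g.t T.ϑ) (s : Vec n), g.t < T.ϑ → g.t < τ →
      (⨅ x ∈ X c g, ((minimaxGap P φ g τ s x : ℝ) : EReal)) ≤ 0 ∧
      0 ≤ ⨆ x ∈ X c g, ((minimaxGap P φ g τ s x : ℝ) : EReal)

/-- The difference quotient of `φ` at `(t, z, w)` along `x^l`. -/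
noncomputable def quotient (φ : Pt n T → ℝ) (g : Pt n T) (l : Vec n) (τ : Icc g.t T.ϑ) : EReal :=
  (((φ (g.along (line g l) τ) - φ g) / ((τ : ℝ) - g.t) : ℝ) : EReal)

/-- The lower right directional derivative `∂⁻_l φ(t, z, w) ∈ [-∞, +∞]` (for `t < ϑ`). -/
noncomputable def lowerDeriv (φ : Pt n T → ℝ) (g : Pt n T) (l : Vec n) : EReal :=
  liminf (quotient φ g l) (comap Subtype.val (𝓝[>] g.t))

/-- The upper right directional derivative `∂⁺_l φ(t, z, w) ∈ [-∞, +∞]` (for `t < ϑ`). -/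
noncomputable def upperDeriv (φ : Pt n T → ℝ) (g : Pt n T) (l : Vec n) : EReal :=
  limsup (quotient φ g l) (comap Subtype.val (𝓝[>] g.t))

/-- The subdifferential `D⁻φ(t, z, w)`. -/
def subdiff (φ : Pt n T → ℝ) (g : Pt n T) : Set (ℝ × Vec n) :=
  {p | ∀ l : Vec n, ((p.1 + inner ℝ l p.2 : ℝ) : EReal) ≤ lowerDeriv φ g l}

/-- The superdifferential `D⁺φ(t, z, w)`. -/
def superdiff (φ : Pt n T → ℝ) (g : Pt n T) : Set (ℝ × Vec n) :=
  {q | ∀ l : Vec n, upperDeriv φ g l ≤ ((q.1 + inner ℝ l q.2 : ℝ) : EReal)}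

/-- `φ ∈ Φ` satisfies the terminal condition and the inequalities for the directional
derivatives. -/
def SatisfiesDerivIneqs (P : Bolza n m T) (c : ℝ) (φ : Pt n T → ℝ) : Prop :=
  InPhi φ ∧ P.Terminal φ ∧
    ∀ (g : Pt n T) (s : Vec n), g.t < T.ϑ →
      (⨅ l ∈ F c g.z (g.w (-T.h)),
        lowerDeriv φ g l + ((P.H g.t g.z (g.w (-T.h)) s - inner ℝ l s : ℝ) : EReal)) ≤ 0 ∧
      0 ≤ ⨆ l ∈ F c g.z (g.w (-T.h)),
        upperDeriv φ g l + ((P.H g.t g.z (g.w (-T.h)) s - inner ℝ l s : ℝ) : EReal)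

/-- Viscosity solutions of the Cauchy problem. -/
def IsViscositySolution (P : Bolza n m T) (φ : Pt n T → ℝ) : Prop :=
  InPhi φ ∧ P.Terminal φ ∧
    ∀ g : Pt n T, g.t < T.ϑ →
      (∀ p ∈ subdiff φ g, p.1 + P.H g.t g.z (g.w (-T.h)) p.2 ≤ 0) ∧
      (∀ q ∈ superdiff φ g, 0 ≤ q.1 + P.H g.t g.z (g.w (-T.h)) q.2)

end Solutions

end DelayHJB

open DelayHJB

/-!
The four properties of `φ` are proved equivalent in a cycle: the value functional is a minimax
solution, a minimax solution satisfies the inequalities for directional derivatives, these imply the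
viscosity inequalities, and a viscosity solution equals the value functional.

*Motions and the value functional.* The delayed state at a time is an earlier value of the
path, so each control generates a unique motion by a Picard contraction in an exponentially weighted
norm (`Bolza.Regular.existsUnique_isMotion`). Splicing controls gives the dynamic programming
principle (`Bolza.Regular.integral_run_add_value_le_J`,
`Bolza.Regular.value_le_integral_run_add_value`), and Gronwall's inequality the regularity of the
value functional (`Bolza.Regular.inPhi_value`).

*Value functional ⇒ minimax solution* (`Bolza.Regular.isMinimaxSolution_value`). The lower
inequality holds because `H ≤ ⟪f, s⟫ + f⁰` along every control. For the upper one, a measurable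
control is needed that almost attains the minimum in `H(·, s)` along its own motion. It is
concatenated from constant controls on short intervals; a maximality argument
(`Bolza.Regular.exists_control_of_local`) replaces a measurable selection theorem.

*Minimax ⇒ directional derivatives ⇒ viscosity* (`IsMinimaxSolution.satisfiesDerivIneqs`,
`SatisfiesDerivIneqs.isViscositySolution`). The average velocities of elements of `X(t, z, w)` over
shrinking intervals accumulate at a direction in `F(z, w(-h))`, and straight lines may replace the
paths because the histories differ by a second-order quantity in `‖·‖₁`. The second implication is
the choice `s = p`.

*Viscosity ⇒ value functional* (`IsViscositySolution.eq_value`). The engine is a multidirectional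
mean value inequality (`exists_decrease_of_subdiff`): if the subgradients of `φ` near a point are
nonpositive in some direction of a convex compact set, then `φ` almost decreases in one of these
directions. It comes from minimising a penalised finite-dimensional function, the history being
frozen along the constant extension of the path. Applied to the convex hull of the velocities and
running costs, it yields short-time controls along which `φ` plus the running cost almost decreases;
concatenated, they give `ρ ≤ φ` (`Bolza.Regular.value_le_of_subdiff`). Applied to `-φ` and a single
velocity, it bounds the rate of decrease of `φ` along every motion by the running cost, so that `φ`
is at most the cost of every control (`Bolza.Regular.le_J_of_superdiff`).
-/

namespace DelayHJB

/-! ### Piecewise continuous functions -/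

theorem exists_mem_Ico_of_nodes {p : ℕ → ℝ} {ξ : ℝ} {N : ℕ} (hξ : ξ ∈ Ico (p 0) (p N)) :
    ∃ i < N, ξ ∈ Ico (p i) (p (i + 1)) := by
  induction N with
  | zero => exact absurd (hξ.1.trans_lt hξ.2) (lt_irrefl _)
  | succ N ih =>
    rcases lt_or_ge ξ (p N) with h | h
    · obtain ⟨i, hi, h'⟩ := ih ⟨hξ.1, h⟩
      exact ⟨i, by omega, h'⟩
    · exact ⟨N, by omega, h, hξ.2⟩

theorem IsPC.exists_bound {n : ℕ} {a b : ℝ} {x : ℝ → Vec n} (hx : IsPC a b x) :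
    ∃ B, ∀ ξ ∈ Ico a b, ‖x ξ‖ ≤ B := by
  obtain ⟨N, p, rfl, rfl, hlt, hp⟩ := hx
  have key : ∀ i, ∃ B, 0 ≤ B ∧ (i < N → ∀ ξ ∈ Ico (p i) (p (i + 1)), ‖x ξ‖ ≤ B) := by
    intro i
    by_cases hi : i < N
    · obtain ⟨hc, l, hl⟩ := hp i hi
      have h1 : ∀ᶠ ξ in 𝓝[<] (p (i + 1)), ‖x ξ‖ < ‖l‖ + 1 :=
        hl.norm.eventually (gt_mem_nhds (by linarith))
      obtain ⟨d, hd, hd'⟩ := (mem_nhdsLT_iff_exists_Ioo_subset' (hlt i hi)).1 h1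
      obtain ⟨B, hB⟩ := (isCompact_Icc (a := p i) (b := d)).exists_bound_of_continuousOn
        (hc.mono fun ξ hξ => ⟨hξ.1, hξ.2.trans_lt hd⟩)
      refine ⟨max B (‖l‖ + 1), le_max_of_le_right (by positivity), fun _ ξ hξ => ?_⟩
      rcases le_or_gt ξ d with h | h
      · exact (hB ξ ⟨hξ.1, h⟩).trans (le_max_left _ _)
      · exact (le_of_lt (hd' ⟨h, hξ.2⟩)).trans (le_max_right _ _)
    · exact ⟨0, le_rfl, fun h => absurd h hi⟩
  choose B hB0 hB using key
  refine ⟨∑ i ∈ Finset.range N, B i, fun ξ hξ => ?_⟩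
  obtain ⟨i, hi, hm⟩ := exists_mem_Ico_of_nodes hξ
  exact (hB i hi ξ hm).trans
    (Finset.single_le_sum (f := B) (fun j _ => hB0 j) (Finset.mem_range.2 hi))

theorem IsPC.measurable_indicator {n : ℕ} {a b : ℝ} {x : ℝ → Vec n} (hx : IsPC a b x) :
    Measurable ((Ico a b).indicator x) := by
  obtain ⟨N, p, rfl, rfl, hlt, hp⟩ := hx
  have key : ∀ M ≤ N, p 0 ≤ p M ∧ Measurable ((Ico (p 0) (p M)).indicator x) := by
    intro M
    induction M with
    | zero => intro _; simp
    | succ M ih =>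
      intro hM
      obtain ⟨h0, hm⟩ := ih (by omega)
      have hlM := hlt M hM
      refine ⟨h0.trans hlM.le, ?_⟩
      rw [← Ico_union_Ico_eq_Ico h0 hlM.le,
        indicator_union_of_disjoint (by
          rw [Set.disjoint_left]; intro ξ h1 h2; exact absurd h1.2 (not_lt.2 h2.1))]
      refine hm.add ?_
      classical
      rw [← piecewise_eq_indicator]
      exact (hp M hM).1.measurable_piecewise continuousOn_const measurableSet_Ico
  exact (key N le_rfl).2

namespace PC

variable {n : ℕ} {a b : ℝ} (x : PC n a b)

theorem exists_bound : ∃ B, 0 ≤ B ∧ ∀ ξ, ‖x ξ‖ ≤ B := by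
  obtain ⟨B, hB⟩ := x.isPC.exists_bound
  refine ⟨max B 0 + ‖x b‖, by positivity, fun ξ => ?_⟩
  by_cases h : ξ ∈ Icc a b
  · rcases h.2.lt_or_eq with h' | rfl
    · have := hB ξ ⟨h.1, h'⟩
      have := le_max_left B 0
      have := norm_nonneg (x b)
      linarith
    · have := le_max_right B 0
      linarith
  · rw [x.zero_outside ξ h, norm_zero]
    positivity

protected theorem measurable : Measurable x := by
  have h := x.isPC.measurable_indicator
  have e : x.toFun = ({b} : Set ℝ).piecewise (fun _ => x b) ((Ico a b).indicator x) := by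
    funext ξ
    by_cases hb : ξ = b
    · subst hb; simp
    · rw [piecewise_eq_of_notMem _ _ _ (by simpa using hb)]
      by_cases h : ξ ∈ Ico a b
      · rw [indicator_of_mem h]
      · rw [indicator_of_notMem h]
        exact x.zero_outside ξ fun h' => h ⟨h'.1, lt_of_le_of_ne h'.2 hb⟩
  rw [e]
  classical
  exact Measurable.piecewise (measurableSet_singleton b) measurable_const h

theorem continuousWithinAt_Ici {ξ : ℝ} (hξ : ξ ∈ Ico a b) : ContinuousWithinAt x (Ici ξ) ξ := by
  obtain ⟨N, p, h0, hN, hlt, hp⟩ := x.isPC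
  obtain ⟨i, hi, hm⟩ := exists_mem_Ico_of_nodes (p := p) (N := N) (ξ := ξ) (by rwa [h0, hN])
  have h1 := (hp i hi).1 ξ hm
  refine h1.mono_of_mem_nhdsWithin ?_
  exact mem_of_superset (Ico_mem_nhdsGE hm.2) (Ico_subset_Ico_left hm.1)

/-- A piecewise continuous function is discontinuous at the nodes only, which are countably many. -/
theorem ae_continuousAt : ∀ᵐ ξ, ContinuousAt x ξ := by
  obtain ⟨N, p, h0, hN, hlt, hp⟩ := x.isPC
  have hc : (range p).Countable := countable_range p
  filter_upwards [hc.ae_notMem volume] with ξ hξ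
  have hξ' : ∀ i, ξ ≠ p i := fun i h => hξ ⟨i, h.symm⟩
  by_cases h : ξ ∈ Icc a b
  · have hb : ξ < b := lt_of_le_of_ne h.2 (hN ▸ hξ' N)
    obtain ⟨i, hi, hm⟩ := exists_mem_Ico_of_nodes (p := p) (N := N) (ξ := ξ)
      (by rw [h0, hN]; exact ⟨h.1, hb⟩)
    exact ((hp i hi).1 ξ hm).continuousAt
      (Ico_mem_nhds (lt_of_le_of_ne hm.1 (hξ' i).symm) hm.2)
  · have : x.toFun =ᶠ[𝓝 ξ] fun _ => 0 := by
      filter_upwards [isClosed_Icc.isOpen_compl.mem_nhds h] with η hη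
      exact x.zero_outside η hη
    exact continuousAt_const.congr this.symm

/-- The integral `∫ ‖x(τ + ξ) - x(τ' + ξ)‖ dξ` tends to zero as `τ' → τ`. -/
theorem tendsto_integral_shift (c d τ : ℝ) :
    Tendsto (fun τ' => ∫ ξ in c..d, ‖x (τ' + ξ) - x (τ + ξ)‖) (𝓝 τ) (𝓝 0) := by
  obtain ⟨B, hB0, hB⟩ := x.exists_bound
  have h0 : (0 : ℝ) = ∫ ξ in c..d, (0 : ℝ) := by simp
  rw [h0]
  refine intervalIntegral.tendsto_integral_filter_of_dominated_convergence (fun _ => 2 * B) ?_ ?_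
    (by simp) ?_
  · refine Eventually.of_forall fun τ' => Measurable.aestronglyMeasurable ?_
    exact ((x.measurable.comp (measurable_const_add τ')).sub
      (x.measurable.comp (measurable_const_add τ))).norm
  · refine Eventually.of_forall fun τ' => Eventually.of_forall fun ξ _ => ?_
    rw [norm_norm]
    exact (norm_sub_le _ _).trans (by linarith [hB (τ' + ξ), hB (τ + ξ)])
  · have h1 : ∀ᵐ ξ, ContinuousAt x (τ + ξ) :=
      (measurePreserving_add_left volume τ).quasiMeasurePreserving.ae x.ae_continuousAt
    filter_upwards [h1] with ξ hξ _
    have h2 : Tendsto (fun τ' => x (τ' + ξ)) (𝓝 τ) (𝓝 (x (τ + ξ))) :=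
      hξ.tendsto.comp ((by fun_prop : Continuous fun τ' : ℝ => τ' + ξ).tendsto τ)
    simpa using (h2.sub_const (x (τ + ξ))).norm

theorem intervalIntegrable_norm_sub {a' b' : ℝ} (y : PC n a' b') (c d : ℝ) :
    IntervalIntegrable (fun ξ => ‖x ξ - y ξ‖) volume c d := by
  obtain ⟨B, -, hB⟩ := x.exists_bound
  obtain ⟨B', -, hB'⟩ := y.exists_bound
  refine (intervalIntegrable_const (c := B + B')).mono_fun
    ((x.measurable.sub y.measurable).norm.aestronglyMeasurable)
    (Eventually.of_forall fun ξ => ?_)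
  simp only [Real.norm_eq_abs, abs_norm]
  exact ((norm_sub_le _ _).trans (add_le_add (hB ξ) (hB' ξ))).trans (le_abs_self _)

end PC

/-! ### Histories and the norm `‖·‖₁` -/

section Histories

variable {n : ℕ} {T : Horizon}

theorem seg_apply {t : ℝ} (x : PC n (t - T.h) T.ϑ) (τ : Icc t T.ϑ) {ξ : ℝ}
    (hξ : ξ ∈ Icc (-T.h) 0) : seg x τ ξ = x (τ + ξ) := by
  simp only [seg, indicator_of_mem hξ]

theorem norm1_congr {r r' : ℝ → Vec n} (h : ∀ ξ ∈ Icc (-T.h) 0, ‖r ξ‖ = ‖r' ξ‖) :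
    norm1 T r = norm1 T r' := by
  refine intervalIntegral.integral_congr fun ξ hξ => ?_
  rw [uIcc_of_le (by linarith [T.h_pos])] at hξ
  exact h ξ hξ

theorem norm1_nonneg (r : ℝ → Vec n) : 0 ≤ norm1 T r :=
  intervalIntegral.integral_nonneg (by linarith [T.h_pos]) fun _ _ => norm_nonneg _

theorem norm1_sub_comm (w w' : Hist n T) :
    norm1 T (fun ξ => w ξ - w' ξ) = norm1 T (fun ξ => w' ξ - w ξ) :=
  norm1_congr fun _ _ => norm_sub_rev _ _

/-- Histories that differ by at most `D` in norm and only on the final piece `[-δ, 0]`. -/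
theorem norm1_sub_le_of_eq {w w' : Hist n T} {δ D : ℝ} (hδ : 0 ≤ δ) (hD : 0 ≤ D)
    (h1 : ∀ ξ ∈ Ico (-T.h) (-δ), w ξ = w' ξ)
    (h2 : ∀ ξ ∈ Ico (-T.h) 0, -δ ≤ ξ → ‖w ξ - w' ξ‖ ≤ D) :
    norm1 T (fun ξ => w ξ - w' ξ) ≤ D * δ := by
  have hh := T.h_pos
  unfold norm1
  rw [intervalIntegral.integral_of_le (by linarith)]
  have hi : IntegrableOn (fun ξ => ‖w ξ - w' ξ‖) (Ioc (-T.h) 0) :=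
    (intervalIntegrable_iff_integrableOn_Ioc_of_le (by linarith)).1
      (w.intervalIntegrable_norm_sub w' _ _)
  rw [integral_Ioc_eq_integral_Ioo]
  have hI : IntegrableOn ((Icc (-δ) 0).indicator fun _ => D) (Ioo (-T.h) 0) :=
    ((integrable_indicator_iff measurableSet_Icc).2
      (integrableOn_const (by simp))).integrableOn
  calc ∫ ξ in Ioo (-T.h) 0, ‖w ξ - w' ξ‖
      ≤ ∫ ξ in Ioo (-T.h) 0, (Icc (-δ) 0).indicator (fun _ => D) ξ := by
        refine setIntegral_mono_on (hi.mono_set Ioo_subset_Ioc_self) hI measurableSet_Ioo ?_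
        intro ξ hξ
        rcases lt_or_ge ξ (-δ) with h | h
        · rw [h1 ξ ⟨hξ.1.le, h⟩, sub_self, norm_zero]
          exact indicator_nonneg (fun _ _ => hD) _
        · rw [indicator_of_mem (show ξ ∈ Icc (-δ) 0 from ⟨h, hξ.2.le⟩)]
          exact h2 ξ ⟨hξ.1.le, hξ.2⟩ h
    _ ≤ ∫ ξ, (Icc (-δ) 0).indicator (fun _ => D) ξ := by
        refine setIntegral_le_integral ((integrable_indicator_iff measurableSet_Icc).2
          (integrableOn_const (by simp))) (Eventually.of_forall fun ξ => ?_)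
        exact indicator_nonneg (fun _ _ => hD) _
    _ = D * δ := by
        rw [integral_indicator measurableSet_Icc, setIntegral_const]
        simp [hδ, mul_comm]

theorem norm1_seg_sub_seg {t t' : ℝ} (x : PC n (t - T.h) T.ϑ) (y : PC n (t' - T.h) T.ϑ)
    (τ : Icc t T.ϑ) (τ' : Icc t' T.ϑ) (h : (τ : ℝ) = τ') :
    norm1 T (fun ξ => seg x τ ξ - seg y τ' ξ) = ∫ ξ in (τ - T.h)..τ, ‖x ξ - y ξ‖ := by
  rw [norm1_congr (r' := fun ξ => x (τ + ξ) - y (τ + ξ))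
    fun ξ hξ => by rw [seg_apply x τ hξ, seg_apply y τ' hξ, h]]
  unfold norm1
  rw [intervalIntegral.integral_comp_add_left (fun ξ => ‖x ξ - y ξ‖) (τ : ℝ)]
  simp [sub_eq_add_neg]

/-- Points of `𝔾` lie in some `P(α)`. -/
theorem exists_mem_bounded (g : Pt n T) :
    ∃ α > 0, (g.z, g.w) ∈ bounded n T α := by
  obtain ⟨B, hB0, hB⟩ := g.w.exists_bound
  exact ⟨‖g.z‖ + B + 1, by positivity, by simp only; linarith,
    fun ξ _ => (hB ξ).trans (by linarith [norm_nonneg g.z])⟩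

theorem bounded_mono {α β : ℝ} (h : α ≤ β) : bounded n T α ⊆ bounded n T β :=
  fun _ hq => ⟨hq.1.trans h, fun ξ hξ => (hq.2 ξ hξ).trans h⟩

theorem norm1_sub_le {w w' : Hist n T} {D : ℝ} (hD : 0 ≤ D)
    (h : ∀ ξ ∈ Ico (-T.h) 0, ‖w ξ - w' ξ‖ ≤ D) : norm1 T (fun ξ => w ξ - w' ξ) ≤ D * T.h :=
  norm1_sub_le_of_eq T.h_pos.le hD (fun _ hξ => absurd hξ.2 (not_lt.2 hξ.1)) fun ξ hξ _ => h ξ hξ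

end Histories

/-! ### Two tools for absolutely continuous functions -/

theorem lipschitzOnWith_integral {n : ℕ} {a b : ℝ} {v : ℝ → Vec n} {K : NNReal}
    (hv : IntervalIntegrable v volume a b)
    (hK : ∀ᵐ τ ∂(volume.restrict (Ioc a b)), ‖v τ‖ ≤ K) :
    LipschitzOnWith K (fun τ => ∫ ξ in a..τ, v ξ) (Icc a b) := by
  refine LipschitzOnWith.of_dist_le_mul fun τ hτ τ' hτ' => ?_
  have hsub : ∀ τ ∈ Icc a b, IntervalIntegrable v volume a τ := fun τ hτ =>
    hv.mono_set (by
      rw [uIcc_of_le hτ.1, uIcc_of_le (hτ.1.trans hτ.2)]; exact Icc_subset_Icc_right hτ.2)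
  rw [dist_eq_norm, intervalIntegral.integral_interval_sub_left (hsub τ hτ) (hsub τ' hτ'),
    Real.dist_eq]
  refine intervalIntegral.norm_integral_le_of_norm_le_const_ae ?_
  filter_upwards [(ae_restrict_iff' measurableSet_Ioc).1 hK] with ξ h1 h2
  exact h1 ⟨(le_min hτ'.1 hτ.1).trans_lt h2.1, h2.2.trans (max_le hτ'.2 hτ.2)⟩

/-- The fundamental theorem of calculus for vector-valued Lipschitz functions. -/
theorem integral_eq_sub_of_lipschitzOnWith {n : ℕ} {a b : ℝ} {x v : ℝ → Vec n} {K : NNReal}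
    (hab : a ≤ b) (hx : LipschitzOnWith K x (Icc a b))
    (hv : ∀ᵐ τ ∂(volume.restrict (Icc a b)), HasDerivAt x (v τ) τ) :
    IntervalIntegrable v volume a b ∧ ∀ τ ∈ Icc a b, ∫ ξ in a..τ, v ξ = x τ - x a := by
  have hae : ∀ᵐ τ, τ ∈ Icc a b → HasDerivAt x (v τ) τ := (ae_restrict_iff' measurableSet_Icc).1 hv
  have hnorm : ∀ᵐ τ ∂(volume.restrict (Ioc a b)), ‖v τ‖ ≤ K := by
    refine (ae_restrict_iff' measurableSet_Ioc).2 ?_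
    filter_upwards [hae, (countable_singleton b).ae_notMem volume] with τ h1 h2 h3
    have h4 : τ ∈ Ioo a b := ⟨h3.1, lt_of_le_of_ne h3.2 h2⟩
    have h5 := h1 (Ioo_subset_Icc_self h4)
    rw [← h5.deriv]
    exact norm_deriv_le_of_lipschitzOn (Icc_mem_nhds h4.1 h4.2) hx
  have hmeas : AEStronglyMeasurable v (volume.restrict (Ioc a b)) := by
    refine (stronglyMeasurable_deriv x).aestronglyMeasurable.congr ?_
    refine (ae_restrict_iff' measurableSet_Ioc).2 ?_
    filter_upwards [hae] with τ h1 h2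
    exact (h1 (Ioc_subset_Icc_self h2)).deriv
  have hint : IntervalIntegrable v volume a b := by
    rw [intervalIntegrable_iff_integrableOn_Ioc_of_le hab]
    exact ⟨hmeas, .restrict_of_bounded (C := K) (by simp) hnorm⟩
  refine ⟨hint, ?_⟩
  have hlip : LipschitzOnWith (K + K) (fun τ => x τ - ∫ ξ in a..τ, v ξ) (uIcc a b) := by
    rw [uIcc_of_le hab]
    exact hx.sub (lipschitzOnWith_integral hint hnorm)
  obtain ⟨C, hC⟩ := hlip.absolutelyContinuousOnInterval.const_of_ae_hasDerivAt_zero (by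
    filter_upwards [hae, hint.ae_hasDerivAt_integral] with τ h1 h2 h3
    have := (h1 (by rwa [uIcc_of_le hab] at h3)).sub (h2 h3 a left_mem_uIcc)
    rwa [sub_self] at this)
  rw [uIcc_of_le hab] at hC
  intro τ hτ
  have h1 := hC τ hτ
  have h2 := hC a ⟨le_rfl, hab⟩
  simp only [intervalIntegral.integral_same, sub_zero] at h2
  rw [h2, ← h1]
  abel

/-- Gronwall's inequality in integral form. -/
theorem le_mul_exp_of_le_add_mul_integral {e : ℝ → ℝ} {a b B L : ℝ}
    (he : ContinuousOn e (Icc a b)) (hL : 0 ≤ L)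
    (h : ∀ τ ∈ Icc a b, e τ ≤ B + L * ∫ ξ in a..τ, e ξ) :
    ∀ τ ∈ Icc a b, e τ ≤ B * Real.exp (L * (τ - a)) := by
  intro τ hτ
  have hab : a ≤ b := hτ.1.trans hτ.2
  set e' : ℝ → ℝ := IccExtend hab ((Icc a b).domRestrict e) with he'
  have hc : Continuous e' := (continuousOn_iff_continuous_domRestrict.1 he).Icc_extend'
  have heq : ∀ ξ ∈ Icc a b, e' ξ = e ξ := fun ξ hξ => by rw [he', IccExtend_of_mem _ _ hξ]; rfl
  have hint : ∀ τ ∈ Icc a b, ∫ ξ in a..τ, e' ξ = ∫ ξ in a..τ, e ξ := fun τ hτ => by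
    refine intervalIntegral.integral_congr fun ξ hξ => ?_
    rw [uIcc_of_le hτ.1] at hξ
    exact heq ξ ⟨hξ.1, hξ.2.trans hτ.2⟩
  have hd : ∀ τ, HasDerivAt (fun τ => B + L * ∫ ξ in a..τ, e' ξ) (L * e' τ) τ := fun τ => by
    have := (hc.integral_hasStrictDerivAt a τ).hasDerivAt
    exact (this.const_mul L).const_add B
  have key := le_gronwallBound_of_liminf_deriv_right_le (f := fun τ => B + L * ∫ ξ in a..τ, e' ξ)
    (f' := fun τ => L * e' τ) (δ := B) (K := L) (ε := 0) (a := a) (b := b)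
    (fun τ _ => (hd τ).continuousAt.continuousWithinAt)
    (fun τ _ r hr => (hd τ).hasDerivWithinAt.liminf_right_slope_le hr) (by simp)
    (fun τ hτ => by
      rw [add_zero, heq τ (Ico_subset_Icc_self hτ), hint τ (Ico_subset_Icc_self hτ)]
      exact mul_le_mul_of_nonneg_left (h τ (Ico_subset_Icc_self hτ)) hL) τ hτ
  rw [gronwallBound_ε0] at key
  refine (h τ hτ).trans ?_
  rw [← hint τ hτ]
  exact key

/-! ### Paths through a point of `𝔾` -/

section Paths

variable {n : ℕ} {T : Horizon}

/-- The path with the history of `g` and the given continuous continuation `v` on `[g.t, ϑ]`. -/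
noncomputable def glue (g : Pt n T) (v : ℝ → Vec n) (hv : ContinuousOn v (Icc g.t T.ϑ)) :
    PC n (g.t - T.h) T.ϑ where
  toFun := (Icc (g.t - T.h) T.ϑ).indicator (fun τ => if τ < g.t then g.w (τ - g.t) else v τ)
  isPC := by
    have h0 := g.w.isPC.shift (-g.t)
    have e1 : -T.h - -g.t = g.t - T.h := by ring
    have e2 : (0 : ℝ) - -g.t = g.t := by ring
    rw [e1, e2] at h0
    have h1 : IsPC (g.t - T.h) g.t ((Icc (g.t - T.h) T.ϑ).indicator
        (fun τ => if τ < g.t then g.w (τ - g.t) else v τ)) := by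
      refine h0.congr fun τ hτ => ?_
      have hm : τ ∈ Icc (g.t - T.h) T.ϑ := ⟨hτ.1, hτ.2.le.trans g.mem.2⟩
      rw [indicator_of_mem hm, if_pos hτ.2, neg_add_eq_sub]
    rcases g.mem.2.lt_or_eq with h2 | h2
    · have hEq : EqOn ((Icc (g.t - T.h) T.ϑ).indicator
          (fun τ => if τ < g.t then g.w (τ - g.t) else v τ)) v (Ico g.t T.ϑ) := by
        intro τ hτ
        have hm : τ ∈ Icc (g.t - T.h) T.ϑ := ⟨by linarith [hτ.1, T.h_pos], hτ.2.le⟩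
        rw [indicator_of_mem hm, if_neg (not_lt.2 hτ.1)]
      refine h1.snoc h2 ((hv.mono Ico_subset_Icc_self).congr hEq) ⟨v T.ϑ, ?_⟩
      have h3 : Tendsto v (𝓝[<] T.ϑ) (𝓝 (v T.ϑ)) := by
        rw [← nhdsWithin_Ico_eq_nhdsLT h2]
        exact (hv T.ϑ ⟨h2.le, le_rfl⟩).mono Ico_subset_Icc_self
      refine h3.congr' ?_
      filter_upwards [Ico_mem_nhdsLT h2] with τ hτ
      exact (hEq hτ).symm
    · have : ∀ c, c = T.ϑ → IsPC (g.t - T.h) c ((Icc (g.t - T.h) T.ϑ).indicator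
          (fun τ => if τ < g.t then g.w (τ - g.t) else v τ)) → IsPC (g.t - T.h) T.ϑ
          ((Icc (g.t - T.h) T.ϑ).indicator
          (fun τ => if τ < g.t then g.w (τ - g.t) else v τ)) := by
        rintro c rfl h; exact h
      exact this _ h2 h1
  zero_outside := fun ξ hξ => indicator_of_notMem hξ _

theorem glue_of_lt {g : Pt n T} {v : ℝ → Vec n} {hv : ContinuousOn v (Icc g.t T.ϑ)} {τ : ℝ}
    (h1 : g.t - T.h ≤ τ) (h2 : τ < g.t) : glue g v hv τ = g.w (τ - g.t) := by
  simp only [glue, indicator_of_mem (show τ ∈ Icc (g.t - T.h) T.ϑ from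
    ⟨h1, h2.le.trans g.mem.2⟩), if_pos h2]

theorem glue_of_mem {g : Pt n T} {v : ℝ → Vec n} {hv : ContinuousOn v (Icc g.t T.ϑ)} {τ : ℝ}
    (h : τ ∈ Icc g.t T.ϑ) : glue g v hv τ = v τ := by
  simp only [glue, indicator_of_mem (show τ ∈ Icc (g.t - T.h) T.ϑ from
    ⟨by linarith [h.1, T.h_pos], h.2⟩), if_neg (not_lt.2 h.1)]

theorem line_of_mem {g : Pt n T} {l : Vec n} {τ : ℝ} (h : τ ∈ Icc g.t T.ϑ) :
    line g l τ = g.z + (τ - g.t) • l := by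
  simp only [line, indicator_of_mem (show τ ∈ Icc (g.t - T.h) T.ϑ from
    ⟨by linarith [h.1, T.h_pos], h.2⟩), if_neg (not_lt.2 h.1)]

theorem line_of_lt {g : Pt n T} {l : Vec n} {τ : ℝ} (h1 : g.t - T.h ≤ τ) (h2 : τ < g.t) :
    line g l τ = g.w (τ - g.t) := by
  simp only [line, indicator_of_mem (show τ ∈ Icc (g.t - T.h) T.ϑ from
    ⟨h1, h2.le.trans g.mem.2⟩), if_pos h2]

theorem line_mem_Lam (g : Pt n T) (l : Vec n) : line g l ∈ Lam g := by
  refine ⟨fun τ hτ => line_of_lt hτ.1 hτ.2, ?_, ⟨‖l‖₊, ?_⟩⟩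
  · rw [line_of_mem ⟨le_rfl, g.mem.2⟩]; simp
  · refine LipschitzOnWith.of_dist_le_mul fun τ hτ τ' hτ' => ?_
    rw [line_of_mem hτ, line_of_mem hτ', dist_add_left, dist_eq_norm, ← sub_smul, norm_smul,
      dist_eq_norm, mul_comm, sub_sub_sub_cancel_right]
    rfl

theorem along_t (g : Pt n T) (x : PC n (g.t - T.h) T.ϑ) (τ : Icc g.t T.ϑ) :
    (g.along x τ).t = τ := rfl

theorem along_z (g : Pt n T) (x : PC n (g.t - T.h) T.ϑ) (τ : Icc g.t T.ϑ) :
    (g.along x τ).z = x τ := rfl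

theorem along_w_apply (g : Pt n T) (x : PC n (g.t - T.h) T.ϑ) (τ : Icc g.t T.ϑ) {ξ : ℝ}
    (hξ : ξ ∈ Icc (-T.h) 0) : (g.along x τ).w ξ = x (τ + ξ) := seg_apply x τ hξ

/-- The restriction of a path to `[τ - h, ϑ]`. -/
noncomputable def tail (g : Pt n T) (x : PC n (g.t - T.h) T.ϑ) (τ : Icc g.t T.ϑ) :
    PC n ((g.along x τ).t - T.h) T.ϑ where
  toFun := (Icc ((τ : ℝ) - T.h) T.ϑ).indicator x
  isPC := (x.isPC.mono (by rw [along_t]; linarith [τ.2.1])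
    (by rw [along_t]; linarith [T.h_pos, τ.2.2]) le_rfl).congr
    fun _ hξ => indicator_of_mem (Ico_subset_Icc_self hξ) _
  zero_outside := fun ξ hξ => indicator_of_notMem hξ _

theorem tail_apply {g : Pt n T} (x : PC n (g.t - T.h) T.ϑ) (τ : Icc g.t T.ϑ) {ξ : ℝ}
    (hξ : τ - T.h ≤ ξ) : tail g x τ ξ = x ξ := by
  by_cases h : ξ ≤ T.ϑ
  · simp only [tail, indicator_of_mem (show ξ ∈ Icc ((τ : ℝ) - T.h) T.ϑ from ⟨hξ, h⟩)]
  · rw [(tail g x τ).zero_outside ξ (fun h' => h h'.2), x.zero_outside ξ (fun h' => h h'.2)]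

theorem along_along_tail (g : Pt n T) (x : PC n (g.t - T.h) T.ϑ) (τ : Icc g.t T.ϑ)
    (τ' : Icc (g.along x τ).t T.ϑ) :
    (g.along x τ).along (tail g x τ) τ' = g.along x ⟨τ', τ.2.1.trans τ'.2.1, τ'.2.2⟩ := by
  have h : (τ : ℝ) ≤ τ' := τ'.2.1
  refine Pt.ext rfl ?_ ?_
  · exact tail_apply x τ (by linarith [T.h_pos])
  · refine PC.ext (funext fun ξ => ?_)
    by_cases hξ : ξ ∈ Icc (-T.h) 0
    · rw [along_w_apply _ _ _ hξ, along_w_apply _ _ _ hξ]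
      exact tail_apply x τ (by linarith [hξ.1])
    · rw [PC.zero_outside _ _ hξ, PC.zero_outside _ _ hξ]

theorem along_congr {g : Pt n T} {x y : PC n (g.t - T.h) T.ϑ} {τ : Icc g.t T.ϑ}
    (h : ∀ ξ ∈ Icc (g.t - T.h) τ, x ξ = y ξ) : g.along x τ = g.along y τ := by
  refine Pt.ext rfl (h _ ⟨by linarith [τ.2.1, T.h_pos], le_rfl⟩) ?_
  refine PC.ext (funext fun ξ => ?_)
  by_cases hξ : ξ ∈ Icc (-T.h) 0
  · simp only [Pt.along]
    rw [seg_apply _ _ hξ, seg_apply _ _ hξ]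
    exact h _ ⟨by linarith [hξ.1, τ.2.1], by linarith [hξ.2]⟩
  · simp only [Pt.along]
    rw [PC.zero_outside _ _ hξ, PC.zero_outside _ _ hξ]

theorem apply_add_of_mem_Lam {g : Pt n T} {x : PC n (g.t - T.h) T.ϑ} (hx : x ∈ Lam g) {ξ : ℝ}
    (hξ : ξ ∈ Ico (-T.h) 0) : x (g.t + ξ) = g.w ξ := by
  rw [hx.1 _ ⟨by linarith [hξ.1], by linarith [hξ.2]⟩, add_sub_cancel_left]

/-- The point `(τ, ζ, x_τ)`. -/
noncomputable def Pt.withState (g : Pt n T) (x : PC n (g.t - T.h) T.ϑ) (τ : Icc g.t T.ϑ)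
    (ζ : Vec n) : Pt n T where
  t := τ
  mem := ⟨g.mem.1.trans τ.2.1, τ.2.2⟩
  z := ζ
  w := seg x τ

theorem mem_bounded_of_le {t B : ℝ} {x : PC n (t - T.h) T.ϑ} {τ : Icc t T.ϑ} {ζ : Vec n}
    (hx : ∀ ξ ∈ Icc (t - T.h) T.ϑ, ‖x ξ‖ ≤ B) (hζ : ‖ζ‖ ≤ B) :
    (ζ, seg x τ) ∈ bounded n T B := by
  refine ⟨hζ, fun ξ hξ => ?_⟩
  simp only
  rw [seg_apply _ _ hξ]
  exact hx _ ⟨by linarith [τ.2.1, hξ.1], by linarith [τ.2.2, hξ.2]⟩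

theorem InPhi.neg {φ : Pt n T → ℝ} (hφ : InPhi φ) : InPhi (-φ) := by
  refine ⟨fun z w => (hφ.1 z w).neg, fun α hα => ?_⟩
  obtain ⟨lam, h0, h⟩ := hφ.2 α hα
  refine ⟨lam, h0, fun t ht z z' w w' h1 h2 => ?_⟩
  have := h t ht z z' w w' h1 h2
  rwa [Pi.neg_apply, Pi.neg_apply, neg_sub_neg, abs_sub_comm]

/-- Functionals of the class `Φ` are continuous along paths. -/
theorem InPhi.continuous_withState {φ : Pt n T → ℝ} (hφ : InPhi φ) (g : Pt n T)
    (x : PC n (g.t - T.h) T.ϑ) :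
    Continuous fun q : Icc g.t T.ϑ × Vec n => φ (g.withState x q.1 q.2) := by
  obtain ⟨B, hB0, hB⟩ := x.exists_bound
  refine continuous_iff_continuousAt.2 fun ⟨τ₀, ζ₀⟩ => ?_
  obtain ⟨lam, -, hlam⟩ := hφ.2 (B + ‖ζ₀‖ + 1) (by positivity)
  have h1 : Tendsto (fun q : Icc g.t T.ϑ × Vec n => φ (g.withState x q.1 q.2)
      - φ ⟨q.1, ⟨g.mem.1.trans q.1.2.1, q.1.2.2⟩, ζ₀, seg x τ₀⟩) (𝓝 (τ₀, ζ₀)) (𝓝 0) := by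
    have h2 : Tendsto (fun q : Icc g.t T.ϑ × Vec n =>
        lam * (‖q.2 - ζ₀‖ + ∫ ξ in (-T.h)..0, ‖x ((q.1 : ℝ) + ξ) - x ((τ₀ : ℝ) + ξ)‖))
        (𝓝 (τ₀, ζ₀)) (𝓝 0) := by
      have h3 : Tendsto (fun q : Icc g.t T.ϑ × Vec n => ‖q.2 - ζ₀‖) (𝓝 (τ₀, ζ₀)) (𝓝 0) := by
        have : Continuous fun q : Icc g.t T.ϑ × Vec n => ‖q.2 - ζ₀‖ := by fun_prop
        simpa using this.tendsto (τ₀, ζ₀)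
      have h4 := (x.tendsto_integral_shift (-T.h) 0 (τ₀ : ℝ)).comp
        ((continuous_subtype_val.comp continuous_fst).tendsto
          ((τ₀, ζ₀) : Icc g.t T.ϑ × Vec n))
      simpa using (h3.add h4).const_mul lam
    refine squeeze_zero_norm' ?_ h2
    have h5 : ∀ᶠ q : Icc g.t T.ϑ × Vec n in 𝓝 (τ₀, ζ₀), ‖q.2‖ < ‖ζ₀‖ + 1 :=
      (continuous_snd.norm.tendsto (τ₀, ζ₀)).eventually (gt_mem_nhds (by simp))
    filter_upwards [h5] with q hq
    rw [Real.norm_eq_abs]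
    refine (hlam q.1 ⟨g.mem.1.trans q.1.2.1, q.1.2.2⟩ q.2 ζ₀ (seg x q.1) (seg x τ₀)
      (mem_bounded_of_le (fun ξ _ => (hB ξ).trans (by linarith [norm_nonneg ζ₀]))
        (by linarith))
      (mem_bounded_of_le (fun ξ _ => (hB ξ).trans (by linarith [norm_nonneg ζ₀]))
        (by linarith))).trans (le_of_eq ?_)
    congr 2
    exact norm1_congr fun ξ hξ => by rw [seg_apply _ _ hξ, seg_apply _ _ hξ]
  have h2 : Tendsto (fun q : Icc g.t T.ϑ × Vec n =>
      φ ⟨q.1, ⟨g.mem.1.trans q.1.2.1, q.1.2.2⟩, ζ₀, seg x τ₀⟩) (𝓝 (τ₀, ζ₀))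
      (𝓝 (φ ⟨τ₀, ⟨g.mem.1.trans τ₀.2.1, τ₀.2.2⟩, ζ₀, seg x τ₀⟩)) := by
    have h3 : Continuous fun q : Icc g.t T.ϑ × Vec n =>
        (⟨q.1, g.mem.1.trans q.1.2.1, q.1.2.2⟩ : Icc T.t₀ T.ϑ) := by fun_prop
    exact ((hφ.1 ζ₀ (seg x τ₀)).comp h3).tendsto (τ₀, ζ₀)
  have := h1.add h2
  simp only [sub_add_cancel, zero_add] at this
  exact this

theorem continuousOn_of_mem_Lam {g : Pt n T} {x : PC n (g.t - T.h) T.ϑ} (hx : x ∈ Lam g) :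
    ContinuousOn x (Icc g.t T.ϑ) := by
  obtain ⟨K, hK⟩ := hx.2.2
  exact hK.continuousOn

/-- Functionals of the class `Φ` are continuous along the elements of `Λ(t, z, w)`; the time is
projected onto `[t, ϑ]`. -/
theorem InPhi.continuous_along {φ : Pt n T → ℝ} (hφ : InPhi φ) {g : Pt n T}
    {x : PC n (g.t - T.h) T.ϑ} (hx : x ∈ Lam g) :
    Continuous fun τ : ℝ => φ (g.along x (projIcc g.t T.ϑ g.mem.2 τ)) := by
  have h1 : Continuous fun τ : ℝ =>
      (projIcc g.t T.ϑ g.mem.2 τ, x (projIcc g.t T.ϑ g.mem.2 τ)) :=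
    continuous_projIcc.prodMk ((continuousOn_iff_continuous_domRestrict.1
      (continuousOn_of_mem_Lam hx)).comp continuous_projIcc)
  exact (hφ.continuous_withState g x).comp h1

/-- Starting from `(t, z, w)`, the point `(t, x(t), x_t)` may differ from `(t, z, w)` in the value
of the history at `0`, which functionals of the class `Φ` do not see. -/
theorem InPhi.along_self {φ : Pt n T → ℝ} (hφ : InPhi φ) {g : Pt n T}
    {x : PC n (g.t - T.h) T.ϑ} (hx : x ∈ Lam g) :
    φ (g.along x ⟨g.t, le_rfl, g.mem.2⟩) = φ g := by
  obtain ⟨B, hB0, hB⟩ := x.exists_bound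
  obtain ⟨B', hB0', hB'⟩ := g.w.exists_bound
  obtain ⟨lam, -, hlam⟩ := hφ.2 (B + B' + ‖g.z‖ + 1) (by positivity)
  have h1 := hlam g.t g.mem (x g.t) g.z (seg x ⟨g.t, le_rfl, g.mem.2⟩) g.w
    (mem_bounded_of_le (fun ξ _ => (hB ξ).trans (by linarith [norm_nonneg g.z]))
      ((hB _).trans (by linarith [norm_nonneg g.z])))
    ⟨by simp only; linarith, fun ξ _ => (hB' ξ).trans (by linarith [norm_nonneg g.z])⟩
  have h2 : norm1 T (fun ξ => seg x ⟨g.t, le_rfl, g.mem.2⟩ ξ - g.w ξ) ≤ 0 := by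
    refine (norm1_sub_le_of_eq (δ := 0) (D := 0) le_rfl le_rfl ?_ ?_).trans (by simp)
    · intro ξ hξ
      rw [neg_zero] at hξ
      rw [seg_apply _ _ ⟨hξ.1, hξ.2.le⟩]
      exact apply_add_of_mem_Lam hx hξ
    · intro ξ hξ h
      linarith [hξ.2]
  rw [hx.2.1, sub_self, norm_zero, zero_add, le_antisymm h2 (norm1_nonneg _), mul_zero] at h1
  have h3 := abs_eq_zero.1 (le_antisymm h1 (abs_nonneg _))
  have h4 : g.along x ⟨g.t, le_rfl, g.mem.2⟩ =
      ⟨g.t, g.mem, g.z, seg x ⟨g.t, le_rfl, g.mem.2⟩⟩ := Pt.ext rfl hx.2.1 rfl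
  rw [h4]
  linarith

end Paths

/-! ### Motions of the delay system -/

theorem intervalIntegrable_sub {E : Type*} [NormedAddCommGroup E] {v : ℝ → E} {a b c d : ℝ}
    (h : IntervalIntegrable v volume a b) (hac : a ≤ c) (hcd : c ≤ d) (hdb : d ≤ b) :
    IntervalIntegrable v volume c d :=
  h.mono_set (by
    rw [uIcc_of_le hcd, uIcc_of_le (hac.trans (hcd.trans hdb))]
    exact Icc_subset_Icc hac hdb)

/-- A delayed integral is controlled by the integral over the history and the undelayed one. -/
theorem integral_delay_le {ψ : ℝ → ℝ} (h0 : ∀ ξ, 0 ≤ ψ ξ)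
    (hi : ∀ a b, IntervalIntegrable ψ volume a b) {h t τ : ℝ} (hh : 0 ≤ h) (hτ : t ≤ τ) :
    ∫ ξ in t..τ, ψ (ξ - h) ≤ (∫ ξ in (t - h)..t, ψ ξ) + ∫ ξ in t..τ, ψ ξ := by
  rw [intervalIntegral.integral_comp_sub_right, intervalIntegral.integral_add_adjacent_intervals
    (hi _ _) (hi _ _)]
  exact intervalIntegral.integral_mono_interval le_rfl (by linarith) (by linarith)
    (Eventually.of_forall h0) (hi _ _)

/-- The standing assumptions on the Bolza problem. -/
structure Bolza.Regular {n m : ℕ} {T : Horizon} (P : Bolza n m T) (c : ℝ) : Prop where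
  compact : IsCompact P.U
  nonempty : P.U.Nonempty
  f1 : P.CondF1
  f2 : P.CondF2
  c_pos : 0 < c
  f3 : P.CondF3 c
  sigma : P.CondSigma

variable {n m : ℕ} {T : Horizon}

/-- Bound for the elements of `X(t, z, w)` with `(z, w) ∈ P(α)`. -/
noncomputable def radius (T : Horizon) (c α : ℝ) : ℝ :=
  (α + c * (T.ϑ - T.t₀) + c * (T.h * α)) * Real.exp (2 * c * (T.ϑ - T.t₀))

theorem le_radius {c α : ℝ} (hc : 0 < c) (hα : 0 ≤ α) : α ≤ radius T c α := by
  have h1 := T.t₀_lt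
  have h2 := T.h_pos
  have h3 : 0 ≤ c * (T.ϑ - T.t₀) := mul_nonneg hc.le (by linarith)
  have h4 : 0 ≤ c * (T.h * α) := by positivity
  have h5 : 1 ≤ Real.exp (2 * c * (T.ϑ - T.t₀)) := Real.one_le_exp (by linarith)
  unfold radius
  calc α ≤ α + c * (T.ϑ - T.t₀) + c * (T.h * α) := by linarith
    _ ≤ _ := le_mul_of_one_le_right (by linarith) h5

namespace PC

variable {a b : ℝ} (x : PC n a b)

theorem intervalIntegrable_norm (c d : ℝ) : IntervalIntegrable (fun ξ => ‖x ξ‖) volume c d := by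
  obtain ⟨B, -, hB⟩ := x.exists_bound
  refine (intervalIntegrable_const (c := B)).mono_fun x.measurable.norm.aestronglyMeasurable
    (Eventually.of_forall fun ξ => ?_)
  simp only [Real.norm_eq_abs, abs_norm]
  exact (hB ξ).trans (le_abs_self _)

theorem intervalIntegrable_growth (c h s τ : ℝ) :
    IntervalIntegrable (fun ξ => c * (1 + ‖x ξ‖ + ‖x (ξ - h)‖)) volume s τ := by
  have h1 : IntervalIntegrable (fun ξ => ‖x (ξ - h)‖) volume s τ := by
    simpa using (x.intervalIntegrable_norm (s - h) (τ - h)).comp_sub_right h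
  exact ((intervalIntegrable_const.add (x.intervalIntegrable_norm s τ)).add h1).const_mul c

end PC

theorem hasDerivAt_of_mem_X {c : ℝ} {g : Pt n T} {x : PC n (g.t - T.h) T.ϑ} (hx : x ∈ X c g) :
    ∀ᵐ τ ∂(volume.restrict (Icc g.t T.ϑ)),
      HasDerivAt x (deriv x τ) τ ∧ ‖deriv x τ‖ ≤ c * (1 + ‖x τ‖ + ‖x (τ - T.h)‖) := by
  filter_upwards [hx.2] with τ ⟨l, hl, hd⟩
  rw [hd.deriv]
  exact ⟨hd, hl⟩

theorem integral_deriv_of_mem_Lam {g : Pt n T} {x : PC n (g.t - T.h) T.ϑ} (hx : x ∈ Lam g)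
    {v : ℝ → Vec n} (hv : ∀ᵐ τ ∂(volume.restrict (Icc g.t T.ϑ)), HasDerivAt x (v τ) τ) :
    IntervalIntegrable v volume g.t T.ϑ ∧
      ∀ s ∈ Icc g.t T.ϑ, ∀ τ ∈ Icc s T.ϑ, ∫ ξ in s..τ, v ξ = x τ - x s := by
  obtain ⟨K, hK⟩ := hx.2.2
  obtain ⟨h1, h2⟩ := integral_eq_sub_of_lipschitzOnWith g.mem.2 hK hv
  refine ⟨h1, fun s hs τ hτ => ?_⟩
  have h3 := h2 τ ⟨hs.1.trans hτ.1, hτ.2⟩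
  have h4 := intervalIntegral.integral_add_adjacent_intervals
    (intervalIntegrable_sub h1 le_rfl hs.1 hs.2) (intervalIntegrable_sub h1 hs.1 hτ.1 hτ.2)
  rw [h2 s hs, h3] at h4
  rw [← sub_eq_of_eq_add' h4.symm]
  abel

theorem norm_sub_le_of_mem_X {c : ℝ} {g : Pt n T} {x : PC n (g.t - T.h) T.ϑ} (hx : x ∈ X c g)
    {s τ : ℝ} (hs : s ∈ Icc g.t T.ϑ) (hτ : τ ∈ Icc s T.ϑ) :
    ‖x τ - x s‖ ≤ ∫ ξ in s..τ, c * (1 + ‖x ξ‖ + ‖x (ξ - T.h)‖) := by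
  have h1 := hasDerivAt_of_mem_X hx
  obtain ⟨-, h3⟩ := integral_deriv_of_mem_Lam hx.1 (v := deriv x) (h1.mono fun τ h => h.1)
  rw [← h3 s hs τ hτ]
  refine intervalIntegral.norm_integral_le_of_norm_le hτ.1 ?_
    (x.intervalIntegrable_growth c T.h s τ)
  filter_upwards [(ae_restrict_iff' measurableSet_Icc).1 h1] with ξ h4 h5
  exact (h4 ⟨hs.1.trans h5.1.le, h5.2.trans hτ.2⟩).2

/-- The a priori bound for the elements of `X(t, z, w)`. -/
theorem norm_le_radius_of_mem_X {c α : ℝ} (hc : 0 < c) (hα : 0 ≤ α) {g : Pt n T}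
    (hg : (g.z, g.w) ∈ bounded n T α) {x : PC n (g.t - T.h) T.ϑ} (hx : x ∈ X c g) :
    ∀ τ, ‖x τ‖ ≤ radius T c α := by
  have hh := T.h_pos
  have hw : ∀ ξ ∈ Ico (g.t - T.h) g.t, ‖x ξ‖ ≤ α := fun ξ hξ => by
    rw [hx.1.1 ξ hξ]
    exact hg.2 _ ⟨by linarith [hξ.1], by linarith [hξ.2]⟩
  intro τ
  by_cases hτ : τ ∈ Icc (g.t - T.h) T.ϑ
  swap
  · rw [x.zero_outside τ hτ, norm_zero]
    exact hα.trans (le_radius hc hα)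
  rcases lt_or_ge τ g.t with h | h
  · exact (hw τ ⟨hτ.1, h⟩).trans (le_radius hc hα)
  have hI : ∫ ξ in (g.t - T.h)..g.t, ‖x ξ‖ ≤ T.h * α := by
    have h1 : ∫ ξ in (g.t - T.h)..g.t, ‖x ξ‖ ≤ ∫ ξ in (g.t - T.h)..g.t, α := by
      refine intervalIntegral.integral_mono_ae_restrict (by linarith)
        (x.intervalIntegrable_norm _ _) intervalIntegrable_const ?_
      refine (ae_restrict_iff' measurableSet_Icc).2 ?_
      filter_upwards [(countable_singleton g.t).ae_notMem volume] with ξ h1 h2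
      exact hw ξ ⟨h2.1, lt_of_le_of_ne h2.2 h1⟩
    simpa using h1
  have key := le_mul_exp_of_le_add_mul_integral (e := fun τ => ‖x τ‖) (a := g.t) (b := T.ϑ)
    (B := α + c * (T.ϑ - T.t₀) + c * (T.h * α)) (L := 2 * c)
    (continuousOn_of_mem_Lam hx.1).norm (by linarith) (fun τ hτ => ?_) τ ⟨h, hτ.2⟩
  · refine key.trans ?_
    have h1 := T.t₀_lt
    have h2 : 0 ≤ c * (T.ϑ - T.t₀) := mul_nonneg hc.le (by linarith)
    unfold radius
    gcongr
    · exact hτ.2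
    · exact g.mem.1
  · have h1 := norm_sub_le_of_mem_X hx ⟨le_rfl, g.mem.2⟩ hτ
    have hdel := integral_delay_le (ψ := fun ξ => ‖x ξ‖) (fun _ => norm_nonneg _)
      x.intervalIntegrable_norm hh.le hτ.1
    have hd : IntervalIntegrable (fun ξ => ‖x (ξ - T.h)‖) volume g.t τ := by
      simpa using (x.intervalIntegrable_norm (g.t - T.h) (τ - T.h)).comp_sub_right T.h
    rw [intervalIntegral.integral_const_mul, intervalIntegral.integral_add
      (intervalIntegrable_const.add (x.intervalIntegrable_norm _ _)) hd,
      intervalIntegral.integral_add intervalIntegrable_const (x.intervalIntegrable_norm _ _),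
      hx.1.2.1] at h1
    simp only [intervalIntegral.integral_const, smul_eq_mul, mul_one] at h1
    have h2 : ‖x τ‖ ≤ ‖g.z‖ + ‖x τ - g.z‖ := norm_le_norm_add_norm_sub' _ _ 
    have h3 : ‖g.z‖ ≤ α := hg.1
    have h4 : c * (τ - g.t + (∫ ξ in g.t..τ, ‖x ξ‖) + ∫ ξ in g.t..τ, ‖x (ξ - T.h)‖) ≤
        c * ((T.ϑ - T.t₀) + (∫ ξ in g.t..τ, ‖x ξ‖) +
          (T.h * α + ∫ ξ in g.t..τ, ‖x ξ‖)) := by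
      refine mul_le_mul_of_nonneg_left ?_ hc.le
      linarith [hτ.2, g.mem.1]
    nlinarith

/-- Elements of `X(t, z, w)` are uniformly Lipschitz. -/
theorem norm_sub_le_mul_of_mem_X {c R : ℝ} (hc : 0 < c) {g : Pt n T}
    {x : PC n (g.t - T.h) T.ϑ} (hx : x ∈ X c g) (hR : ∀ ξ, ‖x ξ‖ ≤ R)
    {s τ : ℝ} (hs : s ∈ Icc g.t T.ϑ) (hτ : τ ∈ Icc s T.ϑ) :
    ‖x τ - x s‖ ≤ c * (1 + R + R) * (τ - s) := by
  refine (norm_sub_le_of_mem_X hx hs hτ).trans ?_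
  have h1 : ∫ ξ in s..τ, c * (1 + ‖x ξ‖ + ‖x (ξ - T.h)‖) ≤ ∫ ξ in s..τ, c * (1 + R + R) := by
    refine intervalIntegral.integral_mono_on hτ.1 (x.intervalIntegrable_growth _ _ _ _)
      intervalIntegrable_const fun ξ _ => ?_
    exact mul_le_mul_of_nonneg_left (by linarith [hR ξ, hR (ξ - T.h)]) hc.le
  refine h1.trans (le_of_eq ?_)
  rw [intervalIntegral.integral_const, smul_eq_mul, mul_comm]

namespace Bolza

/-- The velocity `f(ξ, x(ξ), x(ξ - h), u(ξ))`. -/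
abbrev vel (P : Bolza n m T) (x : ℝ → Vec n) (u : ℝ → Vec m) (ξ : ℝ) : Vec n :=
  P.f ξ (x ξ) (x (ξ - T.h)) (u ξ)

/-- The running cost `f⁰(ξ, x(ξ), x(ξ - h), u(ξ))`. -/
abbrev run (P : Bolza n m T) (x : ℝ → Vec n) (u : ℝ → Vec m) (ξ : ℝ) : ℝ :=
  P.f0 ξ (x ξ) (x (ξ - T.h)) (u ξ)

variable {P : Bolza n m T} {c : ℝ}

/-- Integrability of a continuous bounded integrand along a path and a measurable control. -/
theorem intervalIntegrable_comp {E : Type*} [NormedAddCommGroup E]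
    (hU : IsCompact P.U) {q : ℝ × Vec n × Vec n × Vec m → E}
    (hq : ContinuousOn q (Icc T.t₀ T.ϑ ×ˢ univ ×ˢ univ ×ˢ P.U)) {x y : ℝ → Vec n}
    (hx : Measurable x) (hy : Measurable y) {t : ℝ} (ht : t ∈ Icc T.t₀ T.ϑ) {u : ℝ → Vec m}
    (hu : u ∈ P.controls t) {M : ℝ}
    (hM : ∀ ξ ∈ Icc t T.ϑ, ‖q (ξ, x ξ, y ξ, u ξ)‖ ≤ M) :
    IntervalIntegrable (fun ξ => q (ξ, x ξ, y ξ, u ξ)) volume t T.ϑ := by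
  rw [intervalIntegrable_iff_integrableOn_Icc_of_le ht.2]
  have hS : MeasurableSet (Icc T.t₀ T.ϑ ×ˢ (univ : Set (Vec n)) ×ˢ (univ : Set (Vec n)) ×ˢ P.U) :=
    measurableSet_Icc.prod (MeasurableSet.univ.prod (MeasurableSet.univ.prod hU.measurableSet))
  have hm : AEMeasurable (fun ξ => (ξ, x ξ, y ξ, u ξ)) (volume.restrict (Icc t T.ϑ)) :=
    aemeasurable_id.prodMk (hx.aemeasurable.prodMk (hy.aemeasurable.prodMk hu.1))
  refine ⟨?_, .restrict_of_bounded (C := M) (by simp)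
    ((ae_restrict_iff' measurableSet_Icc).2 (Eventually.of_forall hM))⟩
  have h1 := hq.aestronglyMeasurable (μ := (volume.restrict (Icc t T.ϑ)).map
    (fun ξ => (ξ, x ξ, y ξ, u ξ))) hS
  rw [Measure.restrict_eq_self_of_ae_mem] at h1
  · exact h1.comp_aemeasurable hm
  · refine (ae_map_iff (p := fun z => z ∈ Icc T.t₀ T.ϑ ×ˢ univ ×ˢ univ ×ˢ P.U) hm hS).2 ?_
    refine (ae_restrict_iff' measurableSet_Icc).2 (Eventually.of_forall fun ξ hξ => ?_)
    exact ⟨⟨ht.1.trans hξ.1, hξ.2⟩, trivial, trivial, hu.2 ξ hξ⟩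

namespace Regular

theorem norm_vel_le (R : P.Regular c) {t : ℝ} (ht : t ∈ Icc T.t₀ T.ϑ) {u : ℝ → Vec m}
    (hu : u ∈ P.controls t) (x : ℝ → Vec n) {ξ : ℝ} (hξ : ξ ∈ Icc t T.ϑ) :
    ‖P.vel x u ξ‖ ≤ c * (1 + ‖x ξ‖ + ‖x (ξ - T.h)‖) :=
  (le_add_of_nonneg_right (abs_nonneg _)).trans
    (R.f3 ξ ⟨ht.1.trans hξ.1, hξ.2⟩ _ _ _ (hu.2 ξ hξ))

theorem abs_run_le (R : P.Regular c) {t : ℝ} (ht : t ∈ Icc T.t₀ T.ϑ) {u : ℝ → Vec m}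
    (hu : u ∈ P.controls t) (x : ℝ → Vec n) {ξ : ℝ} (hξ : ξ ∈ Icc t T.ϑ) :
    |P.run x u ξ| ≤ c * (1 + ‖x ξ‖ + ‖x (ξ - T.h)‖) :=
  (le_add_of_nonneg_left (norm_nonneg _)).trans
    (R.f3 ξ ⟨ht.1.trans hξ.1, hξ.2⟩ _ _ _ (hu.2 ξ hξ))

theorem intervalIntegrable_vel (R : P.Regular c) {t a b : ℝ} (ht : t ∈ Icc T.t₀ T.ϑ)
    {u : ℝ → Vec m} (hu : u ∈ P.controls t) (x : PC n a b) :
    IntervalIntegrable (P.vel x u) volume t T.ϑ := by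
  obtain ⟨B, hB0, hB⟩ := x.exists_bound
  refine intervalIntegrable_comp R.compact R.f1.1 x.measurable
    (x.measurable.comp (measurable_sub_const T.h)) ht hu (M := c * (1 + B + B)) fun ξ hξ => ?_
  refine (R.norm_vel_le ht hu x hξ).trans ?_
  exact mul_le_mul_of_nonneg_left (by linarith [hB ξ, hB (ξ - T.h)]) R.c_pos.le

theorem intervalIntegrable_run (R : P.Regular c) {t a b : ℝ} (ht : t ∈ Icc T.t₀ T.ϑ)
    {u : ℝ → Vec m} (hu : u ∈ P.controls t) (x : PC n a b) :
    IntervalIntegrable (P.run x u) volume t T.ϑ := by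
  obtain ⟨B, hB0, hB⟩ := x.exists_bound
  refine intervalIntegrable_comp R.compact R.f1.2 x.measurable
    (x.measurable.comp (measurable_sub_const T.h)) ht hu (M := c * (1 + B + B)) fun ξ hξ => ?_
  refine (R.abs_run_le ht hu x hξ).trans ?_
  exact mul_le_mul_of_nonneg_left (by linarith [hB ξ, hB (ξ - T.h)]) R.c_pos.le

theorem mem_X_of_isMotion (R : P.Regular c) {g : Pt n T} {u : ℝ → Vec m}
    (hu : u ∈ P.controls g.t) {x : PC n (g.t - T.h) T.ϑ} (hx : P.IsMotion g u x) : x ∈ X c g := by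
  refine ⟨hx.1, ?_⟩
  filter_upwards [hx.2, ae_restrict_mem measurableSet_Icc] with τ h1 h2
  exact ⟨_, R.norm_vel_le g.mem hu x h2, h1⟩

theorem eq_add_integral_of_isMotion {g : Pt n T} {u : ℝ → Vec m}
    {x : PC n (g.t - T.h) T.ϑ} (hx : P.IsMotion g u x) {s τ : ℝ} (hs : s ∈ Icc g.t T.ϑ)
    (hτ : τ ∈ Icc s T.ϑ) : x τ = x s + ∫ ξ in s..τ, P.vel x u ξ := by
  rw [(integral_deriv_of_mem_Lam hx.1 hx.2).2 s hs τ hτ]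
  abel

theorem isMotion_of_eq_add_integral (R : P.Regular c) {g : Pt n T} {u : ℝ → Vec m}
    (hu : u ∈ P.controls g.t) {x : PC n (g.t - T.h) T.ϑ}
    (hw : ∀ τ ∈ Ico (g.t - T.h) g.t, x τ = g.w (τ - g.t))
    (hx : ∀ τ ∈ Icc g.t T.ϑ, x τ = g.z + ∫ ξ in g.t..τ, P.vel x u ξ) : P.IsMotion g u x := by
  have hi := R.intervalIntegrable_vel g.mem hu x
  obtain ⟨B, hB0, hB⟩ := x.exists_bound
  have hK : 0 ≤ c * (1 + B + B) := mul_nonneg R.c_pos.le (by linarith)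
  refine ⟨⟨hw, by simpa using hx g.t ⟨le_rfl, g.mem.2⟩, ⟨c * (1 + B + B), hK⟩, ?_⟩, ?_⟩
  · have h1 := lipschitzOnWith_integral (K := ⟨c * (1 + B + B), hK⟩) hi (by
      refine (ae_restrict_iff' measurableSet_Ioc).2 (Eventually.of_forall fun ξ hξ => ?_)
      refine (R.norm_vel_le g.mem hu x (Ioc_subset_Icc_self hξ)).trans ?_
      exact mul_le_mul_of_nonneg_left (by linarith [hB ξ, hB (ξ - T.h)]) R.c_pos.le)
    intro τ hτ τ' hτ'
    rw [hx τ hτ, hx τ' hτ', edist_add_left]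
    exact h1 hτ hτ'
  · refine (ae_restrict_iff' measurableSet_Icc).2 ?_
    filter_upwards [hi.ae_hasDerivAt_integral, (countable_singleton g.t).ae_notMem volume,
      (countable_singleton T.ϑ).ae_notMem volume] with τ h1 h2 h3 h4
    have h5 : τ ∈ Ioo g.t T.ϑ := ⟨lt_of_le_of_ne h4.1 (Ne.symm h2), lt_of_le_of_ne h4.2 h3⟩
    rw [uIcc_of_le g.mem.2] at h1
    refine ((h1 h4 g.t ⟨le_rfl, g.mem.2⟩).const_add g.z).congr_of_eventuallyEq ?_
    filter_upwards [Icc_mem_nhds h5.1 h5.2] with ξ hξ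
    exact hx ξ hξ

/-- Two motions with controls that agree up to `τ₁` stay close up to `τ₁`. -/
theorem norm_sub_le_of_eqOn (R : P.Regular c) {t : ℝ} (ht : t ∈ Icc T.t₀ T.ϑ)
    {x y : PC n (t - T.h) T.ϑ} (hx : ContinuousOn x (Icc t T.ϑ)) (hy : ContinuousOn y (Icc t T.ϑ))
    {u v : ℝ → Vec m} (hu : u ∈ P.controls t) (hv : v ∈ P.controls t) {τ₁ : ℝ}
    (hτ₁ : τ₁ ∈ Icc t T.ϑ) (huv : EqOn u v (Ico t τ₁)) {r lam : ℝ} (hlam : 0 < lam)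
    (hxr : ∀ ξ, ‖x ξ‖ ≤ r) (hyr : ∀ ξ, ‖y ξ‖ ≤ r)
    (hL : ∀ t ∈ Icc T.t₀ T.ϑ, ∀ x y x' y' : Vec n,
      ‖x‖ ≤ r → ‖y‖ ≤ r → ‖x'‖ ≤ r → ‖y'‖ ≤ r → ∀ u ∈ P.U,
      ‖P.f t x y u - P.f t x' y' u‖ + |P.f0 t x y u - P.f0 t x' y' u|
        ≤ lam * (‖x - x'‖ + ‖y - y'‖))
    (hxe : ∀ τ ∈ Icc t T.ϑ, x τ = x t + ∫ ξ in t..τ, P.vel x u ξ)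
    (hye : ∀ τ ∈ Icc t T.ϑ, y τ = y t + ∫ ξ in t..τ, P.vel y v ξ) :
    ∀ τ ∈ Icc t τ₁, ‖x τ - y τ‖ ≤ (‖x t - y t‖ + lam * ∫ ξ in (t - T.h)..t, ‖x ξ - y ξ‖) *
      Real.exp (2 * lam * (τ - t)) := by
  have hsub : ∀ τ ∈ Icc t τ₁, τ ∈ Icc t T.ϑ := fun τ h => ⟨h.1, h.2.trans hτ₁.2⟩
  refine le_mul_exp_of_le_add_mul_integral (e := fun τ => ‖x τ - y τ‖)
    (((hx.sub hy).norm).mono hsub) (by linarith) fun τ hτ => ?_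
  have hi := x.intervalIntegrable_norm_sub y
  have hid : IntervalIntegrable (fun ξ => ‖x (ξ - T.h) - y (ξ - T.h)‖) volume t τ := by
    simpa using (hi (t - T.h) (τ - T.h)).comp_sub_right T.h
  have hvx := intervalIntegrable_sub (R.intervalIntegrable_vel ht hu x) le_rfl hτ.1 (hsub τ hτ).2
  have hvy := intervalIntegrable_sub (R.intervalIntegrable_vel ht hv y) le_rfl hτ.1 (hsub τ hτ).2
  have e1 : x τ - y τ = (x t - y t) + ∫ ξ in t..τ, (P.vel x u ξ - P.vel y v ξ) := by
    rw [hxe τ (hsub τ hτ), hye τ (hsub τ hτ), intervalIntegral.integral_sub hvx hvy]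
    abel
  have h1 : ‖∫ ξ in t..τ, (P.vel x u ξ - P.vel y v ξ)‖ ≤
      ∫ ξ in t..τ, lam * (‖x ξ - y ξ‖ + ‖x (ξ - T.h) - y (ξ - T.h)‖) := by
    refine intervalIntegral.norm_integral_le_of_norm_le hτ.1 ?_
      (((hi _ _).add hid).const_mul lam)
    filter_upwards [(countable_singleton τ₁).ae_notMem volume] with ξ h1 h2
    have h3 : ξ ∈ Icc t τ₁ := ⟨h2.1.le, h2.2.trans hτ.2⟩
    have h4 : u ξ = v ξ := huv ⟨h3.1, lt_of_le_of_ne h3.2 h1⟩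
    simp only [vel]
    rw [h4]
    exact (le_add_of_nonneg_right (abs_nonneg _)).trans
      (hL ξ ⟨ht.1.trans h3.1, (hsub ξ h3).2⟩ _ _ _ _ (hxr _) (hxr _) (hyr _) (hyr _) _
        (hv.2 ξ (hsub ξ h3)))
  rw [intervalIntegral.integral_const_mul, intervalIntegral.integral_add (hi _ _) hid] at h1
  have h2 := integral_delay_le (ψ := fun ξ => ‖x ξ - y ξ‖) (fun _ => norm_nonneg _) hi T.h_pos.le
    hτ.1
  have h3 := norm_add_le (x t - y t) (∫ ξ in t..τ, (P.vel x u ξ - P.vel y v ξ))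
  rw [e1]
  nlinarith

end Regular
end Bolza

/-! ### Existence and uniqueness of motions -/

variable {n m : ℕ} {T : Horizon}

section Picard

variable (P : Bolza n m T) (g : Pt n T) (u : ℝ → Vec m) (K : ℝ)

/-- The path which continues the history of `g` by `τ ↦ e^{K (τ - g.t)} y(τ)`. The factor makes
the Picard operator a contraction in the uniform norm of `y`. -/
noncomputable def weightedPath (y : C(Icc g.t T.ϑ, Vec n)) : PC n (g.t - T.h) T.ϑ :=
  glue g (fun τ => Real.exp (K * (τ - g.t)) • IccExtend g.mem.2 y τ)
    (by
      have : Continuous (IccExtend g.mem.2 y) := y.continuous.Icc_extend'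
      fun_prop)

theorem weightedPath_of_mem (y : C(Icc g.t T.ϑ, Vec n)) {τ : ℝ} (hτ : τ ∈ Icc g.t T.ϑ) :
    weightedPath g K y τ = Real.exp (K * (τ - g.t)) • y ⟨τ, hτ⟩ := by
  rw [weightedPath, glue_of_mem hτ, IccExtend_of_mem _ _ hτ]

/-- The Picard operator of the delay system in the exponentially weighted unknown. -/
noncomputable def picard (R : ∀ x : PC n (g.t - T.h) T.ϑ,
    IntervalIntegrable (P.vel x u) volume g.t T.ϑ) (y : C(Icc g.t T.ϑ, Vec n)) :
    C(Icc g.t T.ϑ, Vec n) where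
  toFun τ := Real.exp (-(K * (τ - g.t))) •
    (g.z + ∫ ξ in g.t..τ, P.vel (weightedPath g K y) u ξ)
  continuous_toFun := by
    have h := intervalIntegral.continuousOn_primitive_interval'
      (R (weightedPath g K y)) left_mem_uIcc
    rw [uIcc_of_le g.mem.2] at h
    have h2 : Continuous fun τ : Icc g.t T.ϑ =>
        ∫ ξ in g.t..τ, P.vel (weightedPath g K y) u ξ :=
      continuousOn_iff_continuous_domRestrict.1 h
    fun_prop

theorem picard_apply (R : ∀ x : PC n (g.t - T.h) T.ϑ,
    IntervalIntegrable (P.vel x u) volume g.t T.ϑ) (y : C(Icc g.t T.ϑ, Vec n)) (τ : Icc g.t T.ϑ) :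
    picard P g u K R y τ = Real.exp (-(K * (τ - g.t))) •
      (g.z + ∫ ξ in g.t..τ, P.vel (weightedPath g K y) u ξ) := rfl

end Picard

namespace Bolza.Regular

variable {P : Bolza n m T} {c : ℝ}

/-- Motions are fixed points of the Picard operator. The Lipschitz condition is local, so the operator
is restricted to the closed set of the `y` whose path is bounded by an exponential `r` with
`r' = 3 c r`; by linear growth this set is invariant, and on it the operator is a `1/2`-contraction. -/
theorem exists_isMotion (R : P.Regular c) (g : Pt n T) {u : ℝ → Vec m}
    (hu : u ∈ P.controls g.t) : ∃ x, P.IsMotion g u x := by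
  have hh := T.h_pos
  have hc := R.c_pos
  have hab := g.mem.2
  obtain ⟨B, hB0, hB⟩ := g.w.exists_bound
  -- `3 c r` dominates the growth bound `c (1 + r + r)`, because `1 ≤ r`
  set A : ℝ := 1 + (‖g.z‖ + B) with hA
  have hA1 : 1 ≤ A := by linarith [norm_nonneg g.z]
  set r : ℝ → ℝ := fun τ => A * Real.exp (3 * c * (τ - g.t)) with hr
  have hrA : ∀ τ, g.t ≤ τ → A ≤ r τ := fun τ hτ =>
    le_mul_of_one_le_right (by linarith) (Real.one_le_exp (by
      have : 0 ≤ τ - g.t := by linarith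
      positivity))
  have hrmono : ∀ s τ, s ≤ τ → r s ≤ r τ := fun s τ h => by
    simp only [hr]; gcongr
  have hrcont : Continuous r := by fun_prop
  have hrint : ∀ τ, ∫ ξ in g.t..τ, 3 * c * r ξ = r τ - A := fun τ => by
    have h1 : ∀ ξ ∈ uIcc g.t τ, HasDerivAt r (3 * c * r ξ) ξ := fun ξ _ => by
      have h2 : HasDerivAt (fun ξ : ℝ => 3 * c * (ξ - g.t)) (3 * c) ξ := by
        simpa using ((hasDerivAt_id ξ).sub_const g.t).const_mul (3 * c)
      have h3 := (h2.exp).const_mul A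
      exact h3.congr_deriv (by simp only [hr]; ring)
    rw [intervalIntegral.integral_eq_sub_of_hasDerivAt h1
      ((hrcont.const_mul (3 * c)).intervalIntegrable _ _)]
    simp [hr]
  obtain ⟨lam, hlam, hL⟩ := R.f2 (r T.ϑ) (by linarith [hrA T.ϑ hab])
  -- the Lipschitz constant in the state and the delayed state together is `2 lam = K / 2`
  set K : ℝ := 4 * lam with hK
  have hi := fun x : PC n (g.t - T.h) T.ϑ => R.intervalIntegrable_vel g.mem hu x
  set S := picard P g u K hi with hS
  set s : Set C(Icc g.t T.ϑ, Vec n) :=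
    {y | ∀ τ : Icc g.t T.ϑ, ‖Real.exp (K * (τ - g.t)) • y τ‖ ≤ r τ} with hs
  have hscl : IsClosed s := by
    rw [hs, ofPred_forall]
    refine isClosed_iInter fun τ => isClosed_le ?_ continuous_const
    have : Continuous fun y : C(Icc g.t T.ϑ, Vec n) => y τ := continuous_eval_const τ
    fun_prop
  have hpath : ∀ y ∈ s, ∀ τ ∈ Icc (g.t - T.h) T.ϑ, ‖weightedPath g K y τ‖ ≤
      max A (r τ) := by
    intro y hy τ hτ
    rcases lt_or_ge τ g.t with h | h
    · rw [weightedPath, glue_of_lt hτ.1 h]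
      exact (hB _).trans (le_max_of_le_left (by linarith [norm_nonneg g.z]))
    · rw [weightedPath_of_mem g K y ⟨h, hτ.2⟩]
      exact (hy ⟨τ, h, hτ.2⟩).trans (le_max_right _ _)
  have hpath' : ∀ y ∈ s, ∀ ξ ∈ Icc g.t T.ϑ, ‖weightedPath g K y ξ‖ ≤ r ξ ∧
      ‖weightedPath g K y (ξ - T.h)‖ ≤ r ξ := by
    intro y hy ξ hξ
    refine ⟨(hpath y hy ξ ⟨by linarith [hξ.1], hξ.2⟩).trans (max_le (hrA ξ hξ.1) le_rfl),
      (hpath y hy (ξ - T.h) ⟨by linarith [hξ.1], by linarith [hξ.2]⟩).trans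
        (max_le (hrA ξ hξ.1) (hrmono _ _ (by linarith)))⟩
  have hmaps : MapsTo S s s := by
    intro y hy τ
    have h1 : Real.exp (K * (τ - g.t)) • S y τ =
        g.z + ∫ ξ in g.t..τ, P.vel (weightedPath g K y) u ξ := by
      rw [hS, picard_apply, smul_smul, ← Real.exp_add, add_neg_cancel, Real.exp_zero, one_smul]
    rw [h1]
    have h2 : ‖∫ ξ in g.t..(τ : ℝ), P.vel (weightedPath g K y) u ξ‖ ≤
        ∫ ξ in g.t..(τ : ℝ), 3 * c * r ξ := by
      refine intervalIntegral.norm_integral_le_of_norm_le τ.2.1 (Eventually.of_forall fun ξ hξ => ?_)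
        ((hrcont.const_mul (3 * c)).intervalIntegrable _ _)
      have hξ' : ξ ∈ Icc g.t T.ϑ := ⟨hξ.1.le, hξ.2.trans τ.2.2⟩
      refine (R.norm_vel_le g.mem hu _ hξ').trans ?_
      obtain ⟨h3, h4⟩ := hpath' y hy ξ hξ'
      have := hrA ξ hξ'.1
      nlinarith
    rw [hrint] at h2
    refine (norm_add_le _ _).trans ?_
    linarith
  have hlip : LipschitzWith (1 / 2) (hmaps.restrict S s s) := by
    refine LipschitzWith.of_dist_le_mul fun ⟨y, hy⟩ ⟨y', hy'⟩ => ?_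
    change dist (S y) (S y') ≤ _ * dist y y'
    have hd0 : 0 ≤ dist y y' := dist_nonneg
    refine (ContinuousMap.dist_le (mul_nonneg (NNReal.coe_nonneg _) dist_nonneg)).2 fun τ => ?_
    have hdiff : ∀ ξ ∈ Icc g.t T.ϑ, ‖weightedPath g K y ξ - weightedPath g K y' ξ‖ ≤
        Real.exp (K * (ξ - g.t)) * dist y y' ∧
        ‖weightedPath g K y (ξ - T.h) - weightedPath g K y' (ξ - T.h)‖ ≤
        Real.exp (K * (ξ - g.t)) * dist y y' := by
      have h0 : ∀ ξ ∈ Icc g.t T.ϑ, ‖weightedPath g K y ξ - weightedPath g K y' ξ‖ ≤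
        Real.exp (K * (ξ - g.t)) * dist y y' := by
        intro ξ hξ
        rw [weightedPath_of_mem g K y hξ, weightedPath_of_mem g K y' hξ, ← smul_sub, norm_smul,
          Real.norm_eq_abs, abs_of_pos (Real.exp_pos _), ← dist_eq_norm]
        exact mul_le_mul_of_nonneg_left (ContinuousMap.dist_apply_le_dist _) (Real.exp_pos _).le
      intro ξ hξ
      refine ⟨h0 ξ hξ, ?_⟩
      rcases lt_or_ge (ξ - T.h) g.t with h | h
      · rw [weightedPath, weightedPath, glue_of_lt (by linarith [hξ.1]) h,
          glue_of_lt (by linarith [hξ.1]) h, sub_self, norm_zero]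
        positivity
      · refine (h0 _ ⟨h, by linarith [hξ.2]⟩).trans ?_
        gcongr
        linarith
    have h1 : S y τ - S y' τ = Real.exp (-(K * (τ - g.t))) • ∫ ξ in g.t..(τ : ℝ),
        (P.vel (weightedPath g K y) u ξ - P.vel (weightedPath g K y') u ξ) := by
      rw [intervalIntegral.integral_sub (intervalIntegrable_sub (hi _) le_rfl τ.2.1 τ.2.2)
        (intervalIntegrable_sub (hi _) le_rfl τ.2.1 τ.2.2)]
      rw [hS, picard_apply, picard_apply, ← smul_sub, add_sub_add_left_eq_sub]
    have hE : Continuous fun ξ : ℝ => Real.exp (K * (ξ - g.t)) := by fun_prop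
    have hEint : ∫ ξ in g.t..(τ : ℝ), 2 * lam * Real.exp (K * (ξ - g.t)) * dist y y' =
        1 / 2 * (Real.exp (K * (τ - g.t)) - 1) * dist y y' := by
      have h2 : ∀ ξ ∈ uIcc g.t (τ : ℝ), HasDerivAt
          (fun ξ => 1 / 2 * (Real.exp (K * (ξ - g.t)) - 1) * dist y y')
          (2 * lam * Real.exp (K * (ξ - g.t)) * dist y y') ξ := fun ξ _ => by
        have h3 : HasDerivAt (fun ξ : ℝ => K * (ξ - g.t)) K ξ := by
          simpa using ((hasDerivAt_id ξ).sub_const g.t).const_mul K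
        have h4 := (((h3.exp).sub_const 1).const_mul (1 / 2)).mul_const (dist y y')
        exact h4.congr_deriv (by rw [hK]; ring)
      rw [intervalIntegral.integral_eq_sub_of_hasDerivAt h2
        (Continuous.intervalIntegrable (by fun_prop) _ _)]
      simp
    have h2 : ‖∫ ξ in g.t..(τ : ℝ),
        (P.vel (weightedPath g K y) u ξ - P.vel (weightedPath g K y') u ξ)‖ ≤
        1 / 2 * (Real.exp (K * (τ - g.t)) - 1) * dist y y' := by
      rw [← hEint]
      refine intervalIntegral.norm_integral_le_of_norm_le τ.2.1 (Eventually.of_forall fun ξ hξ => ?_)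
        (Continuous.intervalIntegrable (by fun_prop) _ _)
      have hξ' : ξ ∈ Icc g.t T.ϑ := ⟨hξ.1.le, hξ.2.trans τ.2.2⟩
      obtain ⟨h3, h4⟩ := hdiff ξ hξ'
      have hrξ := hrmono ξ T.ϑ hξ'.2
      obtain ⟨a1, a2⟩ := hpath' y hy ξ hξ'
      obtain ⟨b1, b2⟩ := hpath' y' hy' ξ hξ'
      have h5 := (le_add_of_nonneg_right (abs_nonneg _)).trans
        (hL ξ ⟨g.mem.1.trans hξ'.1, hξ'.2⟩ _ _ _ _ (a1.trans hrξ) (a2.trans hrξ) (b1.trans hrξ)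
          (b2.trans hrξ) _ (hu.2 ξ hξ'))
      refine h5.trans ?_
      nlinarith
    rw [dist_eq_norm, h1, norm_smul, Real.norm_eq_abs, abs_of_pos (Real.exp_pos _)]
    refine (mul_le_mul_of_nonneg_left h2 (Real.exp_pos _).le).trans ?_
    have h3 : Real.exp (-(K * (τ - g.t))) * Real.exp (K * (τ - g.t)) = 1 := by
      rw [← Real.exp_add, neg_add_cancel, Real.exp_zero]
    have h4 := Real.exp_pos (-(K * (τ - g.t)))
    have h5 : ((1 / 2 : NNReal) : ℝ) = 1 / 2 := by norm_num
    rw [h5]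
    calc Real.exp (-(K * (τ - g.t))) * (1 / 2 * (Real.exp (K * (τ - g.t)) - 1) * dist y y')
        = 1 / 2 * (Real.exp (-(K * (τ - g.t))) * Real.exp (K * (τ - g.t))
            - Real.exp (-(K * (τ - g.t)))) * dist y y' := by ring
      _ ≤ 1 / 2 * dist y y' := by
          rw [h3]
          nlinarith
  have h0s : (0 : C(Icc g.t T.ϑ, Vec n)) ∈ s := by
    intro τ
    simp only [ContinuousMap.zero_apply, smul_zero, norm_zero]
    linarith [hrA τ τ.2.1]
  obtain ⟨y, hys, hy, -⟩ := ContractingWith.exists_fixedPoint' hscl.isComplete hmaps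
    ⟨by rw [← NNReal.coe_lt_coe]; norm_num, hlip⟩ h0s (edist_ne_top _ _)
  refine ⟨weightedPath g K y, R.isMotion_of_eq_add_integral hu (fun τ hτ => ?_) fun τ hτ => ?_⟩
  · rw [weightedPath, glue_of_lt hτ.1 hτ.2]
  · rw [weightedPath_of_mem g K y hτ]
    have h1 : S y ⟨τ, hτ⟩ = y ⟨τ, hτ⟩ := by rw [hy.eq]
    rw [← h1]
    rw [hS, picard_apply, smul_smul, ← Real.exp_add, add_neg_cancel, Real.exp_zero, one_smul]

/-- Motions are causal: up to `τ₁` they only depend on the control before `τ₁`. -/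
theorem eq_of_eqOn (R : P.Regular c) {g : Pt n T} {u v : ℝ → Vec m}
    (hu : u ∈ P.controls g.t) (hv : v ∈ P.controls g.t) {x y : PC n (g.t - T.h) T.ϑ}
    (hx : P.IsMotion g u x) (hy : P.IsMotion g v y) {τ₁ : ℝ} (hτ₁ : τ₁ ∈ Icc g.t T.ϑ)
    (huv : EqOn u v (Ico g.t τ₁)) : ∀ ξ ≤ τ₁, x ξ = y ξ := by
  intro ξ hξ
  by_cases h1 : ξ ∈ Icc (g.t - T.h) T.ϑ
  swap
  · rw [x.zero_outside ξ h1, y.zero_outside ξ h1]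
  have hhist : ∀ ξ ∈ Ico (g.t - T.h) g.t, x ξ = y ξ := fun ξ h => by
    rw [hx.1.1 ξ h, hy.1.1 ξ h]
  rcases lt_or_ge ξ g.t with h2 | h2
  · exact hhist ξ ⟨h1.1, h2⟩
  obtain ⟨B, hB0, hB⟩ := x.exists_bound
  obtain ⟨B', hB0', hB'⟩ := y.exists_bound
  obtain ⟨lam, hlam, hL⟩ := R.f2 (B + B' + 1) (by linarith)
  have h3 := R.norm_sub_le_of_eqOn g.mem (continuousOn_of_mem_Lam hx.1)
    (continuousOn_of_mem_Lam hy.1) hu hv hτ₁ huv hlam (fun ξ => (hB ξ).trans (by linarith))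
    (fun ξ => (hB' ξ).trans (by linarith)) hL
    (fun τ hτ => eq_add_integral_of_isMotion hx ⟨le_rfl, g.mem.2⟩ hτ)
    (fun τ hτ => eq_add_integral_of_isMotion hy ⟨le_rfl, g.mem.2⟩ hτ) ξ ⟨h2, hξ⟩
  have h4 : ∫ ξ in (g.t - T.h)..g.t, ‖x ξ - y ξ‖ = 0 := by
    have h5 : ∫ ξ in (g.t - T.h)..g.t, ‖x ξ - y ξ‖ = ∫ ξ in (g.t - T.h)..g.t, (0 : ℝ) := by
      refine intervalIntegral.integral_congr_ae ?_
      filter_upwards [(countable_singleton g.t).ae_notMem volume] with ξ h5 h6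
      rw [uIoc_of_le (by linarith [T.h_pos])] at h6
      rw [hhist ξ ⟨h6.1.le, lt_of_le_of_ne h6.2 h5⟩, sub_self, norm_zero]
    simpa using h5
  rw [h4, hx.1.2.1, hy.1.2.1, sub_self, norm_zero, mul_zero, add_zero, zero_mul] at h3
  exact sub_eq_zero.1 (norm_le_zero_iff.1 h3)

theorem existsUnique_isMotion (R : P.Regular c) (g : Pt n T) {u : ℝ → Vec m}
    (hu : u ∈ P.controls g.t) : ∃! x, P.IsMotion g u x := by
  obtain ⟨x, hx⟩ := R.exists_isMotion g hu
  refine ⟨x, hx, fun y hy => PC.ext (funext fun ξ => ?_)⟩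
  by_cases h : ξ ≤ T.ϑ
  · exact R.eq_of_eqOn hu hu hy hx ⟨g.mem.2, le_rfl⟩ (fun _ _ => rfl) ξ h
  · rw [x.zero_outside ξ fun h' => h h'.2, y.zero_outside ξ fun h' => h h'.2]

end Bolza.Regular

/-! ### Dynamic programming -/

variable {n m : ℕ} {T : Horizon}

namespace Bolza

variable {P : Bolza n m T} {c : ℝ}

theorem controls_mono {t τ : ℝ} (h : t ≤ τ) {u : ℝ → Vec m} (hu : u ∈ P.controls t) :
    u ∈ P.controls τ :=
  ⟨hu.1.mono_measure (Measure.restrict_mono (Icc_subset_Icc_left h) le_rfl),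
    fun ξ hξ => hu.2 ξ ⟨h.trans hξ.1, hξ.2⟩⟩

theorem controls_of_measurable {t : ℝ} {u : ℝ → Vec m} (hu : Measurable u)
    (hU : ∀ ξ, u ξ ∈ P.U) : u ∈ P.controls t := ⟨hu.aemeasurable, fun ξ _ => hU ξ⟩

theorem controls_nonempty (R : P.Regular c) (t : ℝ) : (P.controls t).Nonempty := by
  obtain ⟨u, hu⟩ := R.nonempty
  exact ⟨fun _ => u, controls_of_measurable measurable_const fun _ => hu⟩

end Bolza

/-- The control that follows `u` before the time `τ` and `v` from `τ` on. -/
noncomputable def splice (τ : ℝ) (u v : ℝ → Vec m) (ξ : ℝ) : Vec m := if ξ < τ then u ξ else v ξ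

theorem splice_of_lt {τ ξ : ℝ} {u v : ℝ → Vec m} (h : ξ < τ) : splice τ u v ξ = u ξ := if_pos h

theorem splice_of_le {τ ξ : ℝ} {u v : ℝ → Vec m} (h : τ ≤ ξ) : splice τ u v ξ = v ξ :=
  if_neg (not_lt.2 h)

namespace Bolza

variable {P : Bolza n m T} {c : ℝ}

theorem splice_mem_controls {t τ : ℝ} (hτ : τ ∈ Icc t T.ϑ) {u v : ℝ → Vec m}
    (hu : u ∈ P.controls t) (hv : v ∈ P.controls τ) : splice τ u v ∈ P.controls t := by
  refine ⟨?_, fun ξ hξ => ?_⟩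
  · rw [← Ico_union_Icc_eq_Icc hτ.1 hτ.2]
    refine aemeasurable_union_iff.2 ⟨?_, ?_⟩
    · refine (hu.1.mono_measure (Measure.restrict_mono
        (Ico_subset_Icc_self.trans (Icc_subset_Icc_right hτ.2)) le_rfl)).congr ?_
      refine (ae_restrict_iff' measurableSet_Ico).2 (Eventually.of_forall fun ξ hξ => ?_)
      exact (splice_of_lt hξ.2).symm
    · refine hv.1.congr ?_
      refine (ae_restrict_iff' measurableSet_Icc).2 (Eventually.of_forall fun ξ hξ => ?_)
      exact (splice_of_le hξ.1).symm
  · rcases lt_or_ge ξ τ with h | h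
    · rw [splice_of_lt h]; exact hu.2 ξ hξ
    · rw [splice_of_le h]; exact hv.2 ξ ⟨h, hξ.2⟩

open Classical in
/-- The motion generated by the control `u` from `g`; an arbitrary path if there is none. -/
noncomputable def mot (P : Bolza n m T) (g : Pt n T) (u : ℝ → Vec m) : PC n (g.t - T.h) T.ϑ :=
  if h : ∃ x, P.IsMotion g u x then h.choose else line g 0

/-- The cost of the control `u`. -/
noncomputable def J (P : Bolza n m T) (g : Pt n T) (u : ℝ → Vec m) : ℝ :=
  P.cost g u (P.mot g u)

/-- The restriction of a motion is the motion generated from the point reached at the time `τ`. -/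
theorem isMotion_tail {g : Pt n T} {u : ℝ → Vec m} {x : PC n (g.t - T.h) T.ϑ}
    (hx : P.IsMotion g u x) (τ : Icc g.t T.ϑ) : P.IsMotion (g.along x τ) u (tail g x τ) := by
  have hh := T.h_pos
  refine ⟨⟨fun ξ hξ => ?_, ?_, ?_⟩, ?_⟩
  · rw [along_t] at hξ
    rw [tail_apply x τ hξ.1, along_t, along_w_apply g x τ (show ξ - (τ : ℝ) ∈ Icc (-T.h) 0 from
      ⟨by linarith [hξ.1], by linarith [hξ.2]⟩), add_sub_cancel]
  · exact tail_apply x τ (by rw [along_t]; linarith)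
  · obtain ⟨K, hK⟩ := hx.1.2.2
    refine ⟨K, fun ξ hξ ξ' hξ' => ?_⟩
    rw [along_t] at hξ hξ'
    rw [tail_apply x τ (by linarith [hξ.1]), tail_apply x τ (by linarith [hξ'.1])]
    exact hK ⟨τ.2.1.trans hξ.1, hξ.2⟩ ⟨τ.2.1.trans hξ'.1, hξ'.2⟩
  · have h1 := (ae_restrict_iff' measurableSet_Icc).1 hx.2
    refine (ae_restrict_iff' measurableSet_Icc).2 ?_
    filter_upwards [h1] with ξ h2 h3
    rw [along_t] at h3
    have h5 := h2 ⟨τ.2.1.trans h3.1, h3.2⟩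
    rw [tail_apply x τ (by linarith [h3.1]), tail_apply x τ (by linarith [h3.1])]
    refine h5.congr_of_eventuallyEq ?_
    filter_upwards [Ioi_mem_nhds (show (τ : ℝ) - T.h < ξ by linarith [h3.1])] with η hη
    exact tail_apply x τ (le_of_lt hη)

namespace Regular

theorem isMotion_mot (R : P.Regular c) {g : Pt n T} {u : ℝ → Vec m}
    (hu : u ∈ P.controls g.t) : P.IsMotion g u (P.mot g u) := by
  have h := R.exists_isMotion g hu
  rw [mot, dif_pos h]
  exact h.choose_spec

theorem mot_mem_Lam (R : P.Regular c) {g : Pt n T} {u : ℝ → Vec m}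
    (hu : u ∈ P.controls g.t) : P.mot g u ∈ Lam g := (R.isMotion_mot hu).1

theorem mot_mem_X (R : P.Regular c) {g : Pt n T} {u : ℝ → Vec m}
    (hu : u ∈ P.controls g.t) : P.mot g u ∈ X c g := R.mem_X_of_isMotion hu (R.isMotion_mot hu)

theorem mot_eq (R : P.Regular c) {g : Pt n T} {u : ℝ → Vec m}
    (hu : u ∈ P.controls g.t) {x : PC n (g.t - T.h) T.ϑ} (hx : P.IsMotion g u x) :
    P.mot g u = x := (R.existsUnique_isMotion g hu).unique (R.isMotion_mot hu) hx

theorem mot_congr (R : P.Regular c) {g : Pt n T} {u v : ℝ → Vec m}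
    (hu : u ∈ P.controls g.t) (hv : v ∈ P.controls g.t) {τ : ℝ} (hτ : τ ∈ Icc g.t T.ϑ)
    (huv : EqOn u v (Ico g.t τ)) : ∀ ξ ≤ τ, P.mot g u ξ = P.mot g v ξ :=
  R.eq_of_eqOn hu hv (R.isMotion_mot hu) (R.isMotion_mot hv) hτ huv

theorem along_mot_congr (R : P.Regular c) {g : Pt n T} {u v : ℝ → Vec m}
    (hu : u ∈ P.controls g.t) (hv : v ∈ P.controls g.t) {τ : Icc g.t T.ϑ}
    (huv : EqOn u v (Ico g.t τ)) : g.along (P.mot g u) τ = g.along (P.mot g v) τ :=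
  along_congr fun ξ hξ => R.mot_congr hu hv τ.2 huv ξ hξ.2

/-- The semigroup property of motions. -/
theorem mot_along (R : P.Regular c) {g : Pt n T} {u : ℝ → Vec m}
    (hu : u ∈ P.controls g.t) (τ : Icc g.t T.ϑ) :
    P.mot (g.along (P.mot g u) τ) u = tail g (P.mot g u) τ :=
  R.mot_eq (g := g.along (P.mot g u) τ) (controls_mono τ.2.1 hu)
    (isMotion_tail (R.isMotion_mot hu) τ)

theorem mot_ext (R : P.Regular c) {g : Pt n T} {u v : ℝ → Vec m}
    (hu : u ∈ P.controls g.t) (hv : v ∈ P.controls g.t) (huv : EqOn u v (Ico g.t T.ϑ)) :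
    P.mot g u = P.mot g v := by
  refine PC.ext (funext fun ξ => ?_)
  by_cases h : ξ ≤ T.ϑ
  · exact R.mot_congr hu hv ⟨g.mem.2, le_rfl⟩ huv ξ h
  · rw [PC.zero_outside _ ξ fun h' => h h'.2, PC.zero_outside _ ξ fun h' => h h'.2]

theorem along_mot_splice (R : P.Regular c) {g : Pt n T} {u v : ℝ → Vec m}
    (hu : u ∈ P.controls g.t) {τ : Icc g.t T.ϑ} (hv : v ∈ P.controls τ) :
    g.along (P.mot g (splice τ u v)) τ = g.along (P.mot g u) τ :=
  R.along_mot_congr (splice_mem_controls τ.2 hu hv) hu fun _ hξ => splice_of_lt hξ.2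

theorem mot_splice_eq_tail (R : P.Regular c) {g : Pt n T} {u v : ℝ → Vec m}
    (hu : u ∈ P.controls g.t) {τ : Icc g.t T.ϑ} (hv : v ∈ P.controls τ) :
    P.mot (g.along (P.mot g (splice τ u v)) τ) v = tail g (P.mot g (splice τ u v)) τ := by
  have hs := splice_mem_controls τ.2 hu hv
  rw [← R.mot_along hs τ]
  exact R.mot_ext hv (controls_mono τ.2.1 hs) fun η hη => (splice_of_le hη.1).symm

/-- After `τ` the spliced control generates the motion generated by `v` from the point reached
at the time `τ`. -/
theorem mot_splice (R : P.Regular c) {g : Pt n T} {u v : ℝ → Vec m}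
    (hu : u ∈ P.controls g.t) {τ : Icc g.t T.ϑ} (hv : v ∈ P.controls τ) {ξ : ℝ}
    (hξ : τ - T.h ≤ ξ) :
    P.mot (g.along (P.mot g u) τ) v ξ = P.mot g (splice τ u v) ξ := by
  rw [← R.along_mot_splice hu hv, R.mot_splice_eq_tail hu hv]
  exact tail_apply _ τ hξ

theorem along_mot_splice_of_le (R : P.Regular c) {g : Pt n T} {u v : ℝ → Vec m}
    (hu : u ∈ P.controls g.t) {τ : Icc g.t T.ϑ} (hv : v ∈ P.controls τ)
    (τ' : Icc (g.along (P.mot g u) τ).t T.ϑ) :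
    (g.along (P.mot g u) τ).along (P.mot (g.along (P.mot g u) τ) v) τ' =
      g.along (P.mot g (splice τ u v)) ⟨τ', τ.2.1.trans τ'.2.1, τ'.2.2⟩ := by
  have key : ∀ (g' : Pt n T) (_ : g' = g.along (P.mot g (splice τ u v)) τ) (τ'' : Icc g'.t T.ϑ)
      (h : (τ'' : ℝ) ∈ Icc g.t T.ϑ),
      g'.along (P.mot g' v) τ'' = g.along (P.mot g (splice τ u v)) ⟨τ'', h⟩ := by
    rintro _ rfl τ'' h
    rw [R.mot_splice_eq_tail hu hv]
    exact along_along_tail _ _ _ τ''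
  exact key _ (R.along_mot_splice hu hv).symm τ' _

/-- The cost splits at `τ` into the running cost up to `τ` and the cost from the point reached. -/
theorem J_eq_add (R : P.Regular c) {g : Pt n T} {u : ℝ → Vec m}
    (hu : u ∈ P.controls g.t) (τ : Icc g.t T.ϑ) :
    P.J g u = (∫ ξ in g.t..τ, P.run (P.mot g u) u ξ) + P.J (g.along (P.mot g u) τ) u := by
  have hi := R.intervalIntegrable_run g.mem hu (P.mot g u)
  have h1 := intervalIntegral.integral_add_adjacent_intervals
    (intervalIntegrable_sub hi le_rfl τ.2.1 τ.2.2) (intervalIntegrable_sub hi τ.2.1 τ.2.2 le_rfl)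
  have h2 : ∫ ξ in τ..T.ϑ, P.run (tail g (P.mot g u) τ) u ξ =
      ∫ ξ in τ..T.ϑ, P.run (P.mot g u) u ξ := by
    refine intervalIntegral.integral_congr fun ξ hξ => ?_
    rw [uIcc_of_le τ.2.2] at hξ
    simp only [run]
    rw [tail_apply _ τ (by linarith [T.h_pos, hξ.1]), tail_apply _ τ (by linarith [hξ.1])]
  have h3 : P.cost (g.along (P.mot g u) τ) u (tail g (P.mot g u) τ) =
      P.σ (P.mot g u T.ϑ) (seg (P.mot g u) ⟨T.ϑ, g.mem.2, le_rfl⟩) +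
        ∫ ξ in τ..T.ϑ, P.run (P.mot g u) u ξ := by
    rw [← h2]
    exact congrArg₂ (· + ·) (congrArg (fun p : Pt n T => P.σ p.z p.w)
      (along_along_tail g (P.mot g u) τ ⟨T.ϑ, τ.2.2, le_rfl⟩)) rfl
  unfold J
  rw [R.mot_along hu τ, h3]
  unfold cost
  rw [← h1]
  ring

theorem J_congr (R : P.Regular c) {g : Pt n T} {u v : ℝ → Vec m}
    (hu : u ∈ P.controls g.t) (hv : v ∈ P.controls g.t) (huv : EqOn u v (Icc g.t T.ϑ)) :
    P.J g u = P.J g v := by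
  unfold J cost
  rw [R.mot_ext hu hv (huv.mono Ico_subset_Icc_self)]
  congr 1
  refine intervalIntegral.integral_congr fun ξ hξ => ?_
  rw [uIcc_of_le g.mem.2] at hξ
  rw [huv hξ]

theorem costs_eq (R : P.Regular c) (g : Pt n T) : P.costs g = P.J g '' P.controls g.t := by
  ext r
  constructor
  · rintro ⟨u, hu, x, hx, rfl⟩
    exact ⟨u, hu, by rw [J, R.mot_eq hu hx]⟩
  · rintro ⟨u, hu, rfl⟩
    exact ⟨u, hu, _, R.isMotion_mot hu, rfl⟩

theorem abs_integral_run_le (R : P.Regular c) {t a b : ℝ} (ht : t ∈ Icc T.t₀ T.ϑ) {u : ℝ → Vec m}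
    (hu : u ∈ P.controls t) {x : PC n a b} {r : ℝ} (hx : ∀ ξ, ‖x ξ‖ ≤ r) {s τ : ℝ}
    (hs : t ≤ s) (hsτ : s ≤ τ) (hτ : τ ≤ T.ϑ) :
    |∫ ξ in s..τ, P.run x u ξ| ≤ c * (1 + r + r) * (τ - s) := by
  have := intervalIntegral.norm_integral_le_of_norm_le_const (a := s) (b := τ)
    (f := P.run x u) (C := c * (1 + r + r)) fun ξ hξ => ?_
  · rwa [abs_of_nonneg (by linarith : 0 ≤ τ - s)] at this
  · rw [uIoc_of_le hsτ] at hξ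
    refine (R.abs_run_le ht hu x ⟨hs.trans hξ.1.le, hξ.2.trans hτ⟩).trans ?_
    exact mul_le_mul_of_nonneg_left (by linarith [hx ξ, hx (ξ - T.h)]) R.c_pos.le

theorem bddBelow_J (R : P.Regular c) (g : Pt n T) : BddBelow (P.J g '' P.controls g.t) := by
  obtain ⟨α, hα, hg⟩ := exists_mem_bounded g
  set r := radius T c α
  have hr : α ≤ r := le_radius R.c_pos hα.le
  have hr0 : 0 < r := hα.trans_le hr
  obtain ⟨lam, hlam, hL⟩ := R.sigma r hr0
  refine ⟨P.σ g.z g.w - lam * ((r + r) + (r + r) * T.h) - c * (1 + r + r) * (T.ϑ - g.t), ?_⟩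
  rintro _ ⟨u, hu, rfl⟩
  have hx := norm_le_radius_of_mem_X R.c_pos hα.le hg (R.mot_mem_X hu)
  have h1 := hL (P.mot g u T.ϑ) g.z (seg (P.mot g u) ⟨T.ϑ, g.mem.2, le_rfl⟩) g.w
    (mem_bounded_of_le (fun ξ _ => hx ξ) (hx _)) (bounded_mono hr hg)
  have hb := (bounded_mono hr hg)
  have h2 : ‖P.mot g u T.ϑ - g.z‖ ≤ r + r := (norm_sub_le _ _).trans (add_le_add (hx _) hb.1)
  have h3 : norm1 T (fun ξ => seg (P.mot g u) ⟨T.ϑ, g.mem.2, le_rfl⟩ ξ - g.w ξ) ≤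
      (r + r) * T.h := by
    refine norm1_sub_le (by linarith) fun ξ hξ => ?_
    have hξ' : ξ ∈ Icc (-T.h) 0 := ⟨hξ.1, hξ.2.le⟩
    rw [seg_apply _ _ hξ']
    exact (norm_sub_le _ _).trans (add_le_add (hx _) (hb.2 ξ hξ'))
  have h4 := R.abs_integral_run_le g.mem hu hx le_rfl g.mem.2 le_rfl
  have h5 : lam * (‖P.mot g u T.ϑ - g.z‖ +
      norm1 T (fun ξ => seg (P.mot g u) ⟨T.ϑ, g.mem.2, le_rfl⟩ ξ - g.w ξ)) ≤
      lam * ((r + r) + (r + r) * T.h) := by gcongr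
  have h6 := (abs_le.1 (h1.trans h5)).1
  have h7 := (abs_le.1 h4).1
  unfold J cost
  change _ ≤ _ + ∫ ξ in g.t..T.ϑ, P.run (P.mot g u) u ξ
  linarith

/-- Controls exist and the costs are bounded below, so that the infimum is not a junk value. -/
theorem isGLB_value (R : P.Regular c) (g : Pt n T) :
    IsGLB (P.J g '' P.controls g.t) (P.value g) := by
  rw [value, R.costs_eq]
  exact isGLB_csInf ((controls_nonempty R g.t).image _) (R.bddBelow_J g)

theorem value_le_J (R : P.Regular c) {g : Pt n T} {u : ℝ → Vec m} (hu : u ∈ P.controls g.t) :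
    P.value g ≤ P.J g u := (R.isGLB_value g).1 ⟨u, hu, rfl⟩

theorem exists_J_lt (R : P.Regular c) (g : Pt n T) {ε : ℝ} (hε : 0 < ε) :
    ∃ u ∈ P.controls g.t, P.J g u < P.value g + ε := by
  obtain ⟨_, ⟨u, hu, rfl⟩, -, h⟩ := (R.isGLB_value g).exists_between (lt_add_of_pos_right _ hε)
  exact ⟨u, hu, h⟩

/-- Half of the dynamic programming principle: the control `u` is admissible from the point reached
at the time `τ`. -/
theorem integral_run_add_value_le_J (R : P.Regular c) {g : Pt n T} {u : ℝ → Vec m}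
    (hu : u ∈ P.controls g.t) (τ : Icc g.t T.ϑ) :
    (∫ ξ in g.t..τ, P.run (P.mot g u) u ξ) + P.value (g.along (P.mot g u) τ) ≤ P.J g u := by
  rw [R.J_eq_add hu τ]
  exact add_le_add le_rfl (R.value_le_J (g := g.along (P.mot g u) τ) (controls_mono τ.2.1 hu))

/-- Half of the dynamic programming principle: at the time `τ`, the control `u` may be replaced by one
that is almost optimal from then on. -/
theorem value_le_integral_run_add_value (R : P.Regular c) {g : Pt n T} {u : ℝ → Vec m}
    (hu : u ∈ P.controls g.t) (τ : Icc g.t T.ϑ) :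
    P.value g ≤ (∫ ξ in g.t..τ, P.run (P.mot g u) u ξ) + P.value (g.along (P.mot g u) τ) := by
  refine le_of_forall_pos_le_add fun ε hε => ?_
  obtain ⟨v, hv, hv'⟩ := R.exists_J_lt (g.along (P.mot g u) τ) hε
  have hs := splice_mem_controls τ.2 hu hv
  have h1 := R.value_le_J hs
  have h2 : ∀ g', g' = g.along (P.mot g u) τ → P.J g' (splice τ u v) = P.J g' v := by
    rintro _ rfl
    exact R.J_congr (g := g.along (P.mot g u) τ) (controls_mono τ.2.1 hs) hv
      fun ξ hξ => splice_of_le hξ.1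
  rw [R.J_eq_add hs τ, h2 _ (R.along_mot_splice hu hv), R.along_mot_splice hu hv] at h1
  have h3 : ∫ ξ in g.t..τ, P.run (P.mot g (splice τ u v)) (splice τ u v) ξ =
      ∫ ξ in g.t..τ, P.run (P.mot g u) u ξ := by
    refine intervalIntegral.integral_congr_ae ?_
    filter_upwards [(countable_singleton (τ : ℝ)).ae_notMem volume] with ξ h3 h4
    rw [uIoc_of_le τ.2.1] at h4
    have h5 : ξ < τ := lt_of_le_of_ne h4.2 h3
    have h6 := R.mot_congr hs hu τ.2 fun _ hξ => splice_of_lt hξ.2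
    simp only [run]
    rw [h6 ξ h4.2, h6 (ξ - T.h) (by linarith [T.h_pos]), splice_of_lt h5]
  rw [h3] at h1
  linarith

end Regular
end Bolza

/-! ### The value functional belongs to `Φ` -/

variable {n m : ℕ} {T : Horizon}

/-- Over the past, the distance of two paths is the `‖·‖₁`-distance of the histories. -/
theorem integral_norm_sub_history {g g' : Pt n T} (ht : g'.t = g.t)
    {x : PC n (g.t - T.h) T.ϑ} {x' : PC n (g'.t - T.h) T.ϑ} (hx : x ∈ Lam g) (hx' : x' ∈ Lam g') :
    ∫ ξ in (g.t - T.h)..g.t, ‖x ξ - x' ξ‖ = norm1 T (fun ξ => g.w ξ - g'.w ξ) := by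
  have h1 := intervalIntegral.integral_comp_add_left (a := -T.h) (b := 0)
    (fun ξ => ‖x ξ - x' ξ‖) g.t
  rw [← sub_eq_add_neg, add_zero] at h1
  rw [← h1]
  refine intervalIntegral.integral_congr_ae ?_
  filter_upwards [(countable_singleton (0 : ℝ)).ae_notMem volume] with ξ h2 h3
  rw [uIoc_of_le (by linarith [T.h_pos])] at h3
  have h4 : ξ ∈ Ico (-T.h) 0 := ⟨h3.1.le, lt_of_le_of_ne h3.2 h2⟩
  rw [apply_add_of_mem_Lam hx h4]
  have h5 := apply_add_of_mem_Lam hx' h4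
  rw [show g'.t + ξ = g.t + ξ by rw [ht]] at h5
  rw [h5]

namespace Bolza.Regular

variable {P : Bolza n m T} {c : ℝ}

/-- The cost is Lipschitz in the initial data, uniformly in the control. -/
theorem exists_lipschitz_J (R : P.Regular c) {α : ℝ} (hα : 0 < α) :
    ∃ lam > 0, ∀ g g' : Pt n T, g'.t = g.t → (g.z, g.w) ∈ bounded n T α →
      (g'.z, g'.w) ∈ bounded n T α → ∀ u ∈ P.controls g.t,
      |P.J g u - P.J g' u| ≤ lam * (‖g.z - g'.z‖ + norm1 T (fun ξ => g.w ξ - g'.w ξ)) := by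
  set r := radius T c α
  have hr0 : 0 < r := hα.trans_le (le_radius R.c_pos hα.le)
  obtain ⟨ls, hls, hσ⟩ := R.sigma r hr0
  obtain ⟨lf, hlf, hL⟩ := R.f2 r hr0
  have hh := T.h_pos
  set L := T.ϑ - T.t₀ with hLdef
  have hL0 : 0 < L := by linarith [T.t₀_lt]
  set E := (1 + lf) * Real.exp (2 * lf * L) with hE
  have hE0 : 0 < E := by positivity
  refine ⟨ls * (E + 1 + E * L) + lf * (1 + 2 * (E * L)), by positivity, ?_⟩
  rintro g ⟨t', ht', z', w'⟩ rfl hg hg' u hu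
  set g' : Pt n T := ⟨g.t, ht', z', w'⟩ with hg'def
  set x := P.mot g u with hxdef
  set x' := P.mot g' u with hx'def
  have hxr := norm_le_radius_of_mem_X R.c_pos hα.le hg (R.mot_mem_X hu)
  have hxr' := norm_le_radius_of_mem_X R.c_pos hα.le hg' (R.mot_mem_X (g := g') hu)
  have hxm := R.isMotion_mot hu
  have hxm' := R.isMotion_mot (g := g') hu
  set N := norm1 T (fun ξ => g.w ξ - w' ξ) with hN
  set D := ‖g.z - z'‖ + N with hD
  have hN0 : 0 ≤ N := norm1_nonneg _
  have hz0 : 0 ≤ ‖g.z - z'‖ := norm_nonneg _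
  have hD0 : 0 ≤ D := by positivity
  have hND : N ≤ D := by linarith
  have hhist : ∫ ξ in (g.t - T.h)..g.t, ‖x ξ - x' ξ‖ = N :=
    integral_norm_sub_history (g := g) (g' := g') (x := x) (x' := x') rfl hxm.1 hxm'.1
  have hclose : ∀ τ ∈ Icc g.t T.ϑ, ‖x τ - x' τ‖ ≤ E * D := by
    intro τ hτ
    have h1 := R.norm_sub_le_of_eqOn g.mem (x := x) (y := x') (continuousOn_of_mem_Lam hxm.1)
      (continuousOn_of_mem_Lam (g := g') hxm'.1) hu hu ⟨g.mem.2, le_rfl⟩ (fun _ _ => rfl) hlf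
      hxr hxr' hL (fun τ hτ => eq_add_integral_of_isMotion hxm ⟨le_rfl, g.mem.2⟩ hτ)
      (fun τ hτ => eq_add_integral_of_isMotion hxm' ⟨le_rfl, g.mem.2⟩ hτ) τ hτ
    have e1 : x g.t = g.z := hxm.1.2.1
    have e2 : x' g.t = z' := hxm'.1.2.1
    rw [hhist, e1, e2] at h1
    have h2 : Real.exp (2 * lf * (τ - g.t)) ≤ Real.exp (2 * lf * L) := by
      apply Real.exp_le_exp.2
      have : τ - g.t ≤ L := by linarith [hτ.2, g.mem.1]
      gcongr
    refine h1.trans ?_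
    calc (‖g.z - z'‖ + lf * N) * Real.exp (2 * lf * (τ - g.t))
        ≤ ((1 + lf) * D) * Real.exp (2 * lf * L) := by
          gcongr
          nlinarith
      _ = E * D := by rw [hE]; ring
  have hi := x.intervalIntegrable_norm_sub x'
  have hint : ∫ ξ in g.t..T.ϑ, ‖x ξ - x' ξ‖ ≤ E * D * L := by
    have h1 := intervalIntegral.integral_mono_on g.mem.2 (hi _ _) intervalIntegrable_const hclose
    rw [intervalIntegral.integral_const, smul_eq_mul, mul_comm] at h1
    refine h1.trans ?_
    have : T.ϑ - g.t ≤ L := by linarith [g.mem.1]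
    gcongr
  have hseg : norm1 T (fun ξ => seg x ⟨T.ϑ, g.mem.2, le_rfl⟩ ξ -
      seg (t := g'.t) x' ⟨T.ϑ, g.mem.2, le_rfl⟩ ξ) ≤ N + E * D * L := by
    rw [norm1_seg_sub_seg (t' := g'.t) x x' _ _ rfl, ← hhist]
    refine le_trans ?_ (add_le_add le_rfl hint)
    rw [intervalIntegral.integral_add_adjacent_intervals (hi _ _) (hi _ _)]
    exact intervalIntegral.integral_mono_interval (by linarith [g.mem.2]) (by simp only; linarith)
      le_rfl (Eventually.of_forall fun _ => norm_nonneg _) (hi _ _)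
  have hσ1 := hσ (x T.ϑ) (x' T.ϑ) _ _
    (mem_bounded_of_le (τ := ⟨T.ϑ, g.mem.2, le_rfl⟩) (fun ξ _ => hxr ξ) (hxr _))
    (mem_bounded_of_le (t := g'.t) (τ := ⟨T.ϑ, g.mem.2, le_rfl⟩) (fun ξ _ => hxr' ξ) (hxr' _))
  have hσ2 := hσ1.trans (mul_le_mul_of_nonneg_left
    (add_le_add (hclose T.ϑ ⟨g.mem.2, le_rfl⟩) hseg) hls.le)
  have hid : IntervalIntegrable (fun ξ => ‖x (ξ - T.h) - x' (ξ - T.h)‖) volume g.t T.ϑ := by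
    simpa using (hi (g.t - T.h) (T.ϑ - T.h)).comp_sub_right T.h
  have hrun : |∫ ξ in g.t..T.ϑ, (P.run x u ξ - P.run x' u ξ)| ≤
      lf * (N + 2 * (E * D * L)) := by
    have h1 : |∫ ξ in g.t..T.ϑ, (P.run x u ξ - P.run x' u ξ)| ≤
        ∫ ξ in g.t..T.ϑ, lf * (‖x ξ - x' ξ‖ + ‖x (ξ - T.h) - x' (ξ - T.h)‖) := by
      rw [← Real.norm_eq_abs]
      refine intervalIntegral.norm_integral_le_of_norm_le g.mem.2
        (Eventually.of_forall fun ξ hξ => ?_) (((hi _ _).add hid).const_mul lf)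
      exact (le_add_of_nonneg_left (norm_nonneg _)).trans
        (hL ξ ⟨g.mem.1.trans hξ.1.le, hξ.2⟩ _ _ _ _ (hxr _) (hxr _) (hxr' _) (hxr' _) _
          (hu.2 ξ (Ioc_subset_Icc_self hξ)))
    rw [intervalIntegral.integral_const_mul, intervalIntegral.integral_add (hi _ _) hid] at h1
    have h2 := integral_delay_le (ψ := fun ξ => ‖x ξ - x' ξ‖) (fun _ => norm_nonneg _) hi
      hh.le g.mem.2
    rw [hhist] at h2
    refine h1.trans (mul_le_mul_of_nonneg_left ?_ hlf.le)
    linarith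
  have hsub : ∫ ξ in g.t..T.ϑ, (P.run x u ξ - P.run x' u ξ) =
      (∫ ξ in g.t..T.ϑ, P.run x u ξ) - ∫ ξ in g.t..T.ϑ, P.run x' u ξ :=
    intervalIntegral.integral_sub (R.intervalIntegrable_run g.mem hu x)
      (R.intervalIntegrable_run g.mem hu x')
  have hJ : P.J g u - P.J g' u = (P.σ (x T.ϑ) (seg x ⟨T.ϑ, g.mem.2, le_rfl⟩) -
      P.σ (x' T.ϑ) (seg (t := g'.t) x' ⟨T.ϑ, g.mem.2, le_rfl⟩)) +
      ∫ ξ in g.t..T.ϑ, (P.run x u ξ - P.run x' u ξ) := by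
    rw [hsub]
    unfold J cost
    ring
  rw [hJ]
  refine (abs_add_le _ _).trans ((add_le_add hσ2 hrun).trans ?_)
  have h1 : ls * (E * D + (N + E * D * L)) ≤ ls * (E * D + (D + E * D * L)) := by gcongr
  have h2 : lf * (N + 2 * (E * D * L)) ≤ lf * (D + 2 * (E * D * L)) := by gcongr
  refine (add_le_add h1 h2).trans (le_of_eq ?_)
  ring

theorem exists_lipschitz_value (R : P.Regular c) {α : ℝ} (hα : 0 < α) :
    ∃ lam > 0, ∀ g g' : Pt n T, g'.t = g.t → (g.z, g.w) ∈ bounded n T α →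
      (g'.z, g'.w) ∈ bounded n T α →
      |P.value g - P.value g'| ≤ lam * (‖g.z - g'.z‖ + norm1 T (fun ξ => g.w ξ - g'.w ξ)) := by
  obtain ⟨lam, hlam, h⟩ := R.exists_lipschitz_J hα
  refine ⟨lam, hlam, ?_⟩
  have key : ∀ g g' : Pt n T, g'.t = g.t → (g.z, g.w) ∈ bounded n T α →
      (g'.z, g'.w) ∈ bounded n T α →
      P.value g - P.value g' ≤ lam * (‖g.z - g'.z‖ + norm1 T (fun ξ => g.w ξ - g'.w ξ)) := by
    intro g g' ht hg hg'
    have h1 : P.value g - lam * (‖g.z - g'.z‖ + norm1 T (fun ξ => g.w ξ - g'.w ξ)) ≤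
        P.value g' := by
      refine (R.isGLB_value g').2 ?_
      rintro _ ⟨u, hu, rfl⟩
      rw [ht] at hu
      have h2 := (abs_le.1 (h g g' ht hg hg' u hu)).2
      have h3 := R.value_le_J hu
      linarith
    linarith
  intro g g' ht hg hg'
  refine abs_le.2 ⟨?_, key g g' ht hg hg'⟩
  have h1 := key g' g ht.symm hg' hg
  rw [norm_sub_rev, norm1_sub_comm] at h1
  linarith

/-- A modulus of continuity of the value functional in the time variable. -/
theorem exists_modulus_value (R : P.Regular c) (z : Vec n) (w : Hist n T) :
    ∃ C lam : ℝ, ∀ (t₁ t₂ : ℝ) (h₁ : t₁ ∈ Icc T.t₀ T.ϑ) (h₂ : t₂ ∈ Icc T.t₀ T.ϑ), t₁ ≤ t₂ →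
      |P.value ⟨t₁, h₁, z, w⟩ - P.value ⟨t₂, h₂, z, w⟩| ≤
        C * (t₂ - t₁) + lam * ∫ ξ in (-T.h)..0, ‖w (t₂ - t₁ + ξ) - w (0 + ξ)‖ := by
  have hh := T.h_pos
  obtain ⟨α, hα, hg⟩ := exists_mem_bounded (⟨T.t₀, ⟨le_rfl, T.t₀_lt.le⟩, z, w⟩ : Pt n T)
  set r := radius T c α
  have hr : α ≤ r := le_radius R.c_pos hα.le
  have hr0 : 0 < r := hα.trans_le hr
  obtain ⟨lam, hlam, hL⟩ := R.exists_lipschitz_value hr0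
  set A := c * (1 + r + r) with hA
  have hA0 : 0 ≤ A := mul_nonneg R.c_pos.le (by linarith)
  refine ⟨A + lam * (A + 2 * r), lam, fun t₁ t₂ h₁ h₂ h12 => ?_⟩
  set g : Pt n T := ⟨t₁, h₁, z, w⟩ with hgdef
  set δ := t₂ - t₁ with hδ
  set W := ∫ ξ in (-T.h)..0, ‖w (δ + ξ) - w (0 + ξ)‖ with hW
  have hδ0 : 0 ≤ δ := by linarith
  -- the point reached at the time `t₂` is close to `(z, w)`, whatever the control
  have key : ∀ u ∈ P.controls t₁,
      |(∫ ξ in t₁..t₂, P.run (P.mot g u) u ξ) + P.value (g.along (P.mot g u) ⟨t₂, h12, h₂.2⟩) -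
        P.value ⟨t₂, h₂, z, w⟩| ≤ (A + lam * (A + 2 * r)) * δ + lam * W := by
    intro u hu
    set x := P.mot g u with hx
    have hxX : x ∈ X c g := R.mot_mem_X hu
    have hxr := norm_le_radius_of_mem_X R.c_pos hα.le (g := g) hg hxX
    have h3 := R.abs_integral_run_le h₁ hu hxr le_rfl h12 h₂.2
    have h4 := hL (g.along x ⟨t₂, h12, h₂.2⟩) ⟨t₂, h₂, z, w⟩ rfl
      (mem_bounded_of_le (fun ξ _ => hxr ξ) (hxr _)) (bounded_mono hr hg)
    have h5 : ‖(g.along x ⟨t₂, h12, h₂.2⟩).z - z‖ ≤ A * δ := by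
      have := norm_sub_le_mul_of_mem_X R.c_pos hxX hxr (s := g.t) (τ := t₂)
        ⟨le_rfl, h₁.2⟩ ⟨h12, h₂.2⟩
      rwa [hxX.1.2.1] at this
    have h6 : norm1 T (fun ξ => (g.along x ⟨t₂, h12, h₂.2⟩).w ξ - w ξ) ≤ W + 2 * r * δ := by
      have hwi : IntervalIntegrable (fun ξ => ‖w (δ + ξ) - w (0 + ξ)‖) volume (-T.h) 0 := by
        obtain ⟨B, hB0, hB⟩ := w.exists_bound
        refine (intervalIntegrable_const (c := B + B)).mono_fun ?_
          (Eventually.of_forall fun ξ => ?_)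
        · exact ((w.measurable.comp (measurable_const_add δ)).sub
            (w.measurable.comp (measurable_const_add 0))).norm.aestronglyMeasurable
        · simp only [Real.norm_eq_abs, abs_norm]
          exact ((norm_sub_le _ _).trans (add_le_add (hB _) (hB _))).trans (le_abs_self _)
      have hind : IntervalIntegrable ((Icc (-δ) 0).indicator fun _ => 2 * r) volume (-T.h) 0 := by
        refine Integrable.intervalIntegrable ?_
        exact (integrable_indicator_iff measurableSet_Icc).2 (integrableOn_const (by simp))
      have h7 : norm1 T (fun ξ => (g.along x ⟨t₂, h12, h₂.2⟩).w ξ - w ξ) ≤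
          ∫ ξ in (-T.h)..0, (‖w (δ + ξ) - w (0 + ξ)‖ +
            (Icc (-δ) 0).indicator (fun _ => 2 * r) ξ) := by
        refine intervalIntegral.integral_mono_on (by linarith)
          (PC.intervalIntegrable_norm_sub _ _ _ _) (hwi.add hind) fun ξ hξ => ?_
        change ‖(g.along x ⟨t₂, h12, h₂.2⟩).w ξ - w ξ‖ ≤ _
        rw [along_w_apply g x ⟨t₂, h12, h₂.2⟩ hξ, zero_add]
        rcases lt_or_ge ξ (-δ) with h8 | h8
        · have h9 : x (t₂ + ξ) = w (δ + ξ) := by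
            have : t₂ + ξ ∈ Ico (g.t - T.h) g.t :=
              ⟨by simp only [hgdef]; linarith [hξ.1], by simp only [hgdef]; linarith⟩
            rw [hxX.1.1 _ this]
            congr 1
            simp only [hgdef]; rw [hδ]; ring
          rw [h9]
          exact le_add_of_nonneg_right (indicator_nonneg (fun _ _ => by linarith) _)
        · rw [indicator_of_mem (show ξ ∈ Icc (-δ) 0 from ⟨h8, hξ.2⟩)]
          have h9 := hxr (t₂ + ξ)
          have h10 := hg.2 ξ hξ
          simp only at h10
          have h11 := norm_sub_le (x (t₂ + ξ)) (w ξ)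
          have h12 := norm_nonneg (w (δ + ξ) - w ξ)
          linarith
      refine h7.trans ?_
      rw [intervalIntegral.integral_add hwi hind]
      refine add_le_add le_rfl ?_
      rw [intervalIntegral.integral_of_le (by linarith)]
      refine (setIntegral_le_integral ((integrable_indicator_iff measurableSet_Icc).2
        (integrableOn_const (by simp))) (Eventually.of_forall fun ξ =>
          indicator_nonneg (fun _ _ => by linarith) _)).trans (le_of_eq ?_)
      rw [integral_indicator measurableSet_Icc, setIntegral_const]
      simp [hδ0, mul_comm]
    have h7 := h4.trans (mul_le_mul_of_nonneg_left (add_le_add h5 h6) hlam.le)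
    have h8 := abs_add_le (∫ ξ in t₁..t₂, P.run x u ξ)
      (P.value (g.along x ⟨t₂, h12, h₂.2⟩) - P.value ⟨t₂, h₂, z, w⟩)
    rw [add_sub_assoc]
    refine h8.trans ((add_le_add h3 h7).trans (le_of_eq ?_))
    ring
  rw [abs_sub_comm]
  refine abs_le.2 ⟨?_, ?_⟩
  · obtain ⟨u, hu⟩ := controls_nonempty R t₁
    have h1 := R.value_le_integral_run_add_value (g := g) hu ⟨t₂, h12, h₂.2⟩
    have h2 := (abs_le.1 (key u hu)).2
    change _ ≤ (∫ ξ in t₁..t₂, P.run (P.mot g u) u ξ) + _ at h1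
    linarith
  · have h1 : P.value ⟨t₂, h₂, z, w⟩ - ((A + lam * (A + 2 * r)) * δ + lam * W) ≤ P.value g := by
      refine (R.isGLB_value g).2 ?_
      rintro _ ⟨u, hu, rfl⟩
      have h1 := R.integral_run_add_value_le_J (g := g) hu ⟨t₂, h12, h₂.2⟩
      have h2 := (abs_le.1 (key u hu)).1
      change (∫ ξ in t₁..t₂, P.run (P.mot g u) u ξ) + _ ≤ _ at h1
      linarith
    linarith

/-- The Lipschitz condition comes from that of the cost; continuity in `t` from dynamic programming
and the continuity of translations in `L¹`. -/
theorem inPhi_value (R : P.Regular c) : InPhi P.value := by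
  refine ⟨fun z w => ?_, fun α hα => ?_⟩
  · obtain ⟨C, lam, h⟩ := R.exists_modulus_value z w
    set W : ℝ → ℝ := fun δ => C * δ + lam * ∫ ξ in (-T.h)..0, ‖w (δ + ξ) - w (0 + ξ)‖ with hW
    have hW0 : Tendsto W (𝓝 0) (𝓝 0) := by
      have h1 : Tendsto (fun δ : ℝ => C * δ) (𝓝 0) (𝓝 (C * 0)) := tendsto_id.const_mul C
      have := h1.add ((w.tendsto_integral_shift (-T.h) 0 0).const_mul lam)
      simpa [hW] using this
    refine continuous_iff_continuousAt.2 fun t => ?_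
    have h1 : ∀ s : Icc T.t₀ T.ϑ,
        |P.value ⟨s, s.2, z, w⟩ - P.value ⟨t, t.2, z, w⟩| ≤ W |(s : ℝ) - t| := by
      intro s
      rcases le_total (s : ℝ) t with hst | hst
      · rw [abs_sub_comm (s : ℝ), abs_of_nonneg (sub_nonneg.2 hst)]
        exact h s t s.2 t.2 hst
      · rw [abs_of_nonneg (sub_nonneg.2 hst), abs_sub_comm]
        exact h t s t.2 s.2 hst
    have h2 : Tendsto (fun s : Icc T.t₀ T.ϑ => W |(s : ℝ) - t|) (𝓝 t) (𝓝 0) := by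
      refine hW0.comp ?_
      have : Continuous fun s : Icc T.t₀ T.ϑ => |(s : ℝ) - t| := by fun_prop
      simpa using this.tendsto t
    have h3 := squeeze_zero_norm (fun s => (Real.norm_eq_abs _).le.trans (h1 s)) h2
    have h4 := h3.add_const (P.value ⟨t, t.2, z, w⟩)
    simp only [sub_add_cancel, zero_add] at h4
    exact h4
  · obtain ⟨lam, hlam, h⟩ := R.exists_lipschitz_value hα
    exact ⟨lam, hlam, fun t ht z z' w w' h1 h2 =>
      h ⟨t, ht, z, w⟩ ⟨t, ht, z', w'⟩ rfl h1 h2⟩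

/-- At the final time every motion is trivial. The history of the motion may differ from the given
one at `0`, which `σ` does not see. -/
theorem terminal_value (R : P.Regular c) : P.Terminal P.value := by
  intro z w
  set g : Pt n T := ⟨T.ϑ, ⟨T.t₀_lt.le, le_rfl⟩, z, w⟩ with hg
  have hJ : ∀ u ∈ P.controls g.t, P.J g u = P.σ z w := by
    intro u hu
    have hx := R.mot_mem_Lam hu
    set x := P.mot g u with hxdef
    obtain ⟨B, hB0, hB⟩ := x.exists_bound
    obtain ⟨α, hα, hgα⟩ := exists_mem_bounded g
    obtain ⟨lam, -, hlam⟩ := R.sigma (α + B) (by linarith)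
    have h1 := hlam (x T.ϑ) z (seg x ⟨T.ϑ, g.mem.2, le_rfl⟩) w
      (mem_bounded_of_le (fun ξ _ => (hB ξ).trans (by linarith)) ((hB _).trans (by linarith)))
      (bounded_mono (by linarith) hgα)
    have h2 : norm1 T (fun ξ => seg x ⟨T.ϑ, g.mem.2, le_rfl⟩ ξ - w ξ) ≤ 0 := by
      refine (norm1_sub_le_of_eq (δ := 0) (D := 0) le_rfl le_rfl ?_ ?_).trans (by simp)
      · intro ξ hξ
        rw [neg_zero] at hξ
        rw [seg_apply _ _ ⟨hξ.1, hξ.2.le⟩]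
        exact apply_add_of_mem_Lam hx hξ
      · intro ξ hξ h
        linarith [hξ.2]
    have h3 : x T.ϑ = z := hx.2.1
    rw [h3, sub_self, norm_zero, zero_add, le_antisymm h2 (norm1_nonneg _), mul_zero] at h1
    have h4 := abs_eq_zero.1 (le_antisymm h1 (abs_nonneg _))
    have h5 : ∫ ξ in g.t..T.ϑ, P.run x u ξ = 0 := intervalIntegral.integral_same
    unfold J cost
    change P.σ (x T.ϑ) (seg x ⟨T.ϑ, g.mem.2, le_rfl⟩) + ∫ ξ in g.t..T.ϑ, P.run x u ξ = _
    rw [h5, h3]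
    linarith
  have h1 := R.isGLB_value g
  obtain ⟨u, hu⟩ := controls_nonempty R g.t
  refine le_antisymm ((h1.1 ⟨u, hu, rfl⟩).trans (hJ u hu).le) (h1.2 ?_)
  rintro _ ⟨v, hv, rfl⟩
  exact (hJ v hv).ge

end Bolza.Regular

/-! ### From local to global inequalities along motions -/

/-- The Brezis–Browder ordering principle: if increasing sequences have upper bounds, then above
every element there is one above which the bounded monotone function `τ` is constant. -/
theorem exists_forall_le_of_seq {S : Type*} {r : S → S → Prop} (hrefl : ∀ s, r s s)
    (htrans : ∀ s s' s'', r s s' → r s' s'' → r s s'') {τ : S → ℝ} {M : ℝ}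
    (hmono : ∀ s s', r s s' → τ s ≤ τ s') (hM : ∀ s, τ s ≤ M)
    (hseq : ∀ f : ℕ → S, (∀ i j, i ≤ j → r (f i) (f j)) → ∃ b, ∀ i, r (f i) b) (s₀ : S) :
    ∃ s, r s₀ s ∧ ∀ s', r s s' → τ s' ≤ τ s := by
  set β : S → ℝ := fun s => sSup (τ '' {s' | r s s'}) with hβ
  have hbdd : ∀ s, BddAbove (τ '' {s' | r s s'}) := fun s =>
    ⟨M, by rintro _ ⟨s', -, rfl⟩; exact hM s'⟩
  have hle : ∀ s s', r s s' → τ s' ≤ β s := fun s s' h => le_csSup (hbdd s) ⟨s', h, rfl⟩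
  have hnext : ∀ s, ∃ s', r s s' ∧ (τ s + β s) / 2 ≤ τ s' := by
    intro s
    rcases (hle s s (hrefl s)).eq_or_lt with h | h
    · exact ⟨s, hrefl s, by linarith⟩
    · obtain ⟨_, ⟨s', hs', rfl⟩, h'⟩ := exists_lt_of_lt_csSup
        (show (τ '' {s' | r s s'}).Nonempty from ⟨τ s, s, hrefl s, rfl⟩)
        (show (τ s + β s) / 2 < β s by linarith)
      exact ⟨s', hs', h'.le⟩
  choose next hn1 hn2 using hnext
  set f : ℕ → S := fun k => next^[k] s₀ with hf
  have hfs : ∀ k, f (k + 1) = next (f k) := fun k => Function.iterate_succ_apply' _ _ _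
  have hfm : ∀ i j, i ≤ j → r (f i) (f j) := by
    intro i j hij
    induction j, hij using Nat.le_induction with
    | base => exact hrefl _
    | succ j _ ih => exact htrans _ _ _ ih (by rw [hfs]; exact hn1 _)
  obtain ⟨b, hb⟩ := hseq f hfm
  refine ⟨b, hb 0, fun s' hs' => ?_⟩
  have hmon : Monotone fun k => τ (f k) := fun i j hij => hmono _ _ (hfm i j hij)
  obtain ⟨L, hL⟩ : ∃ L, Tendsto (fun k => τ (f k)) atTop (𝓝 L) :=
    ⟨_, tendsto_atTop_ciSup hmon ⟨M, by rintro _ ⟨k, rfl⟩; exact hM _⟩⟩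
  have h1 : ∀ k, τ s' ≤ 2 * τ (f (k + 1)) - τ (f k) := fun k => by
    have h2 := hle (f k) s' (htrans _ _ _ (hb k) hs')
    have h3 := hn2 (f k)
    rw [← hfs] at h3
    linarith
  have h2 : Tendsto (fun k => 2 * τ (f (k + 1)) - τ (f k)) atTop (𝓝 (2 * L - L)) :=
    ((hL.comp (tendsto_add_atTop_nat 1)).const_mul 2).sub hL
  have h3 : τ s' ≤ 2 * L - L := ge_of_tendsto' h2 h1
  have h4 : L ≤ τ b := le_of_tendsto' hL fun k => hmono _ _ (hb k)
  linarith

variable {n m : ℕ} {T : Horizon}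

namespace Bolza.Regular

variable {P : Bolza n m T} {c : ℝ}

/-- A sequence of controls with increasing times `τ i`, the later ones agreeing with `u i` before
`τ i`, has a common extension. -/
theorem exists_common_extension {t : ℝ} {u : ℕ → ℝ → Vec m} {τ : ℕ → ℝ}
    (hu : ∀ i, u i ∈ P.controls t) (hτ : ∀ i, τ i ∈ Icc t T.ϑ)
    (h : ∀ i j, i ≤ j → τ i ≤ τ j ∧ EqOn (u i) (u j) (Ico t (τ i))) :
    ∃ v ∈ P.controls t, ∀ i, EqOn (u i) v (Ico t (τ i)) := by
  classical
  set v : ℝ → Vec m := fun ξ => if h : ∃ i, ξ < τ i then u (Nat.find h) ξ else u 0 ξ with hv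
  have hext : ∀ i, EqOn (u i) v (Ico t (τ i)) := by
    intro i ξ hξ
    have hex : ∃ i, ξ < τ i := ⟨i, hξ.2⟩
    simp only [hv, dif_pos hex]
    exact ((h _ i (Nat.find_min' hex hξ.2)).2 ⟨hξ.1, Nat.find_spec hex⟩).symm
  refine ⟨v, ⟨?_, fun ξ hξ => ?_⟩, hext⟩
  · refine aemeasurable_of_tendsto_metrizable_ae atTop
      (f := fun i => splice (τ i) (u i) (u 0))
      (fun i => (splice_mem_controls (hτ i) (hu i) (controls_mono (hτ i).1 (hu 0))).1) ?_
    refine (ae_restrict_iff' measurableSet_Icc).2 (Eventually.of_forall fun ξ hξ => ?_)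
    by_cases hex : ∃ i, ξ < τ i
    · obtain ⟨i, hi⟩ := hex
      refine tendsto_const_nhds.congr' ?_
      filter_upwards [eventually_ge_atTop i] with j hj
      have hj' : ξ < τ j := hi.trans_le (h i j hj).1
      rw [splice_of_lt hj', hext j ⟨hξ.1, hj'⟩]
    · refine tendsto_const_nhds.congr fun j => ?_
      rw [splice_of_le (not_lt.1 fun h' => hex ⟨j, h'⟩), hv]
      simp only [dif_neg hex]
  · simp only [hv]
    split_ifs
    · exact (hu _).2 ξ hξ
    · exact (hu 0).2 ξ hξ

/-- If from every point one can follow some control for a short time along which the functional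
`φ` plus the integral of `q` grows at rate at most `ε`, then one can do so up to the time `ϑ`. A pair (control, time) that is
maximal for extension has time `ϑ`, since otherwise the local step would extend it. -/
theorem exists_control_of_local (R : P.Regular c) {φ : Pt n T → ℝ} (hφ : InPhi φ)
    {q : ℝ → Vec n → Vec n → Vec m → ℝ}
    (hq : ∀ (g : Pt n T), ∀ u ∈ P.controls g.t, IntervalIntegrable
      (fun ξ => q ξ (P.mot g u ξ) (P.mot g u (ξ - T.h)) (u ξ)) volume g.t T.ϑ) {ε : ℝ}
    (hstep : ∀ g : Pt n T, g.t < T.ϑ → ∃ u ∈ P.controls g.t, ∃ τ : Icc g.t T.ϑ, g.t < τ ∧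
      φ (g.along (P.mot g u) τ) +
        ∫ ξ in g.t..τ, q ξ (P.mot g u ξ) (P.mot g u (ξ - T.h)) (u ξ) ≤ φ g + ε * (τ - g.t))
    (g : Pt n T) :
    ∃ u ∈ P.controls g.t, φ (g.along (P.mot g u) ⟨T.ϑ, g.mem.2, le_rfl⟩) +
      ∫ ξ in g.t..T.ϑ, q ξ (P.mot g u ξ) (P.mot g u (ξ - T.h)) (u ξ) ≤
        φ g + ε * (T.ϑ - g.t) := by
  have hh := T.h_pos
  set Q : (ℝ → Vec m) → ℝ → ℝ := fun u ξ =>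
    q ξ (P.mot g u ξ) (P.mot g u (ξ - T.h)) (u ξ) with hQ
  set Γ : (ℝ → Vec m) → ℝ → ℝ := fun u τ =>
    φ (g.along (P.mot g u) (projIcc g.t T.ϑ g.mem.2 τ)) + (∫ ξ in g.t..τ, Q u ξ)
      - ε * (τ - g.t) with hΓ
  have hint : ∀ u ∈ P.controls g.t, ∀ v ∈ P.controls g.t, ∀ τ ∈ Icc g.t T.ϑ,
      EqOn u v (Ico g.t τ) → ∫ ξ in g.t..τ, Q u ξ = ∫ ξ in g.t..τ, Q v ξ := by
    intro u hu v hv τ hτ huv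
    refine intervalIntegral.integral_congr_ae ?_
    filter_upwards [(countable_singleton τ).ae_notMem volume] with ξ h1 h2
    rw [uIoc_of_le hτ.1] at h2
    have h3 := R.mot_congr hu hv hτ huv
    simp only [hQ]
    rw [h3 ξ h2.2, h3 (ξ - T.h) (by linarith [h2.2]), huv ⟨h2.1.le, lt_of_le_of_ne h2.2 h1⟩]
  have hcausal : ∀ u ∈ P.controls g.t, ∀ v ∈ P.controls g.t, ∀ τ ∈ Icc g.t T.ϑ,
      EqOn u v (Ico g.t τ) → Γ u τ = Γ v τ := by
    intro u hu v hv τ hτ huv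
    simp only [hΓ]
    rw [hint u hu v hv τ hτ huv, projIcc_of_mem g.mem.2 hτ,
      R.along_mot_congr (τ := ⟨τ, hτ⟩) hu hv huv]
  have hcont : ∀ u ∈ P.controls g.t, ContinuousOn (Γ u) (Icc g.t T.ϑ) := by
    intro u hu
    have h1 := intervalIntegral.continuousOn_primitive_interval' (hq g u hu) left_mem_uIcc
    rw [uIcc_of_le g.mem.2] at h1
    exact ((hφ.continuous_along (R.mot_mem_Lam hu)).continuousOn.add h1).sub
      (by fun_prop)
  -- pairs of a control and the time up to which it is fixed, ordered by extension
  let S := {s : (ℝ → Vec m) × ℝ // s.1 ∈ P.controls g.t ∧ s.2 ∈ Icc g.t T.ϑ}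
  let r : S → S → Prop := fun s s' => s.1.2 ≤ s'.1.2 ∧ EqOn s.1.1 s'.1.1 (Ico g.t s.1.2) ∧
    Γ s'.1.1 s'.1.2 ≤ Γ s.1.1 s.1.2
  obtain ⟨u₀, hu₀⟩ := controls_nonempty R g.t
  obtain ⟨⟨⟨u, τ⟩, hu, hτ⟩, hr, hmax⟩ := exists_forall_le_of_seq (r := r)
    (τ := fun s => s.1.2) (M := T.ϑ) (fun s => ⟨le_rfl, fun _ _ => rfl, le_rfl⟩)
    (fun s s' s'' h h' => ⟨h.1.trans h'.1,
      fun ξ hξ => (h.2.1 hξ).trans (h'.2.1 ⟨hξ.1, hξ.2.trans_le h.1⟩), h'.2.2.trans h.2.2⟩)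
    (fun s s' h => h.1) (fun s => s.2.2.2) (by
      intro f hf
      obtain ⟨v, hv, hv'⟩ := exists_common_extension (P := P) (t := g.t)
        (u := fun i => (f i).1.1) (τ := fun i => (f i).1.2) (fun i => (f i).2.1)
        (fun i => (f i).2.2) (fun i j hij => ⟨(hf i j hij).1, (hf i j hij).2.1⟩)
      have hbdd : BddAbove (range fun i => (f i).1.2) :=
        ⟨T.ϑ, by rintro _ ⟨i, rfl⟩; exact (f i).2.2.2⟩
      set τ' := ⨆ i, (f i).1.2 with hτ'
      have hlim : Tendsto (fun i => (f i).1.2) atTop (𝓝 τ') :=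
        tendsto_atTop_ciSup (fun i j hij => (hf i j hij).1) hbdd
      have hτ'm : τ' ∈ Icc g.t T.ϑ :=
        ⟨(f 0).2.2.1.trans (le_ciSup hbdd 0), ciSup_le fun i => (f i).2.2.2⟩
      refine ⟨⟨⟨v, τ'⟩, hv, hτ'm⟩, fun i => ⟨le_ciSup hbdd i, hv' i, ?_⟩⟩
      have h1 : Tendsto (fun j => Γ v (f j).1.2) atTop (𝓝 (Γ v τ')) :=
        (hcont v hv τ' hτ'm).tendsto.comp
          (tendsto_nhdsWithin_iff.2 ⟨hlim, Eventually.of_forall fun j => (f j).2.2⟩)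
      refine le_of_tendsto h1 ?_
      filter_upwards [eventually_ge_atTop i] with j hj
      rw [← hcausal _ (f j).2.1 v hv _ (f j).2.2 (hv' j)]
      exact (hf i j hj).2.2)
    ⟨⟨u₀, g.t⟩, hu₀, le_rfl, g.mem.2⟩
  change u ∈ P.controls g.t at hu
  change τ ∈ Icc g.t T.ϑ at hτ
  have hr3 : Γ u τ ≤ Γ u₀ g.t := hr.2.2
  have hstart : Γ u₀ g.t = φ g := by
    simp only [hΓ, projIcc_of_mem g.mem.2 (left_mem_Icc.2 g.mem.2),
      intervalIntegral.integral_same, sub_self, mul_zero, sub_zero, add_zero]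
    exact hφ.along_self (R.mot_mem_Lam hu₀)
  rcases hτ.2.lt_or_eq with hlt | heq
  · exfalso
    obtain ⟨v, hv, τ'', hlt'', hle⟩ := hstep (g.along (P.mot g u) ⟨τ, hτ⟩) hlt
    have hv' : v ∈ P.controls τ := hv
    rw [R.along_mot_splice_of_le (τ := ⟨τ, hτ⟩) hu hv' τ''] at hle
    obtain ⟨τ', hτ'⟩ := τ''
    change τ' ∈ Icc τ T.ϑ at hτ'
    change τ < τ' at hlt''
    simp only [along_t] at hle
    have hτ'm : τ' ∈ Icc g.t T.ϑ := ⟨hτ.1.trans hτ'.1, hτ'.2⟩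
    have hs := splice_mem_controls hτ hu hv'
    have heq : EqOn (splice τ u v) u (Ico g.t τ) := fun ξ hξ => splice_of_lt hξ.2
    have hI : ∫ ξ in τ..τ', q ξ (P.mot (g.along (P.mot g u) ⟨τ, hτ⟩) v ξ)
        (P.mot (g.along (P.mot g u) ⟨τ, hτ⟩) v (ξ - T.h)) (v ξ) =
        ∫ ξ in τ..τ', Q (splice τ u v) ξ := by
      refine intervalIntegral.integral_congr fun ξ hξ => ?_
      rw [uIcc_of_le hτ'.1] at hξ
      simp only [hQ]
      have e1 := R.mot_splice (g := g) (τ := ⟨τ, hτ⟩) hu hv' (ξ := ξ)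
        (by simp only; linarith [hξ.1])
      have e2 := R.mot_splice (g := g) (τ := ⟨τ, hτ⟩) hu hv' (ξ := ξ - T.h)
        (by simp only; linarith [hξ.1])
      simp only at e1 e2
      rw [e1, e2, splice_of_le hξ.1]
    rw [hI] at hle
    have hQi := hq g _ hs
    have hadd : (∫ ξ in g.t..τ, Q (splice τ u v) ξ) + ∫ ξ in τ..τ', Q (splice τ u v) ξ =
        ∫ ξ in g.t..τ', Q (splice τ u v) ξ :=
      intervalIntegral.integral_add_adjacent_intervals
        (intervalIntegrable_sub hQi le_rfl hτ.1 hτ.2)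
        (intervalIntegrable_sub hQi hτ.1 hτ'.1 hτ'.2)
    rw [hint _ hs u hu τ hτ heq] at hadd
    have hnew : Γ (splice τ u v) τ' ≤ Γ u τ := by
      simp only [hΓ]
      rw [projIcc_of_mem g.mem.2 hτ'm, projIcc_of_mem g.mem.2 hτ, ← hadd]
      linarith
    have := hmax ⟨⟨splice τ u v, τ'⟩, hs, hτ'm⟩ ⟨hτ'.1, heq.symm, hnew⟩
    simp only at this
    linarith
  · subst heq
    refine ⟨u, hu, ?_⟩
    rw [hstart] at hr3
    simp only [hΓ] at hr3
    rw [projIcc_of_mem g.mem.2 hτ] at hr3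
    linarith

end Bolza.Regular

/-! ### Signs of infima and suprema of real families in `EReal` -/

theorem biInf_coe_le_zero {α : Type*} {S : Set α} {f : α → ℝ}
    (h : ∀ ε > 0, ∃ x ∈ S, f x ≤ ε) : (⨅ x ∈ S, ((f x : ℝ) : EReal)) ≤ 0 := by
  by_contra hlt
  obtain ⟨r, hr0, hr⟩ := EReal.lt_iff_exists_real_btwn.1 (not_le.1 hlt)
  obtain ⟨x, hx, hfx⟩ := h r (EReal.coe_pos.1 hr0)
  exact absurd (iInf₂_le x hx) (not_le.2 (lt_of_le_of_lt (EReal.coe_le_coe_iff.2 hfx) hr))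

theorem zero_le_biSup_coe {α : Type*} {S : Set α} {f : α → ℝ}
    (h : ∀ ε > 0, ∃ x ∈ S, -ε ≤ f x) : 0 ≤ ⨆ x ∈ S, ((f x : ℝ) : EReal) := by
  by_contra hlt
  obtain ⟨r, hr, hr0⟩ := EReal.lt_iff_exists_real_btwn.1 (not_le.1 hlt)
  have hr0' : r < 0 := by exact_mod_cast hr0
  obtain ⟨x, hx, hfx⟩ := h (-r) (by linarith)
  refine absurd (le_iSup₂ (f := fun x (_ : x ∈ S) => ((f x : ℝ) : EReal)) x hx)
    (not_le.2 (lt_of_lt_of_le hr ?_))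
  exact EReal.coe_le_coe_iff.2 (by linarith)

theorem exists_le_of_biInf_coe_le_zero {α : Type*} {S : Set α} {f : α → ℝ}
    (h : (⨅ x ∈ S, ((f x : ℝ) : EReal)) ≤ 0) {ε : ℝ} (hε : 0 < ε) : ∃ x ∈ S, f x ≤ ε := by
  by_contra! hlt
  refine absurd (h.trans_lt (EReal.coe_pos.2 hε)) (not_lt.2 (le_iInf₂ fun x hx => ?_))
  exact EReal.coe_le_coe_iff.2 (hlt x hx).le

theorem exists_le_of_zero_le_biSup_coe {α : Type*} {S : Set α} {f : α → ℝ}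
    (h : 0 ≤ ⨆ x ∈ S, ((f x : ℝ) : EReal)) {ε : ℝ} (hε : 0 < ε) : ∃ x ∈ S, -ε ≤ f x := by
  by_contra! hlt
  have h1 : ((-ε : ℝ) : EReal) < 0 := by exact_mod_cast neg_lt_zero.2 hε
  refine absurd (h1.trans_le h) (not_lt.2 (iSup₂_le fun x hx => ?_))
  exact EReal.coe_le_coe_iff.2 (hlt x hx).le

/-! ### The Hamiltonian -/

variable {n m : ℕ} {T : Horizon}

/-- A property that holds near `(t, z, w(-h))` holds along the history of `g` for a short time. -/
theorem exists_radius_of_eventually {g : Pt n T} {p : ℝ × Vec n × Vec n → Prop}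
    (hp : ∀ᶠ q in 𝓝[Icc T.t₀ T.ϑ ×ˢ univ ×ˢ univ] (g.t, g.z, g.w (-T.h)), p q) :
    ∃ r > 0, r ≤ T.h ∧ ∀ ξ ∈ Icc g.t T.ϑ, ξ < g.t + r → ∀ ζ : Vec n, ‖ζ - g.z‖ ≤ r →
      p (ξ, ζ, g.w (ξ - T.h - g.t)) := by
  have hh := T.h_pos
  obtain ⟨ε, hε, hball⟩ := Metric.mem_nhdsWithin_iff.1 hp
  have h1 : ContinuousWithinAt g.w (Ici (-T.h)) (-T.h) :=
    g.w.continuousWithinAt_Ici ⟨le_rfl, by linarith⟩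
  obtain ⟨δ, hδ, hw⟩ := Metric.continuousWithinAt_iff.1 h1 ε hε
  refine ⟨min (min (ε / 2) δ) T.h, by positivity, min_le_right _ _, fun ξ hξ hξr ζ hζ => ?_⟩
  have hr1 : min (min (ε / 2) δ) T.h ≤ ε / 2 := (min_le_left _ _).trans (min_le_left _ _)
  have hr2 : min (min (ε / 2) δ) T.h ≤ δ := (min_le_left _ _).trans (min_le_right _ _)
  refine hball ⟨?_, ⟨g.mem.1.trans hξ.1, hξ.2⟩, trivial, trivial⟩
  have h2 : dist ξ g.t < ε := by
    rw [Real.dist_eq, abs_of_nonneg (by linarith [hξ.1])]; linarith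
  have h3 : dist ζ g.z < ε := by rw [dist_eq_norm]; linarith
  have h4 : dist (g.w (ξ - T.h - g.t)) (g.w (-T.h)) < ε := by
    refine hw (show -T.h ≤ ξ - T.h - g.t by linarith [hξ.1]) ?_
    rw [Real.dist_eq, show ξ - T.h - g.t - -T.h = ξ - g.t by ring,
      abs_of_nonneg (by linarith [hξ.1])]
    linarith
  rw [Metric.mem_ball, Prod.dist_eq, Prod.dist_eq]
  exact max_lt h2 (max_lt h3 h4)

theorem apply_sub_of_mem_Lam {g : Pt n T} {x : PC n (g.t - T.h) T.ϑ} (hx : x ∈ Lam g) {ξ : ℝ}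
    (h1 : g.t ≤ ξ) (h2 : ξ < g.t + T.h) : x (ξ - T.h) = g.w (ξ - T.h - g.t) :=
  hx.1 _ ⟨by linarith, by linarith⟩

/-- A property that holds near `(t, z, w(-h))` holds along the elements of `Λ(t, z, w)` for a short
time. The history is right-continuous at `-h`, which makes this work. -/
theorem exists_time_of_eventually {g : Pt n T} (hg : g.t < T.ϑ) {x : PC n (g.t - T.h) T.ϑ}
    (hx : x ∈ Lam g) {p : ℝ × Vec n × Vec n → Prop}
    (hp : ∀ᶠ q in 𝓝[Icc T.t₀ T.ϑ ×ˢ univ ×ˢ univ] (g.t, g.z, g.w (-T.h)), p q) :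
    ∃ τ ∈ Ioc g.t T.ϑ, ∀ ξ ∈ Icc g.t τ, p (ξ, x ξ, x (ξ - T.h)) := by
  obtain ⟨r, hr, hrh, h⟩ := exists_radius_of_eventually hp
  have h1 : ∀ᶠ ξ in 𝓝[>] g.t, ‖x ξ - g.z‖ < r := by
    have h2 := (continuousOn_of_mem_Lam hx g.t ⟨le_rfl, g.mem.2⟩).mono Ioc_subset_Icc_self
    rw [ContinuousWithinAt, nhdsWithin_Ioc_eq_nhdsGT hg, hx.2.1] at h2
    have h3 := (h2.sub_const g.z).norm
    rw [sub_self, norm_zero] at h3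
    exact h3.eventually (gt_mem_nhds hr)
  obtain ⟨d, hd, hd'⟩ := (mem_nhdsGT_iff_exists_Ioc_subset).1 h1
  have hd0 : g.t < d := hd
  refine ⟨min (min d T.ϑ) (g.t + r / 2), ⟨lt_min (lt_min hd0 hg) (by linarith),
    (min_le_left _ _).trans (min_le_right _ _)⟩, fun ξ hξ => ?_⟩
  have e1 : ξ ≤ d := hξ.2.trans ((min_le_left _ _).trans (min_le_left _ _))
  have e2 : ξ ≤ T.ϑ := hξ.2.trans ((min_le_left _ _).trans (min_le_right _ _))
  have e3 : ξ ≤ g.t + r / 2 := hξ.2.trans (min_le_right _ _)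
  rw [apply_sub_of_mem_Lam hx hξ.1 (by linarith)]
  refine h ξ ⟨hξ.1, e2⟩ (by linarith) _ ?_
  rcases hξ.1.eq_or_lt with e | e
  · rw [← e, hx.2.1, sub_self, norm_zero]; exact hr.le
  · exact le_of_lt (hd' ⟨e, e1⟩)

namespace Bolza.Regular

variable {P : Bolza n m T} {c : ℝ}

theorem abs_inner_add_le (R : P.Regular c) {t : ℝ} (ht : t ∈ Icc T.t₀ T.ϑ) (x y s : Vec n)
    {u : Vec m} (hu : u ∈ P.U) :
    |inner ℝ (P.f t x y u) s + P.f0 t x y u| ≤ c * (1 + ‖x‖ + ‖y‖) * (1 + ‖s‖) := by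
  have h1 := R.f3 t ht x y u hu
  have h2 := abs_real_inner_le_norm (P.f t x y u) s
  have h3 := abs_nonneg (P.f0 t x y u)
  have h4 := norm_nonneg (P.f t x y u)
  have h5 := norm_nonneg s
  refine (abs_add_le _ _).trans ?_
  nlinarith [mul_nonneg h3 h5]

theorem bddBelow_H (R : P.Regular c) {t : ℝ} (ht : t ∈ Icc T.t₀ T.ϑ) (x y s : Vec n) :
    BddBelow ((fun u => inner ℝ (P.f t x y u) s + P.f0 t x y u) '' P.U) :=
  ⟨-(c * (1 + ‖x‖ + ‖y‖) * (1 + ‖s‖)), by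
    rintro _ ⟨u, hu, rfl⟩
    exact (abs_le.1 (R.abs_inner_add_le ht x y s hu)).1⟩

theorem H_le (R : P.Regular c) {t : ℝ} (ht : t ∈ Icc T.t₀ T.ϑ) (x y s : Vec n)
    {u : Vec m} (hu : u ∈ P.U) : P.H t x y s ≤ inner ℝ (P.f t x y u) s + P.f0 t x y u :=
  csInf_le (R.bddBelow_H ht x y s) ⟨u, hu, rfl⟩

theorem exists_lt_H_add (R : P.Regular c) (t : ℝ) (x y s : Vec n) {ε : ℝ} (hε : 0 < ε) :
    ∃ u ∈ P.U, inner ℝ (P.f t x y u) s + P.f0 t x y u < P.H t x y s + ε := by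
  obtain ⟨_, ⟨u, hu, rfl⟩, h⟩ := exists_lt_of_csInf_lt (R.nonempty.image
    (fun u => inner ℝ (P.f t x y u) s + P.f0 t x y u)) (lt_add_of_pos_right (P.H t x y s) hε)
  exact ⟨u, hu, h⟩

theorem abs_H_le (R : P.Regular c) {t : ℝ} (ht : t ∈ Icc T.t₀ T.ϑ) (x y s : Vec n) :
    |P.H t x y s| ≤ c * (1 + ‖x‖ + ‖y‖) * (1 + ‖s‖) := by
  obtain ⟨u, hu⟩ := R.nonempty
  refine abs_le.2 ⟨?_, (R.H_le ht x y s hu).trans (abs_le.1 (R.abs_inner_add_le ht x y s hu)).2⟩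
  refine le_csInf (R.nonempty.image _) ?_
  rintro _ ⟨u, hu, rfl⟩
  exact (abs_le.1 (R.abs_inner_add_le ht x y s hu)).1

/-- The data are continuous in `(t, x, y)` uniformly in the control. -/
theorem eventually_forall_control (R : P.Regular c) {q₀ : ℝ × Vec n × Vec n}
    (hq₀ : q₀ ∈ Icc T.t₀ T.ϑ ×ˢ (univ : Set (Vec n)) ×ˢ (univ : Set (Vec n))) {ε : ℝ}
    (hε : 0 < ε) :
    ∀ᶠ q in 𝓝[Icc T.t₀ T.ϑ ×ˢ univ ×ˢ univ] q₀, ∀ u ∈ P.U,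
      ‖P.f q.1 q.2.1 q.2.2 u - P.f q₀.1 q₀.2.1 q₀.2.2 u‖ < ε ∧
      |P.f0 q.1 q.2.1 q.2.2 u - P.f0 q₀.1 q₀.2.1 q₀.2.2 u| < ε := by
  have hmap : MapsTo (fun q : (ℝ × Vec n × Vec n) × Vec m => (q.1.1, q.1.2.1, q.1.2.2, q.2))
      ((Icc T.t₀ T.ϑ ×ˢ univ ×ˢ univ) ×ˢ P.U) (Icc T.t₀ T.ϑ ×ˢ univ ×ˢ univ ×ˢ P.U) :=
    fun q hq => ⟨hq.1.1, trivial, trivial, hq.2⟩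
  have hc : Continuous (fun q : (ℝ × Vec n × Vec n) × Vec m =>
      (q.1.1, q.1.2.1, q.1.2.2, q.2)) := by fun_prop
  have h1 := R.compact.mem_uniformity_of_prod
    (f := fun (q : ℝ × Vec n × Vec n) u => P.f q.1 q.2.1 q.2.2 u)
    (R.f1.1.comp hc.continuousOn hmap) hq₀ (Metric.dist_mem_uniformity hε)
  have h2 := R.compact.mem_uniformity_of_prod
    (f := fun (q : ℝ × Vec n × Vec n) u => P.f0 q.1 q.2.1 q.2.2 u)
    (R.f1.2.comp hc.continuousOn hmap) hq₀ (Metric.dist_mem_uniformity hε)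
  obtain ⟨v1, hv1, h1⟩ := h1
  obtain ⟨v2, hv2, h2⟩ := h2
  filter_upwards [hv1, hv2] with q hq1 hq2 u hu
  have e1 := h1 q hq1 u hu
  have e2 := h2 q hq2 u hu
  exact ⟨by rw [← dist_eq_norm]; exact e1, by rw [← Real.dist_eq]; exact e2⟩

theorem continuousOn_H (R : P.Regular c) (s : Vec n) :
    ContinuousOn (fun q : ℝ × Vec n × Vec n => P.H q.1 q.2.1 q.2.2 s)
      (Icc T.t₀ T.ϑ ×ˢ univ ×ˢ univ) := by
  intro q₀ hq₀
  refine Metric.tendsto_nhds.2 fun ε hε => ?_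
  have hδ : 0 < ε / (3 * (1 + ‖s‖)) := by positivity
  have hδs : ε / (3 * (1 + ‖s‖)) * (1 + ‖s‖) = ε / 3 := by field_simp
  filter_upwards [R.eventually_forall_control hq₀ hδ, self_mem_nhdsWithin] with q hq hqm
  have key : ∀ u ∈ P.U, |(inner ℝ (P.f q.1 q.2.1 q.2.2 u) s + P.f0 q.1 q.2.1 q.2.2 u) -
      (inner ℝ (P.f q₀.1 q₀.2.1 q₀.2.2 u) s + P.f0 q₀.1 q₀.2.1 q₀.2.2 u)| ≤ ε / 3 := by
    intro u hu
    obtain ⟨h1, h2⟩ := hq u hu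
    have h3 := abs_real_inner_le_norm (P.f q.1 q.2.1 q.2.2 u - P.f q₀.1 q₀.2.1 q₀.2.2 u) s
    rw [inner_sub_left] at h3
    rw [add_sub_add_comm]
    refine (abs_add_le _ _).trans ?_
    have h4 : ‖P.f q.1 q.2.1 q.2.2 u - P.f q₀.1 q₀.2.1 q₀.2.2 u‖ * ‖s‖ ≤
        ε / (3 * (1 + ‖s‖)) * ‖s‖ := by gcongr
    linarith
  rw [Real.dist_eq]
  refine lt_of_le_of_lt (b := 2 * (ε / 3)) (abs_le.2 ⟨?_, ?_⟩) (by linarith)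
  · obtain ⟨u, hu, h1⟩ := R.exists_lt_H_add q.1 q.2.1 q.2.2 s (show 0 < ε / 3 by linarith)
    have h2 := R.H_le hq₀.1 q₀.2.1 q₀.2.2 s hu
    have h3 := (abs_le.1 (key u hu)).1
    linarith
  · obtain ⟨u, hu, h1⟩ := R.exists_lt_H_add q₀.1 q₀.2.1 q₀.2.2 s (show 0 < ε / 3 by linarith)
    have h2 := R.H_le hqm.1 q.2.1 q.2.2 s hu
    have h3 := (abs_le.1 (key u hu)).2
    linarith

theorem intervalIntegrable_H (R : P.Regular c) {t a b : ℝ} (ht : t ∈ Icc T.t₀ T.ϑ)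
    (x : PC n a b) (s : Vec n) :
    IntervalIntegrable (fun ξ => P.H ξ (x ξ) (x (ξ - T.h)) s) volume t T.ϑ := by
  obtain ⟨B, hB0, hB⟩ := x.exists_bound
  obtain ⟨u, hu⟩ := controls_nonempty R t
  have hc : Continuous (fun q : ℝ × Vec n × Vec n × Vec m => (q.1, q.2.1, q.2.2.1)) := by fun_prop
  have hH : ContinuousOn (fun q : ℝ × Vec n × Vec n × Vec m => P.H q.1 q.2.1 q.2.2.1 s)
      (Icc T.t₀ T.ϑ ×ˢ univ ×ˢ univ ×ˢ P.U) := by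
    have hm : MapsTo (fun q : ℝ × Vec n × Vec n × Vec m => (q.1, q.2.1, q.2.2.1))
        (Icc T.t₀ T.ϑ ×ˢ univ ×ˢ univ ×ˢ P.U) (Icc T.t₀ T.ϑ ×ˢ univ ×ˢ univ) :=
      fun q hq => ⟨hq.1, trivial, trivial⟩
    have hcomp := (R.continuousOn_H s).comp hc.continuousOn hm
    exact hcomp
  have hb : ∀ ξ ∈ Icc t T.ϑ, ‖P.H ξ (x ξ) (x (ξ - T.h)) s‖ ≤ c * (1 + B + B) * (1 + ‖s‖) := by
    intro ξ hξ
    refine (R.abs_H_le ⟨ht.1.trans hξ.1, hξ.2⟩ _ _ s).trans ?_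
    refine mul_le_mul_of_nonneg_right (mul_le_mul_of_nonneg_left ?_ R.c_pos.le) (by positivity)
    linarith [hB ξ, hB (ξ - T.h)]
  exact intervalIntegrable_comp (P := P)
    (q := fun q : ℝ × Vec n × Vec n × Vec m => P.H q.1 q.2.1 q.2.2.1 s) R.compact hH x.measurable
    (x.measurable.comp (measurable_sub_const T.h)) ht hu hb

/-! ### The value functional is a minimax solution -/

theorem continuousOn_const_control (R : P.Regular c) {u : Vec m} (hu : u ∈ P.U) (s : Vec n) :
    ContinuousOn (fun q : ℝ × Vec n × Vec n => inner ℝ (P.f q.1 q.2.1 q.2.2 u) s +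
      P.f0 q.1 q.2.1 q.2.2 u) (Icc T.t₀ T.ϑ ×ˢ univ ×ˢ univ) := by
  have hc : Continuous (fun q : ℝ × Vec n × Vec n => (q.1, q.2.1, q.2.2, u)) := by fun_prop
  have hm : MapsTo (fun q : ℝ × Vec n × Vec n => (q.1, q.2.1, q.2.2, u))
      (Icc T.t₀ T.ϑ ×ˢ univ ×ˢ univ) (Icc T.t₀ T.ϑ ×ˢ univ ×ˢ univ ×ˢ P.U) :=
    fun q hq => ⟨hq.1, trivial, trivial, hu⟩
  exact ((R.f1.1.comp hc.continuousOn hm).inner continuousOn_const).add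
    (R.f1.2.comp hc.continuousOn hm)

/-- A control along which the minimum in the definition of `H(·, s)` is almost attained. -/
theorem exists_control_near_H (R : P.Regular c) (g : Pt n T) (s : Vec n) {ε : ℝ} (hε : 0 < ε) :
    ∃ u ∈ P.controls g.t, ∫ ξ in g.t..T.ϑ,
      (inner ℝ (P.vel (P.mot g u) u ξ) s + P.run (P.mot g u) u ξ -
        P.H ξ (P.mot g u ξ) (P.mot g u (ξ - T.h)) s) ≤ ε * (T.ϑ - g.t) := by
  have h0 : InPhi (0 : Pt n T → ℝ) := by
    refine ⟨fun z w => continuous_const, fun α _ => ⟨1, one_pos, fun t ht z z' w w' _ _ => ?_⟩⟩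
    simp only [Pi.zero_apply, sub_self, abs_zero, one_mul]
    exact add_nonneg (norm_nonneg _) (norm1_nonneg _)
  -- constant controls are good for a short time; the functional `0` only lets them be concatenated
  have key := R.exists_control_of_local h0 (ε := ε)
    (q := fun ξ x y u => inner ℝ (P.f ξ x y u) s + P.f0 ξ x y u - P.H ξ x y s)
    (fun g u hu => by
      have h1 := R.intervalIntegrable_vel g.mem hu (P.mot g u)
      have h2 := R.intervalIntegrable_run g.mem hu (P.mot g u)
      have h3 : IntervalIntegrable (fun ξ => inner ℝ (P.vel (P.mot g u) u ξ) s) volume g.t T.ϑ :=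
        ⟨h1.1.inner_const s, h1.2.inner_const s⟩
      exact (h3.add h2).sub (R.intervalIntegrable_H g.mem (P.mot g u) s))
    (fun g hg => by
      obtain ⟨u, hu, hlt⟩ := R.exists_lt_H_add g.t g.z (g.w (-T.h)) s hε
      have hu' : (fun _ => u) ∈ P.controls g.t := controls_of_measurable measurable_const fun _ => hu
      have hev : ∀ᶠ q in 𝓝[Icc T.t₀ T.ϑ ×ˢ univ ×ˢ univ] (g.t, g.z, g.w (-T.h)),
          inner ℝ (P.f q.1 q.2.1 q.2.2 u) s + P.f0 q.1 q.2.1 q.2.2 u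
            - P.H q.1 q.2.1 q.2.2 s < ε := by
        have h1 := ((R.continuousOn_const_control hu s).sub (R.continuousOn_H s))
          (g.t, g.z, g.w (-T.h)) ⟨g.mem, trivial, trivial⟩
        exact h1.tendsto.eventually (gt_mem_nhds (by simp only [Pi.sub_apply]; linarith))
      obtain ⟨τ, hτ, h2⟩ := exists_time_of_eventually hg (R.mot_mem_Lam hu') hev
      refine ⟨fun _ => u, hu', ⟨τ, hτ.1.le, hτ.2⟩, hτ.1, ?_⟩
      simp only [Pi.zero_apply, zero_add]
      have h3 := intervalIntegral.norm_integral_le_of_norm_le_const (a := g.t) (b := τ)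
        (f := fun ξ => inner ℝ (P.f ξ (P.mot g (fun _ => u) ξ)
          (P.mot g (fun _ => u) (ξ - T.h)) u) s +
          P.f0 ξ (P.mot g (fun _ => u) ξ) (P.mot g (fun _ => u) (ξ - T.h)) u -
          P.H ξ (P.mot g (fun _ => u) ξ) (P.mot g (fun _ => u) (ξ - T.h)) s) (C := ε) (by
        intro ξ hξ
        rw [uIoc_of_le hτ.1.le] at hξ
        have h4 := h2 ξ (Ioc_subset_Icc_self hξ)
        have h5 := R.H_le ⟨g.mem.1.trans hξ.1.le, hξ.2.trans hτ.2⟩ (P.mot g (fun _ => u) ξ)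
          (P.mot g (fun _ => u) (ξ - T.h)) s hu
        rw [Real.norm_eq_abs, abs_of_nonneg (by linarith)]
        exact h4.le)
      rw [abs_of_nonneg (by linarith [hτ.1] : 0 ≤ τ - g.t)] at h3
      exact (le_abs_self _).trans h3) g
  simpa using key

theorem integral_H_sub_eq (R : P.Regular c) {g : Pt n T} {u : ℝ → Vec m} (hu : u ∈ P.controls g.t)
    (s : Vec n) (τ : Icc g.t T.ϑ) :
    ∫ ξ in g.t..τ, (P.H ξ (P.mot g u ξ) (P.mot g u (ξ - T.h)) s -
      inner ℝ (deriv (P.mot g u) ξ) s) =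
    ∫ ξ in g.t..τ, (P.H ξ (P.mot g u ξ) (P.mot g u (ξ - T.h)) s -
      inner ℝ (P.vel (P.mot g u) u ξ) s) := by
  refine intervalIntegral.integral_congr_ae ?_
  filter_upwards [(ae_restrict_iff' measurableSet_Icc).1 (R.isMotion_mot hu).2] with ξ h1 h2
  rw [uIoc_of_le τ.2.1] at h2
  rw [(h1 ⟨h2.1.le, h2.2.trans τ.2.2⟩).deriv]

/-- The lower inequality follows from dynamic programming along almost optimal controls and
`H ≤ ⟪f, s⟫ + f⁰`, the upper one from dynamic programming along a control that almost attains the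
minimum in `H(·, s)`. -/
theorem isMinimaxSolution_value (R : P.Regular c) : IsMinimaxSolution P c P.value := by
  refine ⟨R.inPhi_value, R.terminal_value, fun g τ s hg hτ => ?_⟩
  have hint : ∀ u ∈ P.controls g.t,
      IntervalIntegrable (fun ξ => inner ℝ (P.vel (P.mot g u) u ξ) s) volume g.t T.ϑ :=
    fun u hu => by
      have h1 := R.intervalIntegrable_vel g.mem hu (P.mot g u)
      exact ⟨h1.1.inner_const s, h1.2.inner_const s⟩
  have hH := fun u => R.intervalIntegrable_H g.mem (P.mot g u) s
  have hrun := fun u (hu : u ∈ P.controls g.t) => R.intervalIntegrable_run g.mem hu (P.mot g u)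
  constructor
  · refine biInf_coe_le_zero fun ε hε => ?_
    obtain ⟨u, hu, hJ⟩ := R.exists_J_lt g hε
    refine ⟨_, R.mot_mem_X hu, ?_⟩
    have h1 := R.integral_run_add_value_le_J hu τ
    unfold minimaxGap
    rw [R.integral_H_sub_eq hu s τ]
    have h2 : ∫ ξ in g.t..τ, (P.H ξ (P.mot g u ξ) (P.mot g u (ξ - T.h)) s -
        inner ℝ (P.vel (P.mot g u) u ξ) s) ≤ ∫ ξ in g.t..τ, P.run (P.mot g u) u ξ := by
      refine intervalIntegral.integral_mono_on τ.2.1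
        (intervalIntegrable_sub ((hH u).sub (hint u hu)) le_rfl τ.2.1 τ.2.2)
        (intervalIntegrable_sub (hrun u hu) le_rfl τ.2.1 τ.2.2) fun ξ hξ => ?_
      have := R.H_le ⟨g.mem.1.trans hξ.1, hξ.2.trans τ.2.2⟩ (P.mot g u ξ)
        (P.mot g u (ξ - T.h)) s (hu.2 ξ ⟨hξ.1, hξ.2.trans τ.2.2⟩)
      linarith
    linarith
  · refine zero_le_biSup_coe fun ε hε => ?_
    have hpos : 0 < T.ϑ - g.t := by linarith
    obtain ⟨u, hu, hle⟩ := R.exists_control_near_H g s (div_pos hε hpos)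
    rw [div_mul_cancel₀ _ hpos.ne'] at hle
    refine ⟨_, R.mot_mem_X hu, ?_⟩
    have h1 := R.value_le_integral_run_add_value hu τ
    have hq := ((hint u hu).add (hrun u hu)).sub (hH u)
    have h2 : ∫ ξ in g.t..τ, (inner ℝ (P.vel (P.mot g u) u ξ) s + P.run (P.mot g u) u ξ -
        P.H ξ (P.mot g u ξ) (P.mot g u (ξ - T.h)) s) ≤ ε := by
      refine le_trans (intervalIntegral.integral_mono_interval le_rfl τ.2.1 τ.2.2 ?_ hq) hle
      refine (ae_restrict_iff' measurableSet_Ioc).2 (Eventually.of_forall fun ξ hξ => ?_)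
      have := R.H_le ⟨g.mem.1.trans hξ.1.le, hξ.2⟩ (P.mot g u ξ)
        (P.mot g u (ξ - T.h)) s (hu.2 ξ (Ioc_subset_Icc_self hξ))
      change (0 : ℝ) ≤ _
      linarith
    have h3 : ∫ ξ in g.t..τ, (inner ℝ (P.vel (P.mot g u) u ξ) s + P.run (P.mot g u) u ξ -
        P.H ξ (P.mot g u ξ) (P.mot g u (ξ - T.h)) s) = (∫ ξ in g.t..τ, P.run (P.mot g u) u ξ) -
        ∫ ξ in g.t..τ, (P.H ξ (P.mot g u ξ) (P.mot g u (ξ - T.h)) s -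
          inner ℝ (P.vel (P.mot g u) u ξ) s) := by
      rw [← intervalIntegral.integral_sub (intervalIntegrable_sub (hrun u hu) le_rfl τ.2.1 τ.2.2)
        (intervalIntegrable_sub ((hH u).sub (hint u hu)) le_rfl τ.2.1 τ.2.2)]
      refine intervalIntegral.integral_congr fun ξ _ => ?_
      ring
    unfold minimaxGap
    rw [R.integral_H_sub_eq hu s τ]
    linarith

end Bolza.Regular

/-! ### Directional derivatives -/

section Directional

variable {n m : ℕ} {T : Horizon}

/-- The lower derivative is at most `a` if difference quotients at arbitrarily small times are almost
at most `a`. -/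
theorem lowerDeriv_le_coe {φ : Pt n T → ℝ} {g : Pt n T} {l : Vec n} {a : ℝ}
    (h : ∀ ε > 0, ∀ r > 0, ∃ τ : Icc g.t T.ϑ, g.t < τ ∧ (τ : ℝ) < g.t + r ∧
      φ (g.along (line g l) τ) - φ g ≤ (a + ε) * (τ - g.t)) :
    lowerDeriv φ g l ≤ (a : EReal) := by
  by_contra hlt
  obtain ⟨b, hab, hb⟩ := EReal.lt_iff_exists_real_btwn.1 (not_le.1 hlt)
  have hab' : a < b := EReal.coe_lt_coe_iff.1 hab
  obtain ⟨d, hd, hd'⟩ := mem_comap.1 (eventually_lt_of_lt_liminf hb)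
  obtain ⟨e, he, he'⟩ := mem_nhdsGT_iff_exists_Ioo_subset.1 hd
  have he0 : g.t < e := he
  obtain ⟨τ, h1, h2, h3⟩ := h (b - a) (sub_pos.2 hab') (e - g.t) (sub_pos.2 he0)
  have h4 : (b : EReal) < quotient φ g l τ :=
    hd' (show (τ : ℝ) ∈ d from he' ⟨h1, by linarith⟩)
  have h5 : b < (φ (g.along (line g l) τ) - φ g) / (τ - g.t) := EReal.coe_lt_coe_iff.1 h4
  rw [lt_div_iff₀ (sub_pos.2 h1)] at h5
  rw [add_sub_cancel] at h3
  linarith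

/-- The lower derivative is at least `a` if difference quotients at all small times are almost at
least `a`. -/
theorem coe_le_lowerDeriv {φ : Pt n T → ℝ} {g : Pt n T} {l : Vec n} {a : ℝ}
    (h : ∀ ε > 0, ∃ r > 0, ∀ τ : Icc g.t T.ϑ, g.t < τ → (τ : ℝ) < g.t + r →
      (a - ε) * (τ - g.t) ≤ φ (g.along (line g l) τ) - φ g) :
    (a : EReal) ≤ lowerDeriv φ g l := by
  by_contra hlt
  obtain ⟨b, hb, hba⟩ := EReal.lt_iff_exists_real_btwn.1 (not_le.1 hlt)
  have hab' : b < a := EReal.coe_lt_coe_iff.1 hba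
  refine absurd hb (not_lt.2 ?_)
  obtain ⟨r, hr, h⟩ := h (a - b) (sub_pos.2 hab')
  refine le_liminf_of_le (by isBoundedDefault) (mem_comap.2 ⟨Ioo g.t (g.t + r),
    Ioo_mem_nhdsGT (by linarith), fun τ hτ => ?_⟩)
  have h1 := h τ hτ.1 hτ.2
  rw [sub_sub_cancel] at h1
  exact EReal.coe_le_coe_iff.2 ((le_div_iff₀ (sub_pos.2 hτ.1)).2 h1)

theorem upperDeriv_eq_neg (φ : Pt n T → ℝ) (g : Pt n T) (l : Vec n) :
    upperDeriv φ g l = -lowerDeriv (-φ) g l := by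
  unfold lowerDeriv upperDeriv
  rw [← EReal.limsup_neg]
  congr 1
  ext τ
  simp only [quotient, Pi.neg_apply, ← EReal.coe_neg]
  congr 1
  ring

theorem mem_superdiff_iff {φ : Pt n T → ℝ} {g : Pt n T} {q : ℝ × Vec n} :
    q ∈ superdiff φ g ↔ (-q.1, -q.2) ∈ subdiff (-φ) g := by
  refine forall_congr' fun l => ?_
  rw [upperDeriv_eq_neg, EReal.neg_le, ← EReal.coe_neg]
  simp only [inner_neg_right, neg_add]

theorem norm_line_le {g : Pt n T} {l : Vec n} {B : ℝ} (hw : ∀ ξ, ‖g.w ξ‖ ≤ B)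
    (hz : ‖g.z‖ + (T.ϑ - g.t) * ‖l‖ ≤ B) (ξ : ℝ) : ‖line g l ξ‖ ≤ B := by
  have hB : 0 ≤ B := (norm_nonneg _).trans (hw 0)
  by_cases hξ : ξ ∈ Icc (g.t - T.h) T.ϑ
  · rcases lt_or_ge ξ g.t with h | h
    · rw [line_of_lt hξ.1 h]; exact hw _
    · rw [line_of_mem ⟨h, hξ.2⟩]
      refine (norm_add_le _ _).trans (le_trans ?_ hz)
      rw [norm_smul, Real.norm_eq_abs, abs_of_nonneg (sub_nonneg.2 h)]
      have := hξ.2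
      gcongr
  · rw [(line g l).zero_outside ξ hξ, norm_zero]; exact hB

/-- The Lipschitz condition in the definition of the class `Φ`, for the set `P(B)` and the
constant `lam`. -/
abbrev LipschitzOnBounded (φ : Pt n T → ℝ) (B lam : ℝ) : Prop :=
  ∀ (t : ℝ) (ht : t ∈ Icc T.t₀ T.ϑ) (z z' : Vec n) (w w' : Hist n T),
    (z, w) ∈ bounded n T B → (z', w') ∈ bounded n T B →
      |φ ⟨t, ht, z, w⟩ - φ ⟨t, ht, z', w'⟩| ≤
        lam * (‖z - z'‖ + norm1 T (fun ξ => w ξ - w' ξ))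

/-- The local Lipschitz estimate for two paths that issue from the same point. -/
theorem abs_sub_withState_le {φ : Pt n T → ℝ} {B lam : ℝ} (hlam0 : 0 ≤ lam)
    (hlam : LipschitzOnBounded φ B lam)
    {g : Pt n T} {x y : PC n (g.t - T.h) T.ϑ} (hx : x ∈ Lam g) (hy : y ∈ Lam g)
    (hxB : ∀ ξ, ‖x ξ‖ ≤ B) (hyB : ∀ ξ, ‖y ξ‖ ≤ B) {ζ ζ' : Vec n} (hζ : ‖ζ‖ ≤ B) (hζ' : ‖ζ'‖ ≤ B)
    {τ : Icc g.t T.ϑ} {D : ℝ} (hD : 0 ≤ D) (hxy : ∀ ξ ∈ Icc g.t τ, ‖x ξ - y ξ‖ ≤ D) :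
    |φ (g.withState x τ ζ) - φ (g.withState y τ ζ')| ≤
      lam * (‖ζ - ζ'‖ + D * (τ - g.t)) := by
  refine (hlam τ ⟨g.mem.1.trans τ.2.1, τ.2.2⟩ ζ ζ' (seg x τ) (seg y τ)
    (mem_bounded_of_le (fun ξ _ => hxB ξ) hζ)
    (mem_bounded_of_le (fun ξ _ => hyB ξ) hζ')).trans ?_
  refine mul_le_mul_of_nonneg_left (add_le_add_right ?_ _) hlam0
  refine norm1_sub_le_of_eq (sub_nonneg.2 τ.2.1) hD (fun ξ hξ => ?_) fun ξ hξ h => ?_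
  · have hm : ξ ∈ Icc (-T.h) 0 := ⟨hξ.1, hξ.2.le.trans (by linarith [τ.2.1])⟩
    have hm' : (τ : ℝ) + ξ ∈ Ico (g.t - T.h) g.t :=
      ⟨by linarith [hξ.1, τ.2.1], by linarith [hξ.2]⟩
    rw [seg_apply x τ hm, seg_apply y τ hm, hx.1 _ hm', hy.1 _ hm']
  · have hm : ξ ∈ Icc (-T.h) 0 := Ico_subset_Icc_self hξ
    rw [seg_apply x τ hm, seg_apply y τ hm]
    exact hxy _ ⟨by linarith, by linarith [hξ.2]⟩

theorem abs_sub_along_le {φ : Pt n T → ℝ} {B lam : ℝ} (hlam0 : 0 ≤ lam)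
    (hlam : LipschitzOnBounded φ B lam)
    {g : Pt n T} {x y : PC n (g.t - T.h) T.ϑ} (hx : x ∈ Lam g) (hy : y ∈ Lam g)
    (hxB : ∀ ξ, ‖x ξ‖ ≤ B) (hyB : ∀ ξ, ‖y ξ‖ ≤ B) {τ : Icc g.t T.ϑ} {D : ℝ} (hD : 0 ≤ D)
    (hxy : ∀ ξ ∈ Icc g.t τ, ‖x ξ - y ξ‖ ≤ D) :
    |φ (g.along x τ) - φ (g.along y τ)| ≤ lam * (‖x τ - y τ‖ + D * (τ - g.t)) :=
  abs_sub_withState_le hlam0 hlam hx hy hxB hyB (hxB τ) (hyB τ) hD hxy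

/-- Elements of `X(t, z, w)` with `ω ≤ 0` up to an arbitrarily small error yield straight lines along
which `φ` grows slowly: over a short time the average velocity is almost in `F(z, w(-h))`, and the
line with this velocity reaches the same state, with a history that differs only to second order. -/
theorem exists_line_le {c : ℝ} (hc : 0 < c) {φ : Pt n T → ℝ} (hφ : InPhi φ) {g : Pt n T}
    (hg : g.t < T.ϑ) {G : ℝ → Vec n → Vec n → ℝ}
    (hG : ContinuousWithinAt (fun q : ℝ × Vec n × Vec n => G q.1 q.2.1 q.2.2)
      (Icc T.t₀ T.ϑ ×ˢ univ ×ˢ univ) (g.t, g.z, g.w (-T.h)))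
    (hGi : ∀ x ∈ X c g, IntervalIntegrable (fun ξ => G ξ (x ξ) (x (ξ - T.h))) volume g.t T.ϑ)
    {s : Vec n}
    (h : ∀ τ : Icc g.t T.ϑ, g.t < τ → ∀ η > 0, ∃ x ∈ X c g, φ (g.along x τ) - φ g +
      ∫ ξ in g.t..τ, (G ξ (x ξ) (x (ξ - T.h)) - inner ℝ (deriv x ξ) s) ≤ η)
    {ε r : ℝ} (hε : 0 < ε) (hr : 0 < r) :
    ∃ v : Vec n, ‖v‖ ≤ c * (1 + ‖g.z‖ + ‖g.w (-T.h)‖) + ε ∧ ∃ τ : Icc g.t T.ϑ, g.t < τ ∧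
      (τ : ℝ) < g.t + r ∧ φ (g.along (line g v) τ) - φ g ≤
        (inner ℝ v s - G g.t g.z (g.w (-T.h)) + ε) * (τ - g.t) := by
  obtain ⟨α, hα, hgα⟩ := exists_mem_bounded g
  set R := radius T c α with hRdef
  have hRα : α ≤ R := le_radius hc hα.le
  have hR0 : 0 ≤ R := hα.le.trans hRα
  set M := c * (1 + R + R) with hM
  have hM0 : 0 ≤ M := by positivity
  obtain ⟨Bw, hBw0, hBw⟩ := g.w.exists_bound
  set V := c * (1 + ‖g.z‖ + ‖g.w (-T.h)‖) + ε with hV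
  have hV0 : 0 ≤ V := by positivity
  set B := R + Bw + ‖g.z‖ + (T.ϑ - g.t) * V + 1 with hB
  have hpos : 0 < T.ϑ - g.t := sub_pos.2 hg
  have hB0 : 0 < B := by positivity
  obtain ⟨lam, hlam0, hlam⟩ := hφ.2 B hB0
  have hev : ∀ᶠ q in 𝓝[Icc T.t₀ T.ϑ ×ˢ univ ×ˢ univ] (g.t, g.z, g.w (-T.h)),
      G g.t g.z (g.w (-T.h)) - ε / 4 < G q.1 q.2.1 q.2.2 ∧ c * (1 + ‖q.2.1‖ + ‖q.2.2‖) < V := by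
    refine (hG.tendsto.eventually (lt_mem_nhds (by simp only; linarith))).and ?_
    have h1 : Continuous fun q : ℝ × Vec n × Vec n => c * (1 + ‖q.2.1‖ + ‖q.2.2‖) := by fun_prop
    exact h1.continuousWithinAt.tendsto.eventually (gt_mem_nhds (by simp only [hV]; linarith))
  obtain ⟨r₁, hr₁, hr₁h, hev⟩ := exists_radius_of_eventually hev
  set δ := min (min (T.ϑ - g.t) (r / 2)) (min (r₁ / (2 * (M + 1))) (ε / (4 * (lam * (2 * M) + 1))))
    with hδ
  have hδ0 : 0 < δ := by positivity
  have hδ1 : δ ≤ T.ϑ - g.t := (min_le_left _ _).trans (min_le_left _ _)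
  have hδ2 : δ ≤ r / 2 := (min_le_left _ _).trans (min_le_right _ _)
  have hδ3 : δ ≤ r₁ / (2 * (M + 1)) := (min_le_right _ _).trans (min_le_left _ _)
  have hδ4 : δ ≤ ε / (4 * (lam * (2 * M) + 1)) := (min_le_right _ _).trans (min_le_right _ _)
  rw [le_div_iff₀ (by positivity)] at hδ3 hδ4
  have hδM : M * δ ≤ r₁ := by nlinarith
  have hδr : δ < r₁ := by nlinarith
  set τ : Icc g.t T.ϑ := ⟨g.t + δ, by linarith, by linarith⟩ with hτ
  have hτt : (τ : ℝ) = g.t + δ := rfl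
  obtain ⟨x, hx, hxη⟩ := h τ (by rw [hτt]; linarith) (ε / 4 * δ) (by positivity)
  have hxR : ∀ ξ, ‖x ξ‖ ≤ R := norm_le_radius_of_mem_X hc hα.le hgα hx
  have hxz : ∀ ξ ∈ Icc g.t (τ : ℝ), ‖x ξ - g.z‖ ≤ M * (ξ - g.t) := by
    intro ξ hξ
    have := norm_sub_le_mul_of_mem_X hc hx hxR ⟨le_rfl, g.mem.2⟩ ⟨hξ.1, hξ.2.trans τ.2.2⟩
    rwa [hx.1.2.1] at this
  have hp : ∀ ξ ∈ Icc g.t (τ : ℝ),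
      G g.t g.z (g.w (-T.h)) - ε / 4 < G ξ (x ξ) (x (ξ - T.h)) ∧
        c * (1 + ‖x ξ‖ + ‖x (ξ - T.h)‖) < V := by
    intro ξ hξ
    have h2 : ξ ≤ g.t + δ := hξ.2
    rw [apply_sub_of_mem_Lam hx.1 hξ.1 (by linarith)]
    refine hev ξ ⟨hξ.1, hξ.2.trans τ.2.2⟩ (by linarith) _ ((hxz ξ hξ).trans ?_)
    exact (mul_le_mul_of_nonneg_left (by linarith) hM0).trans hδM
  set v : Vec n := δ⁻¹ • (x τ - g.z) with hv
  have hδv : δ • v = x τ - g.z := smul_inv_smul₀ hδ0.ne' _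
  have hvV : ‖v‖ ≤ V := by
    have h1 := norm_sub_le_of_mem_X hx (s := g.t) (τ := τ) ⟨le_rfl, g.mem.2⟩ τ.2
    rw [hx.1.2.1] at h1
    have h2 : ∫ ξ in g.t..τ, c * (1 + ‖x ξ‖ + ‖x (ξ - T.h)‖) ≤ ∫ ξ in g.t..τ, V :=
      intervalIntegral.integral_mono_on τ.2.1 (x.intervalIntegrable_growth _ _ _ _)
        intervalIntegrable_const fun ξ hξ => (hp ξ hξ).2.le
    rw [intervalIntegral.integral_const, smul_eq_mul, hτt, add_sub_cancel_left] at h2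
    rw [hv, norm_smul, norm_inv, Real.norm_eq_abs, abs_of_pos hδ0, inv_mul_le_iff₀ hδ0]
    rw [hτt] at h1 ⊢
    exact h1.trans h2
  have hvM : ‖v‖ ≤ M := by
    rw [hv, norm_smul, norm_inv, Real.norm_eq_abs, abs_of_pos hδ0, inv_mul_le_iff₀ hδ0]
    have := hxz τ ⟨τ.2.1, le_rfl⟩
    rw [hτt, add_sub_cancel_left] at this
    rw [hτt, mul_comm δ]
    exact this
  have hlB : ∀ ξ, ‖line g v ξ‖ ≤ B := by
    refine norm_line_le (fun ξ => (hBw ξ).trans ?_) ?_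
    · have := mul_nonneg hpos.le hV0
      linarith [norm_nonneg g.z]
    · have := mul_le_mul_of_nonneg_left hvV hpos.le
      linarith
  have hcmp := abs_sub_along_le hlam0.le hlam (line_mem_Lam g v) hx.1 hlB
    (fun ξ => (hxR ξ).trans (by
      have := mul_nonneg hpos.le hV0
      linarith [norm_nonneg g.z])) (τ := τ) (D := 2 * M * δ) (by positivity) (fun ξ hξ => by
        have h1 := hxz ξ hξ
        have h2 : ξ ≤ g.t + δ := hξ.2
        rw [line_of_mem ⟨hξ.1, hξ.2.trans τ.2.2⟩, add_sub_right_comm, ← norm_neg, neg_add, neg_sub]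
        refine (norm_add_le _ _).trans ?_
        rw [norm_neg, norm_smul, Real.norm_eq_abs, abs_of_nonneg (sub_nonneg.2 hξ.1)]
        have h3 : (ξ - g.t) * ‖v‖ ≤ δ * M := by
          have := hξ.1
          exact mul_le_mul (by linarith) hvM (norm_nonneg _) hδ0.le
        have h4 : M * (ξ - g.t) ≤ M * δ := mul_le_mul_of_nonneg_left (by linarith) hM0
        linarith)
  have hend : line g v τ = x τ := by
    rw [line_of_mem τ.2, hτt, add_sub_cancel_left, hδv]
    exact add_sub_cancel _ _
  rw [hend, sub_self, norm_zero, zero_add, hτt, add_sub_cancel_left] at hcmp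
  have hder := hasDerivAt_of_mem_X hx
  obtain ⟨hdi, hdint⟩ := integral_deriv_of_mem_Lam hx.1 (v := deriv x) (hder.mono fun _ h => h.1)
  have hdi' := intervalIntegrable_sub hdi le_rfl τ.2.1 τ.2.2
  have hGi' := intervalIntegrable_sub (hGi x hx) le_rfl τ.2.1 τ.2.2
  have hint : ∫ ξ in g.t..τ, inner ℝ (deriv x ξ) s = δ * inner ℝ v s := by
    have h1 : ∀ ξ, inner ℝ (deriv x ξ) s = (innerSL ℝ s) (deriv x ξ) := fun ξ => by
      rw [innerSL_apply_apply, real_inner_comm]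
    simp only [h1]
    rw [ContinuousLinearMap.intervalIntegral_comp_comm _ hdi', hdint g.t ⟨le_rfl, g.mem.2⟩ τ τ.2,
      hx.1.2.1, ← hδv, innerSL_apply_apply, inner_smul_right, real_inner_comm]
  have hG2 : δ * (G g.t g.z (g.w (-T.h)) - ε / 4) ≤ ∫ ξ in g.t..τ, G ξ (x ξ) (x (ξ - T.h)) := by
    have := intervalIntegral.integral_mono_on τ.2.1 (intervalIntegrable_const
      (c := G g.t g.z (g.w (-T.h)) - ε / 4)) hGi' fun ξ hξ => (hp ξ hξ).1.le
    rwa [intervalIntegral.integral_const, smul_eq_mul, hτt, add_sub_cancel_left] at this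
  rw [intervalIntegral.integral_sub hGi' ⟨hdi'.1.inner_const s, hdi'.2.inner_const s⟩, hint]
    at hxη
  refine ⟨v, hvV, τ, by rw [hτt]; linarith, by rw [hτt]; linarith, ?_⟩
  have h1 := (abs_le.1 hcmp).2
  have h2 : lam * (2 * M * δ * δ) ≤ ε / 4 * δ := by nlinarith
  rw [hτt, add_sub_cancel_left]
  nlinarith

/-- A sequence of average velocities along which `φ` decreases sufficiently fast accumulates at a
direction of small lower derivative. -/
theorem exists_lowerDeriv_le {c : ℝ} (hc : 0 < c) {φ : Pt n T → ℝ} (hφ : InPhi φ) {g : Pt n T}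
    (hg : g.t < T.ϑ) {G : ℝ → Vec n → Vec n → ℝ}
    (hG : ContinuousWithinAt (fun q : ℝ × Vec n × Vec n => G q.1 q.2.1 q.2.2)
      (Icc T.t₀ T.ϑ ×ˢ univ ×ˢ univ) (g.t, g.z, g.w (-T.h)))
    (hGi : ∀ x ∈ X c g, IntervalIntegrable (fun ξ => G ξ (x ξ) (x (ξ - T.h))) volume g.t T.ϑ)
    {s : Vec n}
    (h : ∀ τ : Icc g.t T.ϑ, g.t < τ → ∀ η > 0, ∃ x ∈ X c g, φ (g.along x τ) - φ g +
      ∫ ξ in g.t..τ, (G ξ (x ξ) (x (ξ - T.h)) - inner ℝ (deriv x ξ) s) ≤ η) :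
    ∃ l ∈ F c g.z (g.w (-T.h)), lowerDeriv φ g l ≤
      ((inner ℝ l s - G g.t g.z (g.w (-T.h)) : ℝ) : EReal) := by
  set A := c * (1 + ‖g.z‖ + ‖g.w (-T.h)‖) with hA
  have hA0 : 0 ≤ A := by positivity
  have hk : ∀ k : ℕ, (0 : ℝ) < 1 / (k + 1) := fun k => by positivity
  choose v hv τ hτ1 hτ2 hτ3 using
    fun k : ℕ => exists_line_le hc hφ hg hG hGi h (hk k) (hk k)
  have hk1 : ∀ k : ℕ, 1 / ((k : ℝ) + 1) ≤ 1 := fun k => by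
    rw [div_le_one (by positivity)]; linarith [(Nat.cast_nonneg k : (0 : ℝ) ≤ k)]
  have hvb : ∀ k, ‖v k‖ ≤ A + 1 := fun k => (hv k).trans (add_le_add_right (hk1 k) _)
  obtain ⟨l, -, ψ, hψ, hl⟩ := (isCompact_closedBall (0 : Vec n) (A + 1)).tendsto_subseq
    (x := v) (fun k => mem_closedBall_zero_iff.2 (hvb k))
  have hz : Tendsto (fun k : ℕ => 1 / ((ψ k : ℝ) + 1)) atTop (𝓝 0) :=
    tendsto_one_div_add_atTop_nhds_zero_nat.comp hψ.tendsto_atTop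
  have hlA : ‖l‖ ≤ A := by
    have h1 : Tendsto (fun k => A + 1 / ((ψ k : ℝ) + 1)) atTop (𝓝 (A + 0)) := hz.const_add A
    rw [add_zero] at h1
    exact le_of_tendsto_of_tendsto' hl.norm h1 fun k => hv (ψ k)
  refine ⟨l, hlA, lowerDeriv_le_coe fun ε hε r hr => ?_⟩
  obtain ⟨Bw, hBw0, hBw⟩ := g.w.exists_bound
  have hpos : 0 < T.ϑ - g.t := sub_pos.2 hg
  set B := Bw + ‖g.z‖ + (T.ϑ - g.t) * (A + 1) + 1 with hB
  have hB0 : 0 < B := by positivity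
  obtain ⟨lam, hlam0, hlam⟩ := hφ.2 B hB0
  have hline : ∀ v : Vec n, ‖v‖ ≤ A + 1 → ∀ ξ, ‖line g v ξ‖ ≤ B := by
    intro v hv
    have h1 : 0 ≤ (T.ϑ - g.t) * (A + 1) := by positivity
    refine norm_line_le (fun ξ => (hBw ξ).trans ?_) ?_
    · linarith [norm_nonneg g.z]
    · have := mul_le_mul_of_nonneg_left hv hpos.le
      linarith
  have hi : Tendsto (fun k => inner ℝ (v (ψ k)) s) atTop (𝓝 (inner ℝ l s)) :=
    hl.inner tendsto_const_nhds
  have hd : Tendsto (fun k => lam * (‖l - v (ψ k)‖ * (1 + 1))) atTop (𝓝 0) := by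
    have h1 := ((hl.const_sub l).norm.mul_const (1 + 1 : ℝ)).const_mul lam
    simpa using h1
  obtain ⟨k, hk2, hk3, hk4, hk5⟩ := ((hi.eventually (gt_mem_nhds (show inner ℝ l s <
    inner ℝ l s + ε / 3 by linarith))).and ((hd.eventually (gt_mem_nhds (show 0 < ε / 3 by
      linarith))).and ((hz.eventually (gt_mem_nhds hr)).and
        (hz.eventually (gt_mem_nhds (show 0 < ε / 3 by linarith)))))).exists
  set K := ψ k with hK
  have hτ0 : 0 < (τ K : ℝ) - g.t := sub_pos.2 (hτ1 K)
  have hτ4 : (τ K : ℝ) - g.t ≤ 1 := by linarith [hτ2 K, hk1 K]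
  refine ⟨τ K, hτ1 K, (hτ2 K).trans (by linarith), ?_⟩
  have hdiff : ∀ ξ ∈ Icc g.t (τ K : ℝ), ‖line g l ξ - line g (v K) ξ‖ ≤
      (τ K - g.t) * ‖l - v K‖ := by
    intro ξ hξ
    have hm : ξ ∈ Icc g.t T.ϑ := ⟨hξ.1, hξ.2.trans (τ K).2.2⟩
    rw [line_of_mem hm, line_of_mem hm, add_sub_add_left_eq_sub, ← smul_sub, norm_smul,
      Real.norm_eq_abs, abs_of_nonneg (sub_nonneg.2 hξ.1)]
    exact mul_le_mul_of_nonneg_right (by linarith [hξ.2]) (norm_nonneg _)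
  have hcmp := (abs_le.1 (abs_sub_along_le hlam0.le hlam (line_mem_Lam g l) (line_mem_Lam g (v K))
    (hline l (by linarith)) (hline _ (hvb K)) (by positivity) hdiff)).2
  have h1 := hdiff (τ K) ⟨(τ K).2.1, le_rfl⟩
  have h2 : ‖line g l (τ K) - line g (v K) (τ K)‖ + (τ K - g.t) * ‖l - v K‖ * (τ K - g.t) ≤
      (τ K - g.t) * (‖l - v K‖ * (1 + 1)) := by
    have h3 : (τ K - g.t) * ‖l - v K‖ * (τ K - g.t) ≤ (τ K - g.t) * ‖l - v K‖ * 1 :=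
      mul_le_mul_of_nonneg_left hτ4 (by positivity)
    linarith
  have h4 := mul_le_mul_of_nonneg_left h2 hlam0.le
  have h5 := mul_lt_mul_of_pos_left hk3 hτ0
  have h6 := mul_lt_mul_of_pos_left hk2 hτ0
  have h7 := mul_lt_mul_of_pos_left hk5 hτ0
  have h8 := hτ3 K
  nlinarith

end Directional

/-! ### From minimax to viscosity solutions -/

section Implications

variable {n m : ℕ} {T : Horizon} {P : Bolza n m T} {c : ℝ} {φ : Pt n T → ℝ}

/-- The lower inequality is `exists_lowerDeriv_le` for `φ` and `H`, the upper one the same for `-φ`,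
`-H` and `-s`. -/
theorem IsMinimaxSolution.satisfiesDerivIneqs (R : P.Regular c) (h : IsMinimaxSolution P c φ) :
    SatisfiesDerivIneqs P c φ := by
  obtain ⟨hφ, hterm, h⟩ := h
  refine ⟨hφ, hterm, fun g s hg => ⟨?_, ?_⟩⟩
  · obtain ⟨l, hl, hle⟩ := exists_lowerDeriv_le R.c_pos hφ hg (G := fun t x y => P.H t x y s)
      (R.continuousOn_H s _ ⟨g.mem, trivial, trivial⟩)
      (fun x _ => R.intervalIntegrable_H g.mem x s)
      (fun τ hτ η hη => exists_le_of_biInf_coe_le_zero (h g τ s hg hτ).1 hη)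
    refine (iInf₂_le l hl).trans ((add_le_add_left hle _).trans (le_of_eq ?_))
    rw [← EReal.coe_add, ← EReal.coe_zero]
    congr 1
    ring
  · obtain ⟨l, hl, hle⟩ := exists_lowerDeriv_le R.c_pos hφ.neg hg
      (G := fun t x y => -P.H t x y s) (s := -s)
      ((R.continuousOn_H s).neg _ ⟨g.mem, trivial, trivial⟩)
      (fun x _ => (R.intervalIntegrable_H g.mem x s).neg)
      (fun τ hτ η hη => by
        obtain ⟨x, hx, hle⟩ := exists_le_of_zero_le_biSup_coe (h g τ s hg hτ).2 hη
        refine ⟨x, hx, ?_⟩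
        unfold minimaxGap at hle
        have h1 : ∫ ξ in g.t..τ, (-P.H ξ (x ξ) (x (ξ - T.h)) s - inner ℝ (deriv x ξ) (-s)) =
            -∫ ξ in g.t..τ, (P.H ξ (x ξ) (x (ξ - T.h)) s - inner ℝ (deriv x ξ) s) := by
          rw [← intervalIntegral.integral_neg]
          refine intervalIntegral.integral_congr fun ξ _ => ?_
          simp only [inner_neg_right]
          ring
        rw [h1, Pi.neg_apply, Pi.neg_apply]
        linarith)
    refine le_trans ?_ (le_iSup₂ (f := fun l (_ : l ∈ F c g.z (g.w (-T.h))) => upperDeriv φ g l +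
      ((P.H g.t g.z (g.w (-T.h)) s - inner ℝ l s : ℝ) : EReal)) l hl)
    have h1 : ((inner ℝ l s - P.H g.t g.z (g.w (-T.h)) s : ℝ) : EReal) ≤ upperDeriv φ g l := by
      rw [upperDeriv_eq_neg, EReal.le_neg, ← EReal.coe_neg]
      refine hle.trans (le_of_eq ?_)
      rw [inner_neg_right]
      congr 1
      ring
    refine le_trans (le_of_eq ?_) (add_le_add_left h1 _)
    rw [← EReal.coe_add, ← EReal.coe_zero]
    congr 1
    ring

/-- For a subgradient `(p₀, p)` each term of the infimum with `s = p` is at least `p₀ + H(·, p)`;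
symmetrically for supergradients. -/
theorem SatisfiesDerivIneqs.isViscositySolution (h : SatisfiesDerivIneqs P c φ) :
    IsViscositySolution P φ := by
  obtain ⟨hφ, hterm, h⟩ := h
  refine ⟨hφ, hterm, fun g hg => ⟨fun p hp => ?_, fun q hq => ?_⟩⟩
  · rw [← EReal.coe_le_coe_iff, EReal.coe_zero]
    refine (le_iInf₂ fun l _ => ?_).trans (h g p.2 hg).1
    refine le_trans (le_of_eq ?_) (add_le_add_left (hp l) _)
    rw [← EReal.coe_add]
    congr 1
    ring
  · rw [← EReal.coe_le_coe_iff, EReal.coe_zero]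
    refine (h g q.2 hg).2.trans (iSup₂_le fun l _ => ?_)
    refine (add_le_add_left (hq l) _).trans (le_of_eq ?_)
    rw [← EReal.coe_add]
    congr 1
    ring

end Implications

/-! ### A multidirectional mean value inequality -/

section MeanValue

variable {n : ℕ} {T : Horizon} {φ : Pt n T → ℝ} {g : Pt n T} {B lam : ℝ}

theorem norm_line_zero_le (hw : ∀ ξ, ‖g.w ξ‖ ≤ B) (hz : ‖g.z‖ + 1 ≤ B) (ξ : ℝ) :
    ‖line g 0 ξ‖ ≤ B :=
  norm_line_le hw (by rw [norm_zero, mul_zero]; linarith) ξ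

theorem mem_bounded_withState (hw : ∀ ξ, ‖g.w ξ‖ ≤ B) (hz : ‖g.z‖ + 1 ≤ B) {ζ : Vec n}
    (hζ : ‖ζ - g.z‖ ≤ 1) (τ : Icc g.t T.ϑ) : (ζ, seg (line g 0) τ) ∈ bounded n T B := by
  refine mem_bounded_of_le (fun ξ _ => norm_line_zero_le hw hz ξ) ?_
  have := norm_le_norm_add_norm_sub' ζ g.z
  linarith

/-- A quadratic lower bound for `φ` with the history frozen along the constant extension of `g`
gives a subgradient of `φ`. The history of a straight line through `(τ, ζ)` departs from the frozen
one at the rate `‖ζ - z‖`, which is why `p₀` is corrected. -/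
theorem mem_subdiff_withState (hlam0 : 0 ≤ lam)
    (hlam : LipschitzOnBounded φ B lam)
    (hw : ∀ ξ, ‖g.w ξ‖ ≤ B) (hz : ‖g.z‖ + 1 ≤ B) {τ : Icc g.t T.ϑ} {ζ : Vec n}
    (hζ : ‖ζ - g.z‖ < 1) {p₀ : ℝ} {p : Vec n}
    (h : ∀ l : Vec n, ∃ K ≥ 0, ∃ r > 0, ∀ τ' : Icc g.t T.ϑ, (τ : ℝ) < τ' → (τ' : ℝ) < τ + r →
      (p₀ + inner ℝ l p) * (τ' - τ) - K * (τ' - τ) ^ 2 ≤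
        φ (g.withState (line g 0) τ' (ζ + ((τ' : ℝ) - τ) • l)) -
          φ (g.withState (line g 0) τ ζ)) :
    (p₀ - lam * ‖ζ - g.z‖, p) ∈ subdiff φ (g.withState (line g 0) τ ζ) := by
  intro l
  obtain ⟨K, hK, r, hr, h⟩ := h l
  set g' := g.withState (line g 0) τ ζ with hg'
  refine coe_le_lowerDeriv fun ε hε => ?_
  refine ⟨min r (min ((1 - ‖ζ - g.z‖) / (‖l‖ + 1)) (ε / (K + lam * ‖l‖ + 1))), ?_, ?_⟩
  · have : 0 < 1 - ‖ζ - g.z‖ := sub_pos.2 hζ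
    positivity
  intro τ' h1 h2
  change (τ : ℝ) < τ' at h1
  change (τ' : ℝ) < τ + _ at h2
  have hσ0 : 0 < (τ' : ℝ) - τ := sub_pos.2 h1
  have hσr : (τ' : ℝ) < τ + r := h2.trans_le (add_le_add_right (min_le_left _ _) _)
  have hσ1 : (τ' : ℝ) - τ < (1 - ‖ζ - g.z‖) / (‖l‖ + 1) := by
    have := (min_le_right r _).trans (min_le_left ((1 - ‖ζ - g.z‖) / (‖l‖ + 1))
      (ε / (K + lam * ‖l‖ + 1)))
    linarith
  have hσ2 : (τ' : ℝ) - τ < ε / (K + lam * ‖l‖ + 1) := by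
    have := (min_le_right r _).trans (min_le_right ((1 - ‖ζ - g.z‖) / (‖l‖ + 1))
      (ε / (K + lam * ‖l‖ + 1)))
    linarith
  rw [lt_div_iff₀ (by positivity)] at hσ1 hσ2
  have hmem : (τ' : ℝ) ∈ Icc g.t T.ϑ := ⟨τ.2.1.trans h1.le, τ'.2.2⟩
  set τ'' : Icc g.t T.ϑ := ⟨τ', hmem⟩ with hτ''
  have hq := h τ'' h1 hσr
  have hτt : (τ'' : ℝ) = τ' := rfl
  rw [hτt] at hq
  -- values of the line through the new point
  have hline : ∀ ξ ∈ Icc (τ : ℝ) τ', line g' l ξ = ζ + (ξ - τ) • l := fun ξ hξ =>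
    line_of_mem (g := g') ⟨hξ.1, hξ.2.trans τ'.2.2⟩
  have hlineB : ∀ ξ ∈ Icc (τ : ℝ) τ', ‖line g' l ξ - g.z‖ ≤ ‖ζ - g.z‖ + (τ' - τ) * ‖l‖ := by
    intro ξ hξ
    rw [hline ξ hξ, add_sub_right_comm]
    refine (norm_add_le _ _).trans ?_
    rw [norm_smul, Real.norm_eq_abs, abs_of_nonneg (sub_nonneg.2 hξ.1)]
    gcongr
    exact hξ.2
  have hlt1 : ‖ζ - g.z‖ + (τ' - τ) * ‖l‖ ≤ 1 := by nlinarith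
  have hpast : ∀ ξ ∈ Ico ((τ : ℝ) - T.h) τ, line g' l ξ = line g 0 ξ := by
    intro ξ hξ
    rw [line_of_lt (g := g') hξ.1 hξ.2]
    change seg (line g 0) τ (ξ - τ) = _
    rw [seg_apply _ _ ⟨by linarith [hξ.1], by linarith [hξ.2]⟩, add_sub_cancel]
  have hb1 : (line g' l τ', seg (line g' l) τ') ∈ bounded n T B := by
    have haux : ∀ ξ ∈ Icc (τ : ℝ) τ', ‖line g' l ξ‖ ≤ B := fun ξ hξ => by
      have := norm_le_norm_add_norm_sub' (line g' l ξ) g.z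
      linarith [hlineB ξ hξ]
    refine ⟨haux _ ⟨h1.le, le_rfl⟩, fun ξ hξ => ?_⟩
    change ‖seg (line g' l) τ' ξ‖ ≤ B
    rw [seg_apply _ _ hξ]
    rcases lt_or_ge ((τ' : ℝ) + ξ) τ with h3 | h3
    · rw [hpast _ ⟨by linarith [hξ.1], h3⟩]
      exact norm_line_zero_le hw hz _
    · exact haux _ ⟨h3, by linarith [hξ.2]⟩
  have hb2 := mem_bounded_withState hw hz (ζ := ζ + ((τ' : ℝ) - τ) • l) (by
    rw [← hline τ' ⟨h1.le, le_rfl⟩]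
    exact (hlineB τ' ⟨h1.le, le_rfl⟩).trans hlt1) τ''
  have hcmp := hlam τ' ⟨g.mem.1.trans hmem.1, hmem.2⟩ _ _ _ _ hb1 hb2
  have hnorm : norm1 T (fun ξ => seg (line g' l) τ' ξ - seg (line g 0) τ'' ξ) ≤
      (‖ζ - g.z‖ + (τ' - τ) * ‖l‖) * (τ' - τ) := by
    refine norm1_sub_le_of_eq hσ0.le (by positivity) (fun ξ hξ => ?_) fun ξ hξ hle => ?_
    · have hm : ξ ∈ Icc (-T.h) 0 := ⟨hξ.1, by linarith [hξ.2]⟩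
      rw [seg_apply _ τ' hm, seg_apply _ τ'' hm]
      exact hpast _ ⟨by linarith [hξ.1], by linarith [hξ.2]⟩
    · have hm : ξ ∈ Icc (-T.h) 0 := Ico_subset_Icc_self hξ
      rw [seg_apply _ τ' hm, seg_apply _ τ'' hm]
      have h3 : (τ : ℝ) ≤ τ' + ξ := by linarith
      have h4 : line g 0 ((τ'' : ℝ) + ξ) = g.z := by
        change line g 0 ((τ' : ℝ) + ξ) = g.z
        rw [line_of_mem ⟨τ.2.1.trans h3, by linarith [hξ.2, τ'.2.2]⟩, smul_zero, add_zero]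
      rw [h4]
      exact hlineB _ ⟨h3, by linarith [hξ.2]⟩
  rw [hline τ' ⟨h1.le, le_rfl⟩, sub_self, norm_zero, zero_add] at hcmp
  have h5 := (abs_le.1 hcmp).1
  have h6 := mul_le_mul_of_nonneg_left hnorm hlam0
  have h7 : φ (g'.along (line g' l) τ') =
      φ ⟨τ', ⟨g.mem.1.trans hmem.1, hmem.2⟩, ζ + ((τ' : ℝ) - τ) • l, seg (line g' l) τ'⟩ := by
    rw [← hline τ' ⟨h1.le, le_rfl⟩]
    rfl
  change (p₀ - lam * ‖ζ - g.z‖ + inner ℝ l p - ε) * ((τ' : ℝ) - τ) ≤ _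
  rw [h7]
  have h8 : φ (g.withState (line g 0) τ'' (ζ + ((τ' : ℝ) - τ) • l)) =
    φ ⟨τ', ⟨g.mem.1.trans hmem.1, hmem.2⟩, ζ + ((τ' : ℝ) - τ) • l, seg (line g 0) τ''⟩ := rfl
  rw [h8] at hq
  have h9 : (K + lam * ‖l‖) * (τ' - τ) ^ 2 ≤ ε * (τ' - τ) := by nlinarith
  nlinarith

theorem nonneg_of_forall_mul_add_sq_nonneg {a d : ℝ} (hd : 0 ≤ d)
    (h : ∀ s ∈ Icc (0 : ℝ) 1, 0 ≤ s * a + s ^ 2 * d) : 0 ≤ a := by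
  by_contra! hneg
  have hs : 0 < min 1 (-a / (2 * (d + 1))) := lt_min one_pos (by
    have : 0 < -a := by linarith
    positivity)
  set s := min 1 (-a / (2 * (d + 1)))
  have h1 := h s ⟨hs.le, min_le_left _ _⟩
  have h2 : s ≤ -a / (2 * (d + 1)) := min_le_right _ _
  rw [le_div_iff₀ (by positivity)] at h2
  nlinarith

/-- The functional `φ` with the history frozen along the constant extension of `g`, with the running
cost `b - η` and a quadratic penalty for the distance to the segment `z + θ l`; `q = (l, b)`. -/
noncomputable def penalized (φ : Pt n T → ℝ) (g : Pt n T) (k η : ℝ) (τ : Icc g.t T.ϑ) (ζ : Vec n)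
    (q : Vec n × ℝ) : ℝ :=
  φ (g.withState (line g 0) τ ζ) + (τ - g.t) * (q.2 - η) +
    k * ‖ζ - g.z - ((τ : ℝ) - g.t) • q.1‖ ^ 2

theorem penalized_start (hφ : InPhi φ) (k η : ℝ) (q : Vec n × ℝ) :
    penalized φ g k η ⟨g.t, le_rfl, g.mem.2⟩ g.z q = φ g := by
  have h : φ (g.withState (line g 0) ⟨g.t, le_rfl, g.mem.2⟩ g.z) = φ g := by
    rw [← hφ.along_self (line_mem_Lam g 0)]
    congr 1
    refine Pt.ext rfl ?_ rfl
    exact (line_mem_Lam g 0).2.1.symm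
  simp [penalized, h]

/-- The direction of a minimiser of the penalised functional also minimises
`b + ⟪l, p⟫` over `C`, where `p` is the gradient of the penalty. At the initial time the functional
does not depend on the direction, which can then be chosen. -/
theorem exists_isMin_penalized (hφ : InPhi φ) {C : Set (Vec n × ℝ)} (hCc : IsCompact C)
    (hCx : Convex ℝ C) (hCn : C.Nonempty) {k : ℝ} (hk : 0 ≤ k) (η : ℝ) (τ₁ : Icc g.t T.ϑ) :
    ∃ τ ≤ τ₁, ∃ ζ : Vec n, ‖ζ - g.z‖ ≤ 1 ∧ ∃ q ∈ C,
      (∀ τ' ≤ τ₁, ∀ ζ' : Vec n, ‖ζ' - g.z‖ ≤ 1 → ∀ q' ∈ C,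
        penalized φ g k η τ ζ q ≤ penalized φ g k η τ' ζ' q') ∧
      ∀ q' ∈ C, q.2 + inner ℝ q.1 ((-(2 * k)) • (ζ - g.z - ((τ : ℝ) - g.t) • q.1)) ≤
        q'.2 + inner ℝ q'.1 ((-(2 * k)) • (ζ - g.z - ((τ : ℝ) - g.t) • q.1)) := by
  have hΨc : Continuous fun x : Icc g.t T.ϑ × Vec n × (Vec n × ℝ) =>
      penalized φ g k η x.1 x.2.1 x.2.2 := by
    have h1 : Continuous fun x : Icc g.t T.ϑ × Vec n × (Vec n × ℝ) =>
        φ (g.withState (line g 0) x.1 x.2.1) :=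
      (hφ.continuous_withState g (line g 0)).comp (continuous_fst.prodMk
        (continuous_fst.comp continuous_snd))
    unfold penalized
    refine (h1.add ?_).add ?_ <;> fun_prop
  have hSc : IsCompact (Iic τ₁ ×ˢ Metric.closedBall g.z 1 ×ˢ C) :=
    isClosed_Iic.isCompact.prod ((isCompact_closedBall _ _).prod hCc)
  obtain ⟨q₀, hq₀⟩ := hCn
  obtain ⟨⟨τ, ζ, q⟩, hm, hmin⟩ := hSc.exists_isMinOn
    ⟨(τ₁, g.z, q₀), mem_Iic.2 le_rfl, Metric.mem_closedBall_self zero_le_one, hq₀⟩ hΨc.continuousOn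
  have hτm : τ ≤ τ₁ := hm.1
  have hζm : ‖ζ - g.z‖ ≤ 1 := by rw [← dist_eq_norm]; exact hm.2.1
  have hq : q ∈ C := hm.2.2
  have hmin' : ∀ τ' ≤ τ₁, ∀ ζ' : Vec n, ‖ζ' - g.z‖ ≤ 1 → ∀ q' ∈ C,
      penalized φ g k η τ ζ q ≤ penalized φ g k η τ' ζ' q' := fun τ' h1 ζ' h2 q' h3 =>
    hmin (a := (τ', ζ', q')) ⟨h1, by rw [Metric.mem_closedBall, dist_eq_norm]; exact h2, h3⟩
  rcases τ.2.1.eq_or_lt with he | hlt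
  · obtain ⟨q', hq', hqmin⟩ := hCc.exists_isMinOn ⟨q₀, hq₀⟩ (f := fun q : Vec n × ℝ =>
      q.2 + inner ℝ q.1 ((-(2 * k)) • (ζ - g.z))) (by fun_prop : Continuous _).continuousOn
    have h0 : (τ : ℝ) - g.t = 0 := sub_eq_zero.2 he.symm
    refine ⟨τ, hτm, ζ, hζm, q', hq', ?_, fun q'' hq'' => ?_⟩
    · have : penalized φ g k η τ ζ q' = penalized φ g k η τ ζ q := by
        simp only [penalized, h0, zero_mul, zero_smul]
      rw [this]
      exact hmin'
    · rw [h0, zero_smul, sub_zero]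
      exact hqmin hq''
  · refine ⟨τ, hτm, ζ, hζm, q, hq, hmin', fun q' hq' => ?_⟩
    have hθ : 0 < (τ : ℝ) - g.t := sub_pos.2 hlt
    set θ := (τ : ℝ) - g.t with hθd
    set e := ζ - g.z - θ • q.1 with he
    have hkey := nonneg_of_forall_mul_add_sq_nonneg
      (a := θ * (q'.2 - q.2 + inner ℝ (q'.1 - q.1) ((-(2 * k)) • e)))
      (d := k * (θ ^ 2 * ‖q'.1 - q.1‖ ^ 2)) (by positivity) fun s hs => by
        have h1 := hmin' τ hτm ζ hζm (q + s • (q' - q)) (hCx.add_smul_sub_mem hq hq' hs)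
        simp only [penalized, Prod.fst_add, Prod.snd_add, Prod.smul_fst, Prod.smul_snd,
          Prod.fst_sub, Prod.snd_sub, smul_eq_mul, ← hθd] at h1
        have h2 : ζ - g.z - θ • (q.1 + s • (q'.1 - q.1)) = e - (θ * s) • (q'.1 - q.1) := by
          rw [he, smul_add, smul_smul]; abel
        rw [h2, ← he, norm_sub_sq_real e, norm_smul, inner_smul_right, mul_pow,
          Real.norm_eq_abs, sq_abs] at h1
        rw [inner_smul_right, real_inner_comm]
        nlinarith
    have h3 := nonneg_of_mul_nonneg_right hkey hθ
    rw [inner_sub_left] at h3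
    linarith

/-- A multidirectional mean value inequality of Clarke–Ledyaev type: if all subgradients of `φ` near
`(t, z)` admit a direction `q ∈ C` in which they are almost nonpositive, then `φ` almost decreases
in some direction of the convex compact set `C`. The last component of `q` is the running cost.
The proof minimises `φ` plus a quadratic penalty for the distance to the segments `z + θ l`,
`(l, b) ∈ C`; a minimiser before the final time would give a subgradient that violates the
hypothesis. -/
theorem exists_decrease_of_subdiff (hφ : InPhi φ) {C : Set (Vec n × ℝ)}
    (hCc : IsCompact C) (hCx : Convex ℝ C) (hCn : C.Nonempty)
    (h : ∀ ε > 0, ∀ M : ℝ, ∃ r > 0, ∀ τ : Icc g.t T.ϑ, (τ : ℝ) < T.ϑ → (τ : ℝ) < g.t + r →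
      ∀ ζ : Vec n, ‖ζ - g.z‖ < r → ∀ p ∈ subdiff φ (g.withState (line g 0) τ ζ), ‖p.2‖ ≤ M →
        ∃ q ∈ C, p.1 + inner ℝ q.1 p.2 + q.2 ≤ ε) {ε : ℝ} (hε : 0 < ε) :
    ∃ r > 0, ∀ τ : Icc g.t T.ϑ, g.t < τ → (τ : ℝ) < g.t + r → ∃ q ∈ C,
      φ (g.withState (line g 0) τ (g.z + ((τ : ℝ) - g.t) • q.1)) + (τ - g.t) * q.2 ≤
        φ g + ε * (τ - g.t) := by
  obtain ⟨Bw, hBw0, hBw⟩ := g.w.exists_bound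
  have hB0 : 0 < Bw + ‖g.z‖ + 1 := by positivity
  obtain ⟨lam, hlam0, hlam⟩ := hφ.2 _ hB0
  have hw : ∀ ξ, ‖g.w ξ‖ ≤ Bw + ‖g.z‖ + 1 := fun ξ => by linarith [hBw ξ, norm_nonneg g.z]
  have hz : ‖g.z‖ + 1 ≤ Bw + ‖g.z‖ + 1 := by linarith
  obtain ⟨L, hL0, hL⟩ : ∃ L ≥ 0, ∀ q ∈ C, ‖q.1‖ ≤ L := by
    obtain ⟨L, hL⟩ := hCc.isBounded.exists_norm_le
    exact ⟨max L 0, le_max_right _ _, fun q hq =>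
      (norm_fst_le q).trans ((hL q hq).trans (le_max_left _ _))⟩
  obtain ⟨r₀, hr₀, h⟩ := h (ε / 8) (by positivity) (2 * lam)
  refine ⟨min r₀ (min 1 (ε / (4 * lam))) / (1 + L), by positivity, fun τ₁ hτ₁ hτ₁r => ?_⟩
  by_contra! hcon
  set δ := (τ₁ : ℝ) - g.t with hδ
  have hδ0 : 0 < δ := sub_pos.2 hτ₁
  have hδL : δ * (1 + L) < min r₀ (min 1 (ε / (4 * lam))) := by
    rw [← lt_div_iff₀ (by positivity)]; linarith
  have hδr : δ * (1 + L) < r₀ := hδL.trans_le (min_le_left _ _)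
  have hδ1 : δ * (1 + L) < 1 := hδL.trans_le ((min_le_right _ _).trans (min_le_left _ _))
  have hδε : lam * (δ * (1 + L)) < ε / 4 := by
    have := hδL.trans_le ((min_le_right _ _).trans (min_le_right _ _))
    rw [lt_div_iff₀ (by positivity)] at this
    linarith
  have hδδ : δ ≤ δ * (1 + L) := by nlinarith
  set K := lam + 2 * lam ^ 2 / ε + 1 with hK
  have hK1 : lam ≤ K := by
    have : 0 ≤ 2 * lam ^ 2 / ε := by positivity
    linarith
  have hK0 : 0 < K := hlam0.trans_le hK1
  have hK2 : 2 * lam ^ 2 ≤ K * ε := by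
    have h1 : 2 * lam ^ 2 / ε * ε = 2 * lam ^ 2 := div_mul_cancel₀ _ hε.ne'
    have h2 : K * ε = (lam + 1) * ε + 2 * lam ^ 2 / ε * ε := by rw [hK]; ring
    have h3 : 0 < (lam + 1) * ε := by positivity
    linarith
  set k := K / δ with hk
  have hk0 : 0 < k := by positivity
  have hkδ : k * δ = K := div_mul_cancel₀ _ hδ0.ne'
  obtain ⟨τ, hτm, ζ, hζ1, ⟨l, b⟩, hlm, hmin, hstat⟩ :=
    exists_isMin_penalized hφ hCc hCx hCn hk0.le (ε / 2) τ₁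
  have hl : ‖l‖ ≤ L := hL (l, b) hlm
  have hθ0 : 0 ≤ (τ : ℝ) - g.t := sub_nonneg.2 τ.2.1
  have hττ₁ : (τ : ℝ) ≤ τ₁ := hτm
  have hθδ : (τ : ℝ) - g.t ≤ δ := by linarith
  set θ := (τ : ℝ) - g.t with hθ
  simp only at hstat
  set e := ζ - g.z - θ • l with he
  set p := (-(2 * k)) • e with hp
  have hθl : ‖θ • l‖ ≤ δ * L := by
    rw [norm_smul, Real.norm_eq_abs, abs_of_nonneg hθ0]
    exact mul_le_mul hθδ hl (norm_nonneg _) hδ0.le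
  have hyz : ‖g.z + θ • l - g.z‖ ≤ 1 := by
    rw [add_sub_cancel_left]; linarith
  have hζy : ζ - (g.z + θ • l) = e := by rw [he]; abel
  have hnB : ∀ ζ' : Vec n, ‖ζ' - g.z‖ ≤ 1 → ‖ζ'‖ ≤ Bw + ‖g.z‖ + 1 := fun ζ' hζ' => by
    linarith [norm_le_norm_add_norm_sub' ζ' g.z]
  have hLip := abs_le.1 (abs_sub_withState_le hlam0.le hlam (line_mem_Lam g 0) (line_mem_Lam g 0)
    (norm_line_zero_le hw hz) (norm_line_zero_le hw hz) (hnB _ hζ1) (hnB _ hyz) (τ := τ) le_rfl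
    fun ξ _ => by rw [sub_self, norm_zero])
  rw [hζy, zero_mul, add_zero] at hLip
  -- the minimiser stays close to the segment: `k ‖e‖²` is at most what `φ` can gain by leaving it
  have hke : k * ‖e‖ ≤ lam := by
    have h1 := hmin τ hτm (g.z + θ • l) hyz (l, b) hlm
    simp only [penalized, ← hθ, ← he] at h1
    rw [add_sub_cancel_left, sub_self, norm_zero] at h1
    rcases (norm_nonneg e).eq_or_lt with h0 | h0
    · rw [← h0, mul_zero]; exact hlam0.le
    · have h2 : k * ‖e‖ * ‖e‖ ≤ lam * ‖e‖ := by linarith [hLip.2]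
      exact le_of_mul_le_mul_right h2 h0
  have hKe : K * ‖e‖ ≤ lam * δ := by
    rw [← hkδ]
    linarith [mul_le_mul_of_nonneg_right hke hδ0.le]
  have heδ : ‖e‖ ≤ δ := by
    have h1 : K * ‖e‖ ≤ K * δ := hKe.trans (mul_le_mul_of_nonneg_right hK1 hδ0.le)
    exact le_of_mul_le_mul_left h1 hK0
  have hζδ : ‖ζ - g.z‖ ≤ δ * (1 + L) := by
    have h1 : ζ - g.z = e + θ • l := by rw [he]; abel
    rw [h1]
    refine (norm_add_le _ _).trans ?_
    linarith
  have hpn : ‖p‖ ≤ 2 * lam := by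
    rw [hp, norm_smul, norm_neg, Real.norm_eq_abs, abs_of_pos (by positivity)]
    linarith
  -- the minimum is attained before `τ₁`: otherwise the value at the starting point would be at least
  -- that at `τ₁`, against the assumption that `φ` decreases too little in every direction of `C`
  have hτlt : (τ : ℝ) < τ₁ := by
    refine lt_of_le_of_ne hτm fun heq => ?_
    have hτeq : τ = τ₁ := Subtype.ext heq
    have h1 := hmin ⟨g.t, le_rfl, g.mem.2⟩ hτ₁.le g.z (by simp) (l, b) hlm
    rw [penalized_start hφ] at h1
    have h2 := hcon (l, b) hlm
    have hθδ' : θ = δ := by rw [hθ, hτeq]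
    simp only [penalized, ← hθ, ← he] at h1
    rw [← hτeq, ← hθδ'] at h2
    simp only at h2
    have h3 : lam * ‖e‖ ≤ ε / 2 * θ := by
      have h4 : K * (lam * ‖e‖) ≤ K * (ε / 2 * θ) := by
        have h5 := mul_le_mul_of_nonneg_left hKe hlam0.le
        have h6 := mul_le_mul_of_nonneg_right hK2 hδ0.le
        rw [hθδ']
        linarith
      exact le_of_mul_le_mul_left h4 hK0
    have h5 : 0 ≤ k * ‖e‖ ^ 2 := by positivity
    linarith [hLip.1]
  -- perturbing the minimiser along `(1, l')` gives a quadratic lower bound for `φ`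
  have hsub : (-(b - ε / 2) - inner ℝ l p - lam * ‖ζ - g.z‖, p) ∈
      subdiff φ (g.withState (line g 0) τ ζ) := by
    have hζlt : ‖ζ - g.z‖ < 1 := hζδ.trans_lt hδ1
    refine mem_subdiff_withState hlam0.le hlam hw hz hζlt fun l' => ?_
    refine ⟨k * ‖l' - l‖ ^ 2, by positivity, min (τ₁ - τ) ((1 - ‖ζ - g.z‖) / (‖l'‖ + 1)),
      lt_min (sub_pos.2 hτlt) (div_pos (sub_pos.2 hζlt) (by positivity)), fun τ' h1 h2 => ?_⟩
    have h3 : (τ' : ℝ) ≤ τ₁ := by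
      have := min_le_left (τ₁ - τ : ℝ) ((1 - ‖ζ - g.z‖) / (‖l'‖ + 1))
      linarith
    have h4 : (τ' - τ) * (‖l'‖ + 1) < 1 - ‖ζ - g.z‖ := by
      rw [← lt_div_iff₀ (by positivity)]
      have := min_le_right (τ₁ - τ : ℝ) ((1 - ‖ζ - g.z‖) / (‖l'‖ + 1))
      linarith
    set σ := (τ' : ℝ) - τ with hσ
    have hσ0 : 0 < σ := sub_pos.2 h1
    have h5 : ‖ζ + σ • l' - g.z‖ ≤ 1 := by
      rw [add_sub_right_comm]
      refine (norm_add_le _ _).trans ?_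
      rw [norm_smul, Real.norm_eq_abs, abs_of_pos hσ0]
      linarith
    have h6 := hmin τ' h3 (ζ + σ • l') h5 (l, b) hlm
    have h7 : (τ' : ℝ) - g.t = θ + σ := by rw [hθ, hσ]; ring
    simp only [penalized, ← hθ, ← he, h7] at h6
    have h8 : ζ + σ • l' - g.z - (θ + σ) • l = e + σ • (l' - l) := by
      rw [he, add_smul, smul_sub]; abel
    rw [h8, norm_add_sq_real, norm_smul, inner_smul_right, mul_pow, Real.norm_eq_abs, sq_abs] at h6
    have h9 : inner ℝ l' p - inner ℝ l p = -(2 * k) * inner ℝ e (l' - l) := by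
      rw [← inner_sub_left, hp, inner_smul_right, real_inner_comm]
    have h10 := congrArg (σ * ·) h9
    linarith
  obtain ⟨q, hq, hqε⟩ := h τ (hτlt.trans_le τ₁.2.2) (by linarith) ζ (hζδ.trans_lt hδr) _ hsub hpn
  have h1 := hstat q hq
  have h2 := mul_le_mul_of_nonneg_left hζδ hlam0.le
  simp only at hqε
  linarith

end MeanValue

/-! ### Convex combinations as averages over controls -/

section Averages

variable {m : ℕ} {U : Set (Vec m)}

theorem intervalIntegrable_comp_control {E : Type*} [NormedAddCommGroup E] (hU : IsCompact U)
    {k : Vec m → E} (hk : ContinuousOn k U) {u : ℝ → Vec m} (hu : Measurable u)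
    (huU : ∀ ξ, u ξ ∈ U) (a b : ℝ) : IntervalIntegrable (fun ξ => k (u ξ)) volume a b := by
  obtain ⟨M, hM⟩ := hU.exists_bound_of_continuousOn hk
  have h1 := hk.aestronglyMeasurable (μ := (volume.restrict (uIoc a b)).map u) hU.measurableSet
  rw [Measure.restrict_eq_self_of_ae_mem
    ((ae_map_iff hu.aemeasurable hU.measurableSet).2 (Eventually.of_forall huU))] at h1
  refine intervalIntegrable_iff.2 ⟨h1.comp_aemeasurable hu.aemeasurable, ?_⟩
  exact .restrict_of_bounded (C := M) (by simp)
    (Eventually.of_forall fun ξ => hM _ (huU ξ))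

/-- Convex combinations of the values of `k` are averages of `k` over measurable controls. -/
theorem exists_integral_eq_of_mem_convexHull {E : Type*} [NormedAddCommGroup E] [NormedSpace ℝ E]
    [CompleteSpace E] (hU : IsCompact U) {k : Vec m → E} (hk : ContinuousOn k U) {q : E}
    (hq : q ∈ convexHull ℝ (k '' U)) :
    ∃ u : ℝ → Vec m, Measurable u ∧ (∀ ξ, u ξ ∈ U) ∧ ∫ ξ in (0 : ℝ)..1, k (u ξ) = q := by
  refine convexHull_min (t := {q | ∃ u : ℝ → Vec m, Measurable u ∧ (∀ ξ, u ξ ∈ U) ∧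
    ∫ ξ in (0 : ℝ)..1, k (u ξ) = q}) ?_ ?_ hq
  · rintro _ ⟨u, hu, rfl⟩
    exact ⟨fun _ => u, measurable_const, fun _ => hu, by simp⟩
  · refine convex_iff_forall_pos.2 ?_
    rintro _ ⟨u, hu, huU, rfl⟩ _ ⟨v, hv, hvU, rfl⟩ a b ha hb hab
    -- run through `u` on `[0, a]` and through `v` on `[a, 1]`
    set w : ℝ → Vec m := fun ξ => if ξ < a then u (ξ / a) else v ((ξ - a) / b) with hw
    have hwm : Measurable w := Measurable.ite measurableSet_Iio (hu.comp (measurable_id.div_const a))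
      (hv.comp ((measurable_id.sub_const a).div_const b))
    have hwU : ∀ ξ, w ξ ∈ U := fun ξ => by
      simp only [hw]; split_ifs
      exacts [huU _, hvU _]
    refine ⟨w, hwm, hwU, ?_⟩
    have hi := fun c d => intervalIntegrable_comp_control hU hk hwm hwU c d
    rw [← intervalIntegral.integral_add_adjacent_intervals (hi 0 a) (hi a 1)]
    congr 1
    · have h1 : ∫ ξ in (0 : ℝ)..a, k (w ξ) = ∫ ξ in (0 : ℝ)..a, k (u (ξ / a)) := by
        refine intervalIntegral.integral_congr_ae ?_
        filter_upwards [compl_mem_ae_iff.2 (measure_singleton (μ := volume) a)] with ξ h2 h3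
        rw [uIoc_of_le ha.le] at h3
        simp only [hw, if_pos (lt_of_le_of_ne h3.2 h2)]
      rw [h1, intervalIntegral.integral_comp_div (fun ξ => k (u ξ)) ha.ne', zero_div,
        div_self ha.ne']
    · have h1 : ∫ ξ in a..1, k (w ξ) = ∫ ξ in a..1, k (v ((ξ - a) / b)) := by
        refine intervalIntegral.integral_congr fun ξ h2 => ?_
        rw [uIcc_of_le (by linarith)] at h2
        simp only [hw, if_neg (not_lt.2 h2.1)]
      rw [h1, intervalIntegral.integral_comp_sub_right (fun ξ => k (v (ξ / b))),
        intervalIntegral.integral_comp_div (fun ξ => k (v ξ)) hb.ne', sub_self, zero_div,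
        show 1 - a = b by linarith, div_self hb.ne']

end Averages

/-! ### Viscosity solutions coincide with the value functional -/

/-- A continuous function whose rate of decrease is bounded everywhere by a constant and almost
everywhere by `q` decreases by at most `∫ q`: adding a multiple of the time makes it monotone, and
the integral of the derivative of a monotone function is at most its increment. -/
theorem sub_le_integral_of_local {Φ q : ℝ → ℝ} {a b C : ℝ} (hab : a ≤ b)
    (hΦ : ContinuousOn Φ (Icc a b)) (hq : IntervalIntegrable q volume a b)
    (h1 : ∀ s ∈ Ico a b, ∀ᶠ τ in 𝓝[>] s, Φ s - Φ τ ≤ C * (τ - s))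
    (h2 : ∀ᵐ s, s ∈ Ioo a b → ∀ ε > 0, ∀ᶠ τ in 𝓝[>] s, Φ s - Φ τ ≤ (q s + ε) * (τ - s)) :
    Φ a - Φ b ≤ ∫ ξ in a..b, q ξ := by
  set Z : ℝ → ℝ := fun τ => Φ τ + C * τ with hZ
  have hmono : MonotoneOn Z (Icc a b) := by
    intro s hs τ hτ hsτ
    have h3 : ∀ ⦃x⦄, x ∈ Icc s τ → -Φ x ≤ -Φ s + C * (x - s) := by
      refine image_le_of_liminf_slope_right_le_deriv_boundary (f := fun x => -Φ x)
        (B := fun x => -Φ s + C * (x - s)) (B' := fun _ => C)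
        ((hΦ.mono (Icc_subset_Icc hs.1 hτ.2)).neg) (by simp) (by fun_prop) (fun x _ => ?_) ?_
      · have h4 := (((hasDerivAt_id x).sub_const s).const_mul C).const_add (-Φ s)
        rw [mul_one] at h4
        exact h4.hasDerivWithinAt
      · intro x hx r hr
        refine Eventually.frequently ?_
        filter_upwards [h1 x ⟨hs.1.trans hx.1, hx.2.trans_le hτ.2⟩, self_mem_nhdsWithin]
          with z hz hxz
        have hxz' : 0 < z - x := sub_pos.2 hxz
        rw [slope_def_field, div_lt_iff₀ hxz']
        have := mul_lt_mul_of_pos_right hr hxz'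
        linarith
    have h5 := h3 ⟨hsτ, le_rfl⟩
    simp only [hZ]
    linarith
  rw [← uIcc_of_le hab] at hmono
  have hint := hmono.intervalIntegral_deriv_mem_uIcc
  have hZi := hmono.intervalIntegrable_deriv
  rw [uIcc_of_le hab] at hmono
  have hZab : 0 ≤ Z b - Z a := sub_nonneg.2 (hmono ⟨le_rfl, hab⟩ ⟨hab, le_rfl⟩ hab)
  rw [uIcc_of_le hZab] at hint
  have hle : ∫ ξ in a..b, (C - q ξ) ≤ ∫ ξ in a..b, deriv Z ξ := by
    refine intervalIntegral.integral_mono_ae_restrict hab (intervalIntegrable_const.sub hq) hZi ?_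
    refine (ae_restrict_iff' measurableSet_Icc).2 ?_
    filter_upwards [h2, hmono.ae_differentiableWithinAt_of_mem,
      compl_mem_ae_iff.2 (measure_singleton (μ := volume) a),
      compl_mem_ae_iff.2 (measure_singleton (μ := volume) b)] with s h3 h4 hsa hsb hs
    have hs' : s ∈ Ioo a b := ⟨lt_of_le_of_ne hs.1 (Ne.symm hsa), lt_of_le_of_ne hs.2 hsb⟩
    have hd := ((h4 hs).differentiableAt (Icc_mem_nhds hs'.1 hs'.2)).hasDerivAt
    refine le_of_forall_pos_le_add fun ε hε => ?_
    have hslope := (hasDerivAt_iff_tendsto_slope.1 hd).mono_left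
      (nhdsWithin_mono s (show Ioi s ⊆ {s}ᶜ from fun z hz => ne_of_gt hz))
    have h5 : C - q s - ε ≤ deriv Z s := by
      refine ge_of_tendsto hslope ?_
      filter_upwards [h3 hs' ε hε, self_mem_nhdsWithin] with z hz hsz
      have hsz' : 0 < z - s := sub_pos.2 hsz
      rw [slope_def_field, le_div_iff₀ hsz']
      simp only [hZ]
      linarith
    linarith
  rw [intervalIntegral.integral_sub intervalIntegrable_const hq, intervalIntegral.integral_const,
    smul_eq_mul] at hle
  have := hint.2
  simp only [hZ] at this
  linarith

section Viscosity

variable {n m : ℕ} {T : Horizon} {P : Bolza n m T} {c : ℝ} {φ : Pt n T → ℝ}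

namespace Bolza.Regular

/-- Near `(t, z)`, with the history frozen along the constant extension, `⟪f, p⟫ + f⁰` is almost
constant, uniformly in the control and in bounded `p`. -/
theorem exists_radius_abs_sub_le (R : P.Regular c) (g : Pt n T) {ε : ℝ} (hε : 0 < ε) (M : ℝ) :
    ∃ r > 0, ∀ τ : Icc g.t T.ϑ, (τ : ℝ) < g.t + r → ∀ ζ : Vec n, ‖ζ - g.z‖ < r →
      ∀ p : Vec n, ‖p‖ ≤ M → ∀ u ∈ P.U,
      |(inner ℝ (P.f τ ζ ((g.withState (line g 0) τ ζ).w (-T.h)) u) p +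
          P.f0 τ ζ ((g.withState (line g 0) τ ζ).w (-T.h)) u) -
        (inner ℝ (P.f g.t g.z (g.w (-T.h)) u) p + P.f0 g.t g.z (g.w (-T.h)) u)| ≤ ε := by
  have hη : 0 < ε / (|M| + 1) := by positivity
  have hηM : ε / (|M| + 1) * (|M| + 1) = ε := div_mul_cancel₀ _ (by positivity)
  obtain ⟨r, hr, hrh, h⟩ := exists_radius_of_eventually (g := g)
    (R.eventually_forall_control ⟨g.mem, trivial, trivial⟩ hη)
  refine ⟨r, hr, fun τ hτ ζ hζ p hp u hu => ?_⟩
  have hh := T.h_pos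
  have hw : (g.withState (line g 0) τ ζ).w (-T.h) = g.w (τ - T.h - g.t) := by
    change seg (line g 0) τ (-T.h) = _
    rw [seg_apply _ _ ⟨le_rfl, by linarith⟩, ← sub_eq_add_neg,
      line_of_lt (by linarith [τ.2.1]) (by linarith)]
  rw [hw]
  obtain ⟨h1, h2⟩ := h τ τ.2 hτ ζ hζ.le u hu
  simp only at h1 h2
  rw [add_sub_add_comm, ← inner_sub_left]
  refine (abs_add_le _ _).trans ?_
  have h3 := abs_real_inner_le_norm (P.f τ ζ (g.w (τ - T.h - g.t)) u -
    P.f g.t g.z (g.w (-T.h)) u) p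
  have h4 := mul_le_mul h1.le (hp.trans (le_abs_self M)) (norm_nonneg _) hη.le
  linarith

theorem continuousOn_pair (R : P.Regular c) {t : ℝ} (ht : t ∈ Icc T.t₀ T.ϑ) (x y : Vec n) :
    ContinuousOn (fun u => (P.f t x y u, P.f0 t x y u)) P.U := by
  have hc : Continuous (fun u : Vec m => (t, x, y, u)) := by fun_prop
  have hm : MapsTo (fun u : Vec m => (t, x, y, u)) P.U (Icc T.t₀ T.ϑ ×ˢ univ ×ˢ univ ×ˢ P.U) :=
    fun u hu => ⟨ht, trivial, trivial, hu⟩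
  have h1 := R.f1.1.comp hc.continuousOn hm
  have h2 := R.f1.2.comp hc.continuousOn hm
  exact h1.prodMk h2

/-- The subgradient inequality yields, through the mean value inequality for the convexified
velocity set, a short-time control along which `φ` plus the running cost almost decreases. Points
of the convexified set are averages of the values at `(t, z, w(-h))` over a control on the time step,
and over so short a time these determine the motion and the running cost up to first order. -/
theorem exists_control_step (R : P.Regular c) (hφ : InPhi φ)
    (hsub : ∀ g : Pt n T, g.t < T.ϑ → ∀ p ∈ subdiff φ g,
      p.1 + P.H g.t g.z (g.w (-T.h)) p.2 ≤ 0) {ε : ℝ} (hε : 0 < ε) (g : Pt n T) (hg : g.t < T.ϑ) :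
    ∃ u ∈ P.controls g.t, ∃ τ : Icc g.t T.ϑ, g.t < τ ∧
      φ (g.along (P.mot g u) τ) + ∫ ξ in g.t..τ, P.run (P.mot g u) u ξ ≤
        φ g + ε * (τ - g.t) := by
  set k₁ : Vec m → Vec n := fun u => P.f g.t g.z (g.w (-T.h)) u with hk₁
  set k₂ : Vec m → ℝ := fun u => P.f0 g.t g.z (g.w (-T.h)) u with hk₂
  have hk : ContinuousOn (fun u => (k₁ u, k₂ u)) P.U := R.continuousOn_pair g.mem _ _
  set C := closure (convexHull ℝ ((fun u => (k₁ u, k₂ u)) '' P.U)) with hC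
  have hCc : IsCompact C := by
    refine Metric.isCompact_of_isClosed_isBounded isClosed_closure ?_
    exact ((isBounded_convexHull.2 (R.compact.image_of_continuousOn hk).isBounded)).closure
  have hCx : Convex ℝ C := (convex_convexHull ℝ _).closure
  have hCm : ∀ u ∈ P.U, (k₁ u, k₂ u) ∈ C := fun u hu =>
    subset_closure (subset_convexHull ℝ _ ⟨u, hu, rfl⟩)
  have hCn : C.Nonempty := let ⟨u, hu⟩ := R.nonempty; ⟨_, hCm u hu⟩
  obtain ⟨r₁, hr₁, hmvi⟩ := exists_decrease_of_subdiff (g := g) hφ hCc hCx hCn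
    (fun ε' hε' M => by
      obtain ⟨r, hr, h⟩ := R.exists_radius_abs_sub_le g (half_pos hε') M
      refine ⟨r, hr, fun τ hτ hτr ζ hζ p hp hpM => ?_⟩
      obtain ⟨u, hu, hlt⟩ := R.exists_lt_H_add τ ζ ((g.withState (line g 0) τ ζ).w (-T.h)) p.2
        (half_pos hε')
      refine ⟨_, hCm u hu, ?_⟩
      have h1 := (abs_le.1 (h τ hτr ζ hζ p.2 hpM u hu)).1
      have h2 : p.1 + P.H τ ζ ((g.withState (line g 0) τ ζ).w (-T.h)) p.2 ≤ 0 :=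
        hsub (g.withState (line g 0) τ ζ) hτ p hp
      simp only [hk₁, hk₂]
      linarith)
    (show 0 < ε / 4 by linarith)
  obtain ⟨L, hL0, hL⟩ : ∃ L ≥ 0, ∀ q ∈ C, ‖q.1‖ ≤ L := by
    obtain ⟨L, hL⟩ := hCc.isBounded.exists_norm_le
    exact ⟨max L 0, le_max_right _ _, fun q hq =>
      (norm_fst_le q).trans ((hL q hq).trans (le_max_left _ _))⟩
  obtain ⟨α, hα, hgα⟩ := exists_mem_bounded g
  obtain ⟨Bw, hBw0, hBw⟩ := g.w.exists_bound
  set r := radius T c α with hr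
  have hr0 : 0 ≤ r := hα.le.trans (le_radius R.c_pos hα.le)
  have hc0 := R.c_pos.le
  set M := c * (1 + r + r) with hM
  have hM0 : 0 ≤ M := by positivity
  set B := Bw + r + ‖g.z‖ + 1 with hB
  obtain ⟨lam, hlam0, hlam⟩ := hφ.2 B (by positivity)
  have hη : 0 < ε / (8 * (lam + 1)) := by positivity
  set η := ε / (8 * (lam + 1)) with hηd
  have hηlam : (lam + 1) * η = ε / 8 := by rw [hηd]; field_simp
  obtain ⟨r₂, hr₂, hr₂h, htube⟩ := exists_radius_of_eventually (g := g)
    (R.eventually_forall_control ⟨g.mem, trivial, trivial⟩ hη)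
  -- the length of the time step
  obtain ⟨δ, hδ0, hδϑ, hδr₁, hδr₂, hδL, hδM, hδlam⟩ : ∃ δ > 0, δ ≤ T.ϑ - g.t ∧ δ < r₁ ∧ δ < r₂ ∧
      δ * L ≤ 1 ∧ M * δ ≤ r₂ ∧ lam * M * δ ≤ ε / 4 := by
    refine ⟨min (min (T.ϑ - g.t) (r₁ / 2)) (min (min (r₂ / (2 * (M + 1))) (1 / (L + 1)))
      (ε / (4 * (lam * M + 1)))), ?_, ?_, ?_, ?_, ?_, ?_, ?_⟩
    · have := sub_pos.2 hg
      positivity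
    · exact (min_le_left _ _).trans (min_le_left _ _)
    · exact ((min_le_left _ _).trans (min_le_right _ _)).trans_lt (by linarith)
    all_goals
      set δ := min (min (T.ϑ - g.t) (r₁ / 2)) (min (min (r₂ / (2 * (M + 1))) (1 / (L + 1)))
        (ε / (4 * (lam * M + 1)))) with hδ
      have hδ0 : 0 < δ := by
        have := sub_pos.2 hg
        positivity
      have h1 : δ ≤ r₂ / (2 * (M + 1)) :=
        (min_le_right _ _).trans ((min_le_left _ _).trans (min_le_left _ _))
      have h2 : δ ≤ 1 / (L + 1) :=
        (min_le_right _ _).trans ((min_le_left _ _).trans (min_le_right _ _))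
      have h3 : δ ≤ ε / (4 * (lam * M + 1)) := (min_le_right _ _).trans (min_le_right _ _)
      rw [le_div_iff₀ (by positivity)] at h1 h2 h3
      have h4 : 0 ≤ M * δ := by positivity
    · linarith
    · linarith
    · linarith
    · linarith
  set τ : Icc g.t T.ϑ := ⟨g.t + δ, by linarith, by linarith⟩ with hτd
  have hτ : (τ : ℝ) = g.t + δ := rfl
  have hτδ : (τ : ℝ) - g.t = δ := by rw [hτ]; ring
  obtain ⟨q, hq, hqle⟩ := hmvi τ (by linarith) (by linarith)
  rw [hτδ] at hqle
  obtain ⟨q', hq', hqq'⟩ := Metric.mem_closure_iff.1 hq η hη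
  obtain ⟨u₀, hu₀, hu₀U, hu₀q⟩ := exists_integral_eq_of_mem_convexHull R.compact hk hq'
  -- the control that realises `q'` on average
  set v : ℝ → Vec m := fun ξ => u₀ (ξ / δ - g.t / δ) with hv
  have hvm : Measurable v := hu₀.comp ((measurable_id.div_const δ).sub_const _)
  have hvU : ∀ ξ, v ξ ∈ P.U := fun ξ => hu₀U _
  have hvc : v ∈ P.controls g.t := controls_of_measurable hvm hvU
  have hvi := intervalIntegrable_comp_control R.compact hk hvm hvU g.t τ
  have hvq : ∫ ξ in g.t..τ, (k₁ (v ξ), k₂ (v ξ)) = δ • q' := by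
    rw [← hu₀q, intervalIntegral.integral_comp_div_sub (fun ξ => (k₁ (u₀ ξ), k₂ (u₀ ξ)))
      hδ0.ne', sub_self, ← sub_div, hτδ, div_self hδ0.ne']
  have hv1 : ∫ ξ in g.t..τ, k₁ (v ξ) = δ • q'.1 := by
    have h1 := (ContinuousLinearMap.fst ℝ (Vec n) ℝ).intervalIntegral_comp_comm hvi
    rw [hvq] at h1
    exact h1
  have hv2 : ∫ ξ in g.t..τ, k₂ (v ξ) = δ * q'.2 := by
    have h1 := (ContinuousLinearMap.snd ℝ (Vec n) ℝ).intervalIntegral_comp_comm hvi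
    rw [hvq] at h1
    exact h1
  refine ⟨v, hvc, τ, by linarith, ?_⟩
  rw [hτδ]
  set x := P.mot g v with hxd
  have hxX : x ∈ X c g := R.mot_mem_X hvc
  have hxr : ∀ ξ, ‖x ξ‖ ≤ r := norm_le_radius_of_mem_X R.c_pos hα.le hgα hxX
  have hxz : ∀ ξ ∈ Icc g.t (τ : ℝ), ‖x ξ - g.z‖ ≤ M * δ := by
    intro ξ hξ
    have h1 := norm_sub_le_mul_of_mem_X R.c_pos hxX hxr ⟨le_rfl, g.mem.2⟩
      ⟨hξ.1, hξ.2.trans τ.2.2⟩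
    rw [hxX.1.2.1] at h1
    exact h1.trans (mul_le_mul_of_nonneg_left (by linarith [hξ.2]) hM0)
  have hnear : ∀ ξ ∈ Icc g.t (τ : ℝ), ‖P.vel x v ξ - k₁ (v ξ)‖ < η ∧
      |P.run x v ξ - k₂ (v ξ)| < η := by
    intro ξ hξ
    have h1 := htube ξ ⟨hξ.1, hξ.2.trans τ.2.2⟩ (by linarith [hξ.2]) (x ξ)
      ((hxz ξ hξ).trans hδM) (v ξ) (hvU ξ)
    rw [← apply_sub_of_mem_Lam hxX.1 hξ.1 (by linarith [hξ.2])] at h1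
    exact h1
  have hveli := intervalIntegrable_sub (R.intervalIntegrable_vel g.mem hvc x) le_rfl τ.2.1 τ.2.2
  have hruni := intervalIntegrable_sub (R.intervalIntegrable_run g.mem hvc x) le_rfl τ.2.1 τ.2.2
  have hk1i : IntervalIntegrable (fun ξ => k₁ (v ξ)) volume g.t τ := ⟨hvi.1.fst, hvi.2.fst⟩
  have hk2i : IntervalIntegrable (fun ξ => k₂ (v ξ)) volume g.t τ := ⟨hvi.1.snd, hvi.2.snd⟩
  have hdx : ‖x τ - g.z - δ • q'.1‖ ≤ η * δ := by
    have h1 := eq_add_integral_of_isMotion (R.isMotion_mot hvc) (s := g.t) ⟨le_rfl, g.mem.2⟩ τ.2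
    rw [← hxd, hxX.1.2.1] at h1
    rw [h1, add_sub_cancel_left, ← hv1, ← intervalIntegral.integral_sub hveli hk1i]
    have h2 := intervalIntegral.norm_integral_le_of_norm_le_const (a := g.t) (b := τ)
      (f := fun ξ => P.vel x v ξ - k₁ (v ξ)) (C := η) fun ξ hξ => by
        rw [uIoc_of_le τ.2.1] at hξ
        exact (hnear ξ (Ioc_subset_Icc_self hξ)).1.le
    rwa [hτδ, abs_of_pos hδ0] at h2
  have hdr : |(∫ ξ in g.t..τ, P.run x v ξ) - δ * q'.2| ≤ η * δ := by
    rw [← hv2, ← intervalIntegral.integral_sub hruni hk2i, ← Real.norm_eq_abs]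
    have h2 := intervalIntegral.norm_integral_le_of_norm_le_const (a := g.t) (b := τ)
      (f := fun ξ => P.run x v ξ - k₂ (v ξ)) (C := η) fun ξ hξ => by
        rw [uIoc_of_le τ.2.1] at hξ
        exact (hnear ξ (Ioc_subset_Icc_self hξ)).2.le
    rwa [hτδ, abs_of_pos hδ0] at h2
  rw [dist_eq_norm] at hqq'
  have hq1 : ‖q.1 - q'.1‖ ≤ η := (norm_fst_le (q - q')).trans hqq'.le
  have hq2 : |q.2 - q'.2| ≤ η := (norm_snd_le (q - q')).trans hqq'.le
  have hstate : ‖x τ - (g.z + δ • q.1)‖ ≤ 2 * η * δ := by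
    have h1 : x τ - (g.z + δ • q.1) = (x τ - g.z - δ • q'.1) - δ • (q.1 - q'.1) := by
      rw [smul_sub]; abel
    rw [h1]
    refine (norm_sub_le _ _).trans ?_
    rw [norm_smul, Real.norm_eq_abs, abs_of_pos hδ0]
    have := mul_le_mul_of_nonneg_left hq1 hδ0.le
    linarith
  have hw : ∀ ξ, ‖g.w ξ‖ ≤ B := fun ξ => by linarith [hBw ξ, norm_nonneg g.z]
  have hcmp := (abs_le.1 (abs_sub_withState_le hlam0.le hlam hxX.1 (line_mem_Lam g 0)
    (fun ξ => (hxr ξ).trans (by linarith [norm_nonneg g.z]))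
    (norm_line_zero_le hw (by linarith)) (ζ := x τ) (ζ' := g.z + δ • q.1)
    ((hxr τ).trans (by linarith [norm_nonneg g.z])) (by
      refine (norm_add_le _ _).trans ?_
      rw [norm_smul, Real.norm_eq_abs, abs_of_pos hδ0]
      have := mul_le_mul_of_nonneg_left (hL q hq) hδ0.le
      linarith) (τ := τ) (D := M * δ) (by positivity) (fun ξ hξ => by
        rw [line_of_mem ⟨hξ.1, hξ.2.trans τ.2.2⟩, smul_zero, add_zero]
        exact hxz ξ hξ))).2
  rw [hτδ] at hcmp
  change φ (g.along x τ) - _ ≤ _ at hcmp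
  have h1 := mul_le_mul_of_nonneg_left hstate hlam0.le
  have h2 := (abs_le.1 hdr).2
  have h3 := mul_le_mul_of_nonneg_left (abs_le.1 hq2).1 hδ0.le
  have h4 := mul_le_mul_of_nonneg_right hδlam hδ0.le
  have h5 := congrArg (· * δ) hηlam
  have h6 : 0 ≤ ε * δ := by positivity
  linarith

/-- Concatenating the short-time controls of `exists_control_step` gives a control whose cost is
almost at most `φ`. -/
theorem value_le_of_subdiff (R : P.Regular c) (hφ : InPhi φ) (hterm : P.Terminal φ)
    (hsub : ∀ g : Pt n T, g.t < T.ϑ → ∀ p ∈ subdiff φ g,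
      p.1 + P.H g.t g.z (g.w (-T.h)) p.2 ≤ 0) (g : Pt n T) : P.value g ≤ φ g := by
  refine le_of_forall_pos_le_add fun ε hε => ?_
  have hpos : 0 < ε / (T.ϑ - g.t + 1) := div_pos hε (by linarith [g.mem.2])
  obtain ⟨u, hu, hle⟩ := R.exists_control_of_local hφ (q := P.f0)
    (fun g u hu => R.intervalIntegrable_run g.mem hu (P.mot g u))
    (R.exists_control_step hφ hsub hpos) g
  have h1 : P.J g u = φ (g.along (P.mot g u) ⟨T.ϑ, g.mem.2, le_rfl⟩) +
      ∫ ξ in g.t..T.ϑ, P.f0 ξ (P.mot g u ξ) (P.mot g u (ξ - T.h)) (u ξ) := by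
    rw [J, cost, ← hterm]
    rfl
  have h2 := R.value_le_J hu
  have h3 : ε / (T.ϑ - g.t + 1) * (T.ϑ - g.t) ≤ ε := by
    rw [div_mul_eq_mul_div, div_le_iff₀ (by linarith [g.mem.2])]
    nlinarith [g.mem.2]
  linarith

/-- The supergradient inequality bounds the rate of decrease of `φ` along a path from below by the
running cost of any constant control `u`, up to the deviation of the path from the velocity that
`u` generates. -/
theorem eventually_le_along (R : P.Regular c) (hφ : InPhi φ)
    (hsup : ∀ g : Pt n T, g.t < T.ϑ → ∀ q ∈ superdiff φ g,
      0 ≤ q.1 + P.H g.t g.z (g.w (-T.h)) q.2) {g : Pt n T} {B lam M : ℝ} (hlam0 : 0 ≤ lam)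
    (hlam : LipschitzOnBounded φ B lam) (hw : ∀ ξ, ‖g.w ξ‖ ≤ B)
    (hz : ‖g.z‖ + 1 ≤ B) {x : PC n (g.t - T.h) T.ϑ} (hx : x ∈ Lam g) (hxB : ∀ ξ, ‖x ξ‖ ≤ B)
    (hM : 0 ≤ M) (hxM : ∀ ξ ∈ Icc g.t T.ϑ, ‖x ξ - g.z‖ ≤ M * (ξ - g.t)) {u : Vec m}
    (hu : u ∈ P.U) {ε : ℝ} (hε : 0 < ε) :
    ∃ r > 0, ∀ τ : Icc g.t T.ϑ, g.t < τ → (τ : ℝ) < g.t + r →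
      φ g ≤ φ (g.along x τ) + (τ - g.t) * P.f0 g.t g.z (g.w (-T.h)) u +
        lam * ‖x τ - g.z - ((τ : ℝ) - g.t) • P.f g.t g.z (g.w (-T.h)) u‖ + ε * (τ - g.t) := by
  set k₁ := P.f g.t g.z (g.w (-T.h)) u with hk₁
  set k₂ := P.f0 g.t g.z (g.w (-T.h)) u with hk₂
  obtain ⟨r₁, hr₁, hmvi⟩ := exists_decrease_of_subdiff (φ := -φ) (g := g) (C := {(k₁, -k₂)})
    hφ.neg isCompact_singleton (convex_singleton _) (singleton_nonempty _)
    (fun ε' hε' K => by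
      obtain ⟨r, hr, h⟩ := R.exists_radius_abs_sub_le g hε' K
      refine ⟨r, hr, fun τ hτ hτr ζ hζ p hp hpK => ⟨_, rfl, ?_⟩⟩
      have h1 : (-p.1, -p.2) ∈ superdiff φ (g.withState (line g 0) τ ζ) := by
        rw [mem_superdiff_iff, neg_neg, neg_neg]; exact hp
      have h2 : 0 ≤ -p.1 + P.H τ ζ ((g.withState (line g 0) τ ζ).w (-T.h)) (-p.2) :=
        hsup (g.withState (line g 0) τ ζ) hτ _ h1
      have h3 := R.H_le ⟨g.mem.1.trans τ.2.1, τ.2.2⟩ ζ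
        ((g.withState (line g 0) τ ζ).w (-T.h)) (-p.2) hu
      have h4 := (abs_le.1 (h τ hτr ζ hζ (-p.2) (by rwa [norm_neg]) u hu)).2
      have h5 : inner ℝ k₁ (-p.2) = -inner ℝ k₁ p.2 := inner_neg_right _ _
      rw [← hk₁, ← hk₂, h5] at h4
      simp only
      linarith)
    (half_pos hε)
  refine ⟨min r₁ (min (1 / (‖k₁‖ + 1)) (ε / (2 * (lam * M + 1)))), by positivity,
    fun τ hτ hτr => ?_⟩
  set δ := (τ : ℝ) - g.t with hδ
  have hδ0 : 0 < δ := sub_pos.2 hτ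
  have hδr : δ < min r₁ (min (1 / (‖k₁‖ + 1)) (ε / (2 * (lam * M + 1)))) := by linarith
  have hδ1 : δ < r₁ := hδr.trans_le (min_le_left _ _)
  have hδ2 : δ < 1 / (‖k₁‖ + 1) := hδr.trans_le ((min_le_right _ _).trans (min_le_left _ _))
  have hδ3 : δ < ε / (2 * (lam * M + 1)) :=
    hδr.trans_le ((min_le_right _ _).trans (min_le_right _ _))
  rw [lt_div_iff₀ (by positivity)] at hδ2 hδ3
  obtain ⟨q, rfl, hq⟩ := hmvi τ hτ (by linarith)
  simp only [Pi.neg_apply] at hq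
  have hcmp := (abs_le.1 (abs_sub_withState_le hlam0 hlam (line_mem_Lam g 0) hx
    (norm_line_zero_le hw hz) hxB (ζ := g.z + δ • k₁) (ζ' := x τ) (by
      refine (norm_add_le _ _).trans ?_
      rw [norm_smul, Real.norm_eq_abs, abs_of_pos hδ0]
      linarith) (hxB τ) (τ := τ) (D := M * δ) (by positivity) (fun ξ hξ => by
        rw [line_of_mem ⟨hξ.1, hξ.2.trans τ.2.2⟩, smul_zero, add_zero, norm_sub_rev]
        exact (hxM ξ ⟨hξ.1, hξ.2.trans τ.2.2⟩).trans
          (mul_le_mul_of_nonneg_left (by linarith [hξ.2]) hM)))).2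
  rw [← hδ] at hcmp
  change _ - φ (g.along x τ) ≤ _ at hcmp
  have h1 : ‖g.z + δ • k₁ - x τ‖ = ‖x τ - g.z - δ • k₁‖ := by
    rw [norm_sub_rev, sub_add_eq_sub_sub]
  rw [h1] at hcmp
  have h2 := mul_le_mul_of_nonneg_right hδ3.le hδ0.le
  have h3 : 0 ≤ δ * δ := by positivity
  linarith

/-- Along a motion, `φ` has a bounded rate of decrease, by comparison with a fixed element of `𝕌`. At
almost every time the motion has the velocity of its own control value, so that the rate is at most
the running cost. -/
theorem le_J_of_superdiff (R : P.Regular c) (hφ : InPhi φ) (hterm : P.Terminal φ)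
    (hsup : ∀ g : Pt n T, g.t < T.ϑ → ∀ q ∈ superdiff φ g,
      0 ≤ q.1 + P.H g.t g.z (g.w (-T.h)) q.2) {g : Pt n T} {u : ℝ → Vec m}
    (hu : u ∈ P.controls g.t) : φ g ≤ P.J g u := by
  obtain ⟨α, hα, hgα⟩ := exists_mem_bounded g
  set r := radius T c α with hr
  have hr0 : 0 ≤ r := hα.le.trans (le_radius R.c_pos hα.le)
  have hc0 := R.c_pos.le
  set M := c * (1 + r + r) with hM
  have hM0 : 0 ≤ M := by positivity
  obtain ⟨lam, hlam0, hlam⟩ := hφ.2 (r + 1) (by positivity)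
  set x := P.mot g u with hxd
  have hxX : x ∈ X c g := R.mot_mem_X hu
  have hxr : ∀ ξ, ‖x ξ‖ ≤ r := norm_le_radius_of_mem_X R.c_pos hα.le hgα hxX
  set Φ : ℝ → ℝ := fun τ => φ (g.along x (projIcc g.t T.ϑ g.mem.2 τ)) with hΦ
  have hΦc : Continuous Φ := hφ.continuous_along hxX.1
  have hΦτ : ∀ τ (hτ : τ ∈ Icc g.t T.ϑ), Φ τ = φ (g.along x ⟨τ, hτ⟩) := fun τ hτ => by
    simp only [hΦ, projIcc_of_mem g.mem.2 hτ]
  have hloc : ∀ s ∈ Ico g.t T.ϑ, ∀ v ∈ P.U, ∀ ε > 0, ∀ᶠ τ in 𝓝[>] s,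
      Φ s - Φ τ ≤ (τ - s) * P.f0 s (x s) (x (s - T.h)) v +
        lam * ‖x τ - x s - (τ - s) • P.f s (x s) (x (s - T.h)) v‖ + ε * (τ - s) := by
    intro s hs v hv ε hε
    have hh := T.h_pos
    set σ : Icc g.t T.ϑ := ⟨s, Ico_subset_Icc_self hs⟩ with hσ
    have htail : ∀ ξ, s - T.h ≤ ξ → tail g x σ ξ = x ξ := fun ξ hξ => tail_apply x σ hξ
    obtain ⟨d, hd, hle⟩ := R.eventually_le_along hφ hsup (g := g.along x σ) (x := tail g x σ)
      (M := M) hlam0.le hlam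
      (fun ξ => by
        by_cases hξ : ξ ∈ Icc (-T.h) 0
        · rw [along_w_apply _ _ _ hξ]; linarith [hxr (σ + ξ)]
        · rw [PC.zero_outside _ _ hξ, norm_zero]; positivity)
      (by rw [along_z]; linarith [hxr σ])
      (isMotion_tail (R.isMotion_mot hu) σ).1
      (fun ξ => by
        by_cases hξ : s - T.h ≤ ξ
        · rw [htail ξ hξ]; linarith [hxr ξ]
        · rw [(tail g x σ).zero_outside ξ fun h => hξ h.1, norm_zero]; positivity)
      hM0 (fun ξ hξ => by
        have hξ1 : s ≤ ξ := hξ.1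
        rw [htail ξ (by linarith), along_z]
        exact norm_sub_le_mul_of_mem_X R.c_pos hxX hxr (Ico_subset_Icc_self hs) hξ) hv hε
    have hwh : (g.along x σ).w (-T.h) = x (s - T.h) := by
      rw [along_w_apply _ _ _ ⟨le_rfl, by linarith⟩, ← sub_eq_add_neg]
    filter_upwards [Ioo_mem_nhdsGT (show s < min T.ϑ (s + d) from
      lt_min hs.2 (by linarith))] with τ hτ
    have hτϑ : τ ≤ T.ϑ := (hτ.2.trans_le (min_le_left _ _)).le
    have h1 := hle ⟨τ, hτ.1.le, hτϑ⟩ hτ.1 (hτ.2.trans_le (min_le_right _ _))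
    rw [along_along_tail, htail _ (by linarith [hτ.1]), hwh] at h1
    rw [hΦτ s (Ico_subset_Icc_self hs), hΦτ τ ⟨hs.1.trans hτ.1.le, hτϑ⟩]
    simp only [along_z] at h1
    change φ (g.along x σ) ≤ φ (g.along x ⟨τ, hs.1.trans hτ.1.le, hτϑ⟩) +
      (τ - s) * P.f0 s (x s) (x (s - T.h)) v +
        lam * ‖x τ - x s - (τ - s) • P.f s (x s) (x (s - T.h)) v‖ + ε * (τ - s) at h1
    linarith
  have hgrow : ∀ s, c * (1 + ‖x s‖ + ‖x (s - T.h)‖) ≤ M := fun s =>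
    mul_le_mul_of_nonneg_left (by linarith [hxr s, hxr (s - T.h)]) hc0
  have key := sub_le_integral_of_local (Φ := Φ) (q := P.run x u) (C := M + lam * (M + M) + 1)
    g.mem.2 hΦc.continuousOn (R.intervalIntegrable_run g.mem hu x)
    -- a crude bound for the rate of decrease at every time
    (fun s hs => by
      obtain ⟨v, hv⟩ := R.nonempty
      have hb := (R.f3 s ⟨g.mem.1.trans hs.1, hs.2.le⟩ (x s) (x (s - T.h)) v hv).trans (hgrow s)
      filter_upwards [hloc s hs v hv 1 one_pos, Ioo_mem_nhdsGT hs.2] with τ h1 hτ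
      have hδ0 : 0 ≤ τ - s := sub_nonneg.2 hτ.1.le
      have h2 := norm_sub_le_mul_of_mem_X R.c_pos hxX hxr (Ico_subset_Icc_self hs)
        ⟨hτ.1.le, hτ.2.le⟩
      have h3 : ‖x τ - x s - (τ - s) • P.f s (x s) (x (s - T.h)) v‖ ≤ (M + M) * (τ - s) := by
        refine (norm_sub_le _ _).trans ?_
        rw [norm_smul, Real.norm_eq_abs, abs_of_nonneg hδ0]
        have h4 : ‖P.f s (x s) (x (s - T.h)) v‖ ≤ M := by
          linarith [abs_nonneg (P.f0 s (x s) (x (s - T.h)) v)]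
        have := mul_le_mul_of_nonneg_left h4 hδ0
        linarith
      have h5 : P.f0 s (x s) (x (s - T.h)) v ≤ M := by
        linarith [le_abs_self (P.f0 s (x s) (x (s - T.h)) v),
          norm_nonneg (P.f s (x s) (x (s - T.h)) v)]
      have h6 := mul_le_mul_of_nonneg_left h5 hδ0
      have h7 := mul_le_mul_of_nonneg_left h3 hlam0.le
      linarith)
    -- the sharp bound at the points of differentiability
    (by
      filter_upwards [(ae_restrict_iff' measurableSet_Icc).1 (R.isMotion_mot hu).2]
        with s hder hs ε hε
      have hd := hder (Ioo_subset_Icc_self hs)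
      have hη : 0 < ε / (2 * lam) := by positivity
      have h1 := ((hasDerivAt_iff_isLittleO.1 hd).def hη).filter_mono
        (nhdsWithin_le_nhds (s := Ioi s))
      filter_upwards [h1, hloc s ⟨hs.1.le, hs.2⟩ (u s) (hu.2 s (Ioo_subset_Icc_self hs)) (ε / 2)
        (half_pos hε), self_mem_nhdsWithin] with τ h2 h3 hτ
      have hτ0 : 0 < τ - s := sub_pos.2 hτ
      rw [Real.norm_eq_abs, abs_of_pos hτ0] at h2
      have h4 := mul_le_mul_of_nonneg_left h2 hlam0.le
      have h5 : lam * (ε / (2 * lam) * (τ - s)) = ε / 2 * (τ - s) := by field_simp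
      rw [h5] at h4
      change _ ≤ (P.f0 s (x s) (x (s - T.h)) (u s) + ε) * (τ - s)
      linarith)
  have h1 : Φ g.t = φ g := by
    rw [hΦτ g.t ⟨le_rfl, g.mem.2⟩]
    exact hφ.along_self hxX.1
  have h2 : P.J g u = Φ T.ϑ + ∫ ξ in g.t..T.ϑ, P.run x u ξ := by
    rw [hΦτ T.ϑ ⟨g.mem.2, le_rfl⟩, J, cost, ← hterm]
    rfl
  rw [h2, ← h1]
  linarith

end Bolza.Regular

/-- Uniqueness: the subgradient inequality gives `ρ ≤ φ`, the supergradient inequality `φ ≤ ρ`. -/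
theorem IsViscositySolution.eq_value (R : P.Regular c) (h : IsViscositySolution P φ) :
    φ = P.value := by
  obtain ⟨hφ, hterm, h⟩ := h
  funext g
  refine le_antisymm ?_ (R.value_le_of_subdiff hφ hterm (fun g hg => (h g hg).1) g)
  refine (R.isGLB_value g).2 ?_
  rintro _ ⟨u, hu, rfl⟩
  exact R.le_J_of_superdiff hφ hterm (fun g hg => (h g hg).2) hu

end Viscosity

end DelayHJB

theorem theorem2 {n m : ℕ} (T : Horizon) (P : Bolza n m T) (c : ℝ)
    (hU : IsCompact P.U) (hU_ne : P.U.Nonempty) (hf1 : P.CondF1) (hf2 : P.CondF2)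
    (hc : 0 < c) (hf3 : P.CondF3 c) (hσ : P.CondSigma) :
    -- the value functional is well defined
    (∀ g : Pt n T, ∀ u ∈ P.controls g.t, ∃! x, P.IsMotion g u x) ∧
    (∀ g : Pt n T, IsGLB (P.costs g) (P.value g)) ∧
    -- the four statements are equivalent
    (∀ φ : Pt n T → ℝ, List.TFAE [
      φ = P.value,
      IsMinimaxSolution P c φ,
      SatisfiesDerivIneqs P c φ,
      IsViscositySolution P φ]) ∧
    -- existence, uniqueness and coincidence with the value functional
    (∃! φ : Pt n T → ℝ, IsMinimaxSolution P c φ) ∧ IsMinimaxSolution P c P.value ∧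
    (∃! φ : Pt n T → ℝ, IsViscositySolution P φ) ∧ IsViscositySolution P P.value := by
  have R : P.Regular c := ⟨hU, hU_ne, hf1, hf2, hc, hf3, hσ⟩
  have hmin := R.isMinimaxSolution_value
  have hvisc := (hmin.satisfiesDerivIneqs R).isViscositySolution
  refine ⟨fun g u hu => R.existsUnique_isMotion g hu, fun g => ?_, fun φ => ?_,
    ⟨P.value, hmin, fun φ h =>
      ((h.satisfiesDerivIneqs R).isViscositySolution).eq_value R⟩, hmin,
    ⟨P.value, hvisc, fun φ h => h.eq_value R⟩, hvisc⟩
  · rw [R.costs_eq g]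
    exact R.isGLB_value g
  · tfae_have 1 → 2 := by
      rintro rfl
      exact hmin
    tfae_have 2 → 3 := fun h => h.satisfiesDerivIneqs R
    tfae_have 3 → 4 := fun h => h.isViscositySolution
    tfae_have 4 → 1 := fun h => h.eq_value R
    tfae_finish
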